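/- Let $A\in\mathbb R^{m_A\times n}$, $B\in\mathbb R^{m_B\times n}$, $b\in\mathbb R^{m_A}$, $d\in\mathbb R^{m_B}$ and $P=\{x\in\mathbb R^n: Ax=b,\ Bx\le d\}$, where $\operatorname{rank}\binom AB=n$ (so that $P$ is pointed), $\binom AB$ is totally unimodular, and $P$ is integral (all vertices of $P$ are integral). Two vectors are called sign-compatible if $x_iy_i\ge 0$ for all $i$. The set $\mathcal C(A,B)$ of circuits consists of all $g\in\ker A\setminus\{0\}$ with coprime integer components for which $\operatorname{supp}(Bg)$ is inclusion-minimal among the sets $\operatorname{supp}(Bx)$, $x\in\ker A\setminus\{0\}$. A sign-compatible circuit walk from $v_1$ to $v_2$ with $k$ steps is a sequence $v_1=y_0,\dots,y_k=v_2$ with $y_{i+1}=y_i+\alpha_i g_i$, $\alpha_i>0$, $g_i\in\mathcal C(A,B)$ and $Bg_i$ sign-compatible with $B(v_2-v_1)$; it is integral if all $y_j$ are integral. For $u\in\ker A\setminus\{0\}$, Algorithm 4 (constructing sign-compatible sums) starts with $w:=u$, $D:=\binom AB$, $i:=1$ and repeats the following. Let $Z(w)=\{j:(Dw)_j=0\}$.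 If $\operatorname{rank}(D_{Z(w)})=n-1$, let $g_i$ be the circuit that is a positive multiple of $w$, put $\lambda_i:=\|w\|/\|g_i\|$, and return $g_1,\dots,g_i,\lambda_1,\dots,\lambda_i$. Otherwise let $g_i$ be any circuit such that $\operatorname{supp}(Bg_i)\subsetneq\operatorname{supp}(Bw)$ and $Bg_i$ is sign-compatible with $Bw$, put $\lambda_i:=\min\{(Bw)_j/(Bg_i)_j:(Bw)_j(Bg_i)_j>0\}$, and replace $w$ by $w-\lambda_ig_i$ and $i$ by $i+1$. For $u=0$ the output is the empty sum. Then for all integral points $v_1,v_2\in P$ and $u:=v_2-v_1$: 1. If $u\neq 0$, Algorithm 4 never gets stuck, whichever circuits it chooses, and it ends after at most $n-\operatorname{rank}(A)$ iterations. 2. Every output $g_1,\dots,g_k,\lambda_1,\dots,\lambda_k$ of Algorithm 4 satisfies $k\le n-\operatorname{rank}(A)$, and the points $y_j=v_1+\sum_{i\le j}\lambda_ig_i$ $(0\le j\le k)$ form an integral sign-compatible circuit walk from $v_1$ to $v_2$ that lies in $P$. 3. Such an output and the walk it defines can be computed in polynomial time: there is one program (a while-program with integer variables and arrays, under logarithmic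 cost) and one polynomial $p$ such that for all dimensions and all data as above the program, given $A,B,v_1,v_2$, computes an output $g_1,\dots,g_k,\lambda_1,\dots,\lambda_k$ of Algorithm 4 and the points $y_0,\dots,y_k$ in time at most $p(L)$, where $L$ is the sum of $m_A$, $m_B$, $n$ and the bit lengths of all entries of $A,B,v_1,v_2$. -/

import Mathlib

/-! ## Polyhedra, circuits and circuit walks -/

namespace CircuitWalk

/-- The polyhedron `{x ∈ ℝⁿ : A x = b, B x ≤ d}`. -/
def polyhedron {mA mB n : ℕ} (A : Matrix (Fin mA) (Fin n) ℝ) (B : Matrix (Fin mB) (Fin n) ℝ)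
    (b : Fin mA → ℝ) (d : Fin mB → ℝ) : Set (Fin n → ℝ) :=
  {x | A.mulVec x = b ∧ B.mulVec x ≤ d}

/-- A vector with integer components. -/
def IsIntegralVector {n : ℕ} (x : Fin n → ℝ) : Prop :=
  ∀ j, ∃ z : ℤ, x j = z

/-- A (pointed) polyhedron is integral if all its vertices are integral. -/
def IsIntegralPolyhedron {n : ℕ} (P : Set (Fin n → ℝ)) : Prop :=
  ∀ x ∈ P.extremePoints ℝ, IsIntegralVector x

/-- Two vectors are sign-compatible if they lie in a common orthant. -/
def SignCompatible {m : ℕ} (x y : Fin m → ℝ) : Prop :=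
  ∀ i, 0 ≤ x i * y i

/-- The set of circuits `𝓒(A,B)`: the `g ∈ ker A \ {0}` with coprime integer components for which
`B g` is support-minimal over `{B x : x ∈ ker A \ {0}}`. -/
def circuits {mA mB n : ℕ} (A : Matrix (Fin mA) (Fin n) ℝ) (B : Matrix (Fin mB) (Fin n) ℝ) :
    Set (Fin n → ℝ) :=
  {g | A.mulVec g = 0 ∧ g ≠ 0 ∧
    (∃ z : Fin n → ℤ, (∀ j, g j = z j) ∧ Finset.univ.gcd z = 1) ∧
    ∀ x : Fin n → ℝ, A.mulVec x = 0 → x ≠ 0 →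
      ¬ Function.support (B.mulVec x) ⊂ Function.support (B.mulVec g)}

/-- `y 0, …, y k` is a sign-compatible circuit walk from `v₁` to `v₂` with `k` steps, whose `i`-th
step has direction `g i` and length `α i`. (Values of `y` beyond `k`, and of `g`, `α` from `k` on,
are irrelevant.) -/
structure IsSignCompatibleCircuitWalk {mA mB n : ℕ} (A : Matrix (Fin mA) (Fin n) ℝ)
    (B : Matrix (Fin mB) (Fin n) ℝ) (v₁ v₂ : Fin n → ℝ) (k : ℕ)
    (y g : ℕ → Fin n → ℝ) (α : ℕ → ℝ) : Prop where
  start : y 0 = v₁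
  finish : y k = v₂
  circuit : ∀ i < k, g i ∈ circuits A B
  pos : ∀ i < k, 0 < α i
  step : ∀ i < k, y (i + 1) = y i + α i • g i
  signCompatible : ∀ i < k, SignCompatible (B.mulVec (g i)) (B.mulVec (v₂ - v₁))

/-- The points `y_j = v₁ + ∑_{i < j} lam_i g_i` visited when the summands are added one by one. -/
def walkPoint {n : ℕ} (v₁ : Fin n → ℝ) (g : ℕ → Fin n → ℝ) (lam : ℕ → ℝ) (j : ℕ) : Fin n → ℝ :=
  v₁ + ∑ i ∈ Finset.range j, lam i • g i

/-! ## The algorithm constructing sign-compatible sums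

The algorithm keeps a vector `w`, initially the target direction `u`. -/

/-- The rank of the rows of `D = (A;B)` that vanish on `w`. -/
noncomputable def zeroRank {mA mB n : ℕ} (A : Matrix (Fin mA) (Fin n) ℝ)
    (B : Matrix (Fin mB) (Fin n) ℝ) (w : Fin n → ℝ) : ℕ :=
  ((Matrix.fromRows A B).submatrix
    (Subtype.val : {j // (Matrix.fromRows A B).mulVec w j = 0} → Fin mA ⊕ Fin mB) id).rank

/-- The final iteration at `w`: the vanishing rows have rank `n - 1`, the last circuit `g` is the
one in direction `w`, and its coefficient is `‖w‖ / ‖g‖` (this ratio is the same for all norms,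
since `w` is a positive multiple of `g`). -/
def FinalStep {mA mB n : ℕ} (A : Matrix (Fin mA) (Fin n) ℝ) (B : Matrix (Fin mB) (Fin n) ℝ)
    (w g : Fin n → ℝ) (lam : ℝ) : Prop :=
  zeroRank A B w + 1 = n ∧ g ∈ circuits A B ∧ (∃ c : ℝ, 0 < c ∧ w = c • g) ∧ lam = ‖w‖ / ‖g‖

/-- A non-final iteration at `w`: the vanishing rows do not have rank `n - 1`; any circuit `g` with
`supp(B g) ⊊ supp(B w)` and `B g` sign-compatible with `B w` may be chosen; `lam` is the
minimum of the ratios `(B w)_j / (B g)_j` over the `j` with `(B w)_j (B g)_j > 0`; and `w` is replaced by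
`w' = w - lam g`. -/
def LoopStep {mA mB n : ℕ} (A : Matrix (Fin mA) (Fin n) ℝ) (B : Matrix (Fin mB) (Fin n) ℝ)
    (w g : Fin n → ℝ) (lam : ℝ) (w' : Fin n → ℝ) : Prop :=
  zeroRank A B w + 1 ≠ n ∧ g ∈ circuits A B ∧
    Function.support (B.mulVec g) ⊂ Function.support (B.mulVec w) ∧
    SignCompatible (B.mulVec g) (B.mulVec w) ∧
    IsLeast {r : ℝ | ∃ j, 0 < B.mulVec w j * B.mulVec g j ∧ r = B.mulVec w j / B.mulVec g j} lam ∧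
    w' = w - lam • g

/-- `t` non-final iterations from `u`, with current vectors `w 0 = u, w 1, …, w t`. -/
def IsPartialExecution {mA mB n : ℕ} (A : Matrix (Fin mA) (Fin n) ℝ)
    (B : Matrix (Fin mB) (Fin n) ℝ) (u : Fin n → ℝ) (t : ℕ)
    (w g : ℕ → Fin n → ℝ) (lam : ℕ → ℝ) : Prop :=
  w 0 = u ∧ ∀ i < t, LoopStep A B (w i) (g i) (lam i) (w (i + 1))

/-- `g 0, …, g (k-1)` and `lam 0, …, lam (k-1)` form a possible output of the algorithm for the
target `u`: `k - 1` non-final iterations followed by a final one. The zero target, for which there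
is nothing to do, has the empty output. -/
def IsOutput {mA mB n : ℕ} (A : Matrix (Fin mA) (Fin n) ℝ)
    (B : Matrix (Fin mB) (Fin n) ℝ) (u : Fin n → ℝ) (k : ℕ)
    (g : ℕ → Fin n → ℝ) (lam : ℕ → ℝ) : Prop :=
  (u = 0 ∧ k = 0) ∨
  (u ≠ 0 ∧ ∃ (t : ℕ) (w : ℕ → Fin n → ℝ), k = t + 1 ∧
    IsPartialExecution A B u t w g lam ∧ FinalStep A B (w t) (g t) (lam t))

/-! ## Machine model

While-programs over integer variables and integer two-dimensional arrays with arbitrary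
(computed) addresses, under logarithmic cost: evaluating an expression costs the sum of the bit
lengths of all values that occur in it, so every operand, address and result is paid for by
its length. -/

/-- Number of bits of an integer, including one for the sign. -/
def bitLength (z : ℤ) : ℕ := z.natAbs.size + 1

/-- A memory: variables and two-dimensional arrays. -/
structure State where
  var : ℕ → ℤ
  arr : ℕ → ℤ → ℤ → ℤ

/-- Expressions; `read a i j` is the entry of array number `a` in row `i` and column `j`. -/
inductive Expr where
  | const (c : ℤ)
  | var (x : ℕ)
  | read (a : ℕ) (i j : Expr)
  | add (e f : Expr)
  | sub (e f : Expr)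
  | mul (e f : Expr)
  | div (e f : Expr)
  | le (e f : Expr)
  | eq (e f : Expr)

/-- Value of an expression. Division rounds down for a positive divisor, with `x / 0 = 0`;
comparisons give `1` (true) or `0` (false). -/
def Expr.eval (σ : State) : Expr → ℤ
  | .const c => c
  | .var x => σ.var x
  | .read a i j => σ.arr a (i.eval σ) (j.eval σ)
  | .add e f => e.eval σ + f.eval σ
  | .sub e f => e.eval σ - f.eval σ
  | .mul e f => e.eval σ * f.eval σ
  | .div e f => e.eval σ / f.eval σ
  | .le e f => if e.eval σ ≤ f.eval σ then 1 else 0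
  | .eq e f => if e.eval σ = f.eval σ then 1 else 0

/-- Logarithmic cost of evaluating an expression: total bit length of the values of all
subexpressions. -/
def Expr.cost (σ : State) : Expr → ℕ
  | .const c => bitLength c
  | .var x => bitLength (σ.var x)
  | .read a i j => i.cost σ + j.cost σ + bitLength (Expr.eval σ (.read a i j))
  | .add e f => e.cost σ + f.cost σ + bitLength (Expr.eval σ (.add e f))
  | .sub e f => e.cost σ + f.cost σ + bitLength (Expr.eval σ (.sub e f))
  | .mul e f => e.cost σ + f.cost σ + bitLength (Expr.eval σ (.mul e f))
  | .div e f => e.cost σ + f.cost σ + bitLength (Expr.eval σ (.div e f))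
  | .le e f => e.cost σ + f.cost σ + bitLength (Expr.eval σ (.le e f))
  | .eq e f => e.cost σ + f.cost σ + bitLength (Expr.eval σ (.eq e f))

/-- Programs. A condition holds if its value is nonzero. -/
inductive Program where
  | skip
  | assign (x : ℕ) (e : Expr)
  | write (a : ℕ) (i j e : Expr)
  | seq (p q : Program)
  | ite (e : Expr) (p q : Program)
  | loop (e : Expr) (p : Program)

/-- The memory after `x := z`. -/
def State.setVar (σ : State) (x : ℕ) (z : ℤ) : State :=
  { σ with var := fun x' => if x' = x then z else σ.var x' }

/-- The memory after `a[i,j] := z`. -/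
def State.setArr (σ : State) (a : ℕ) (i j z : ℤ) : State :=
  { σ with arr := fun a' i' j' => if a' = a ∧ i' = i ∧ j' = j then z else σ.arr a' i' j' }

/-- `Exec p σ σ' c`: started in memory `σ`, program `p` halts in memory `σ'` after time `c`. -/
inductive Exec : Program → State → State → ℕ → Prop where
  | skip (σ : State) : Exec .skip σ σ 1
  | assign (σ : State) (x : ℕ) (e : Expr) :
      Exec (.assign x e) σ (σ.setVar x (e.eval σ)) (e.cost σ + 1)
  | write (σ : State) (a : ℕ) (i j e : Expr) :
      Exec (.write a i j e) σ (σ.setArr a (i.eval σ) (j.eval σ) (e.eval σ))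
        (i.cost σ + j.cost σ + e.cost σ + 1)
  | seq {p q : Program} {σ σ' σ'' : State} {c c' : ℕ} :
      Exec p σ σ' c → Exec q σ' σ'' c' → Exec (.seq p q) σ σ'' (c + c')
  | iteTrue {e : Expr} {p q : Program} {σ σ' : State} {c : ℕ} :
      e.eval σ ≠ 0 → Exec p σ σ' c → Exec (.ite e p q) σ σ' (e.cost σ + 1 + c)
  | iteFalse {e : Expr} {p q : Program} {σ σ' : State} {c : ℕ} :
      e.eval σ = 0 → Exec q σ σ' c → Exec (.ite e p q) σ σ' (e.cost σ + 1 + c)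
  | loopTrue {e : Expr} {p : Program} {σ σ' σ'' : State} {c c' : ℕ} :
      e.eval σ ≠ 0 → Exec p σ σ' c → Exec (.loop e p) σ' σ'' c' →
        Exec (.loop e p) σ σ'' (e.cost σ + 1 + c + c')
  | loopFalse {e : Expr} {p : Program} {σ : State} :
      e.eval σ = 0 → Exec (.loop e p) σ σ (e.cost σ + 1)

/-- The entries of an integer matrix as an array, with zeros outside of it. -/
def toArray {r s : ℕ} (M : Matrix (Fin r) (Fin s) ℤ) (i j : ℤ) : ℤ :=
  if h : (0 ≤ i ∧ i.toNat < r) ∧ (0 ≤ j ∧ j.toNat < s) then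
    M ⟨i.toNat, h.1.2⟩ ⟨j.toNat, h.2.2⟩ else 0

/-- The initial memory for the input `A, B, v₁, v₂`: variables `0, 1, 2` hold `m_A, m_B, n`; arrays
`0, 1` hold `A, B`; the zeroth rows of arrays `2, 3` hold `v₁, v₂`; all the rest is zero. -/
def inputState {mA mB n : ℕ} (A : Matrix (Fin mA) (Fin n) ℤ) (B : Matrix (Fin mB) (Fin n) ℤ)
    (v₁ v₂ : Fin n → ℤ) : State where
  var x := match x with
    | 0 => mA
    | 1 => mB
    | 2 => n
    | _ => 0
  arr a := match a with
    | 0 => toArray A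
    | 1 => toArray B
    | 2 => toArray (Matrix.of fun _ : Fin 1 => v₁)
    | 3 => toArray (Matrix.of fun _ : Fin 1 => v₂)
    | _ => fun _ _ => 0

/-- The size of the input `A, B, v₁, v₂`: the dimensions plus the bit lengths of all entries. -/
def inputSize {mA mB n : ℕ} (A : Matrix (Fin mA) (Fin n) ℤ) (B : Matrix (Fin mB) (Fin n) ℤ)
    (v₁ v₂ : Fin n → ℤ) : ℕ :=
  mA + mB + n + (∑ i, ∑ j, bitLength (A i j)) + (∑ i, ∑ j, bitLength (B i j)) +
    (∑ j, bitLength (v₁ j)) + ∑ j, bitLength (v₂ j)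

/-- Row `i` of array `a` of a memory, as a vector of `ℝⁿ`. -/
def State.row (σ : State) (n a i : ℕ) : Fin n → ℝ :=
  fun j => (σ.arr a (i : ℤ) ((j : ℕ) : ℤ) : ℝ)

end CircuitWalk

open CircuitWalk

/-! Call a nonzero vector extremal if the rows of `D = (A;B)` vanishing on it determine it up to
scaling (`SpansKernel`). By rank-nullity this is the test `rank = n - 1` of the algorithm, and the
circuits are exactly the extremal vectors in `ker A` with coprime integer entries.

Total unimodularity enters through `isSign_mulVec_of_span`: on an extremal `g` with coprime integer
entries, `D` takes only the values 0, 1, -1. If `(D g)_i ≠ 0`, then row `i` and the rows vanishing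
on `g` have trivial common kernel, so `n` of them form a matrix of determinant ±1; inverting it
shows that `(D g)_i` divides every entry of `g`. Hence all step lengths are integers and the
remainders `w` stay integral (`exists_ratio_eq_int`).

Subtracting a circuit up to the minimum ratio moves each entry of `B w` towards 0 without crossing
it (`within_sub`). So `v₂ - w` satisfies every inequality as a rowwise convex combination of `v₁`
and `v₂`. The kernel of the vanishing rows shrinks strictly, so their rank rises; it starts at `rank
A` or more and stays below `n`, which bounds the iterations. The algorithm is never stuck: from a
vector that is not extremal one can subtract a kernel vector of its vanishing rows, suitably
oriented, until a further row vanishes, and repeat until an extremal vector is reached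
(`exists_spansKernel`).

To compute circuits, the kernel of the vanishing rows is found by Gaussian elimination. A basis
normalised to unit vectors on its free coordinates is extremal for `D` with the identity appended,
again totally unimodular, so all numbers met during elimination are 0, 1, -1 (`KernelBasis.isSign`).
Every product the program needs then has a sign as a factor and can be written as a division. A
program without multiplication enlarges the largest value in memory by at most a constant factor per
step, so after polynomially many steps all bit lengths are polynomial; `Cmd.exec_compile` reads the
running time off the syntax. -/

namespace CircuitWalk

/-! ## Kernels of totally unimodular matrices -/

/-- An integer vector as a real vector. -/
def realVec {n : ℕ} (v : Fin n → ℤ) : Fin n → ℝ := fun j => (v j : ℝ)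

/-- An integer matrix as a real matrix. -/
def realMat {ι : Type*} {n : ℕ} (D : Matrix ι (Fin n) ℤ) : Matrix ι (Fin n) ℝ :=
  D.map (Int.cast : ℤ → ℝ)

/-- Being `0`, `1` or `-1`. -/
def IsSign (z : ℤ) : Prop := z = 0 ∨ z = 1 ∨ z = -1

theorem realMat_mulVec {ι : Type*} {n : ℕ} (D : Matrix ι (Fin n) ℤ) (v : Fin n → ℤ) (i : ι) :
    (realMat D).mulVec (realVec v) i = ((D.mulVec v i : ℤ) : ℝ) := by
  simp [realMat, realVec, Matrix.mulVec, dotProduct]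

/-- A trivial kernel means rank `n`, so a maximal linearly independent family of rows has exactly
`n` members and is an invertible square submatrix. -/
theorem exists_det_ne_zero {ι : Type*} [Fintype ι] {n : ℕ} (M : Matrix ι (Fin n) ℝ)
    (hM : ∀ x, M.mulVec x = 0 → x = 0) :
    ∃ f : Fin n → ι, (M.submatrix f id).det ≠ 0 := by
  obtain ⟨κ, a, ha, hsp, hli⟩ := exists_linearIndependent' ℝ M.row
  have hker : LinearMap.ker M.mulVecLin = ⊥ := by
    rw [LinearMap.ker_eq_bot']
    intro x hx
    exact hM x (by simpa using hx)
  have hrank : M.rank = n := by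
    have := LinearMap.finrank_range_add_finrank_ker M.mulVecLin
    rw [hker] at this
    simpa [Matrix.rank] using this
  have : Finite κ := Finite.of_injective a ha
  have := Fintype.ofFinite κ
  have hcard : Fintype.card κ = n := by
    have h1 := finrank_span_eq_card hli
    rw [hsp] at h1
    rw [Matrix.rank_eq_finrank_span_row] at hrank
    rw [← h1]
    exact hrank
  let e : Fin n ≃ κ := (Fintype.equivFinOfCardEq hcard).symm
  refine ⟨a ∘ e, ?_⟩
  have h2 : LinearIndependent ℝ (M.submatrix (a ∘ e) id).row := by
    have := hli.comp e e.injective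
    exact this
  rw [Matrix.linearIndependent_rows_iff_isUnit, Matrix.isUnit_iff_isUnit_det] at h2
  exact h2.ne_zero

/-- If an integer vector with coprime entries spans the kernel of some rows of a totally
unimodular matrix, then all rows take values `0`, `1`, `-1` on it. -/
theorem isSign_mulVec_of_span {ι : Type*} [Fintype ι] {n : ℕ} {E : Matrix ι (Fin n) ℤ}
    (hE : E.IsTotallyUnimodular) (S : Set ι) {g : Fin n → ℤ}
    (hgcd : Finset.univ.gcd g = 1) (hS : ∀ i ∈ S, E.mulVec g i = 0)
    (hspan : ∀ x : Fin n → ℝ, (∀ i ∈ S, (realMat E).mulVec x i = 0) → ∃ c : ℝ, x = c • realVec g)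
    (i : ι) : IsSign (E.mulVec g i) := by
  classical
  by_cases hi : E.mulVec g i = 0
  · exact Or.inl hi
  -- The rows in `S` cut the kernel down to the line through `g`, and row `i` is nonzero on `g`;
  -- together their kernel is trivial.
  let S' := {j : ι // j ∈ S ∨ j = i}
  obtain ⟨f, hf⟩ := exists_det_ne_zero ((realMat E).submatrix (Subtype.val : S' → ι) id) (by
    intro x hx
    have hx' : ∀ j, j ∈ S ∨ j = i → (realMat E).mulVec x j = 0 := fun j hj =>
      congrFun hx ⟨j, hj⟩
    obtain ⟨c, rfl⟩ := hspan x fun j hj => hx' j (Or.inl hj)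
    have := hx' i (Or.inr rfl)
    rw [Matrix.mulVec_smul, Pi.smul_apply, realMat_mulVec, smul_eq_mul, mul_eq_zero] at this
    rcases this with h | h
    · simp [h]
    · exact absurd (by exact_mod_cast h) hi)
  let M : Matrix (Fin n) (Fin n) ℤ := E.submatrix (fun k => (f k).1) id
  have hdet : ((M.det : ℤ) : ℝ) = (((realMat E).submatrix (Subtype.val : S' → ι) id).submatrix f
      id).det := by
    have : ((realMat E).submatrix (Subtype.val : S' → ι) id).submatrix f id
        = (Int.castRingHom ℝ).mapMatrix M := by
      ext a b; simp [M, realMat]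
    rw [this, ← RingHom.map_det]; simp
  have hunit : IsUnit M.det := by
    have h1 := (Matrix.isTotallyUnimodular_iff E).1 hE n (fun k => (f k).1) id
    obtain ⟨s, hs⟩ := h1
    have h0 : M.det ≠ 0 := by
      intro h; rw [← hdet, h] at hf; simp at hf
    change _ = M.det at hs
    cases s with
    | zero => simp at hs; exact absurd hs.symm h0
    | neg => simp at hs; rw [← hs]; simp
    | pos => simp at hs; rw [← hs]; simp
  -- Since `g` is killed by every selected row except `i`, `M g` is `(E g)_i` times a 0/1 vector,
  -- and the inverse of `M` is integral.
  have hdvd : E.mulVec g i ∣ Finset.univ.gcd g := by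
    have hMg : M.mulVec g = E.mulVec g i • fun k => if (f k).1 = i then 1 else 0 := by
      ext k
      have : M.mulVec g k = E.mulVec g (f k).1 := rfl
      rw [this]
      by_cases hk : (f k).1 = i
      · simp [hk]
      · rcases (f k).2 with h | h
        · simp [hk, hS _ h]
        · exact absurd h hk
    have hg : g = E.mulVec g i • M⁻¹.mulVec fun k => if (f k).1 = i then 1 else 0 := by
      rw [← Matrix.mulVec_smul, ← hMg, Matrix.mulVec_mulVec, Matrix.nonsing_inv_mul _ hunit,
        Matrix.one_mulVec]
    refine Finset.dvd_gcd fun j _ => ?_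
    rw [congrFun hg j]
    exact Dvd.intro _ rfl
  rw [hgcd] at hdvd
  exact Or.inr (Int.isUnit_iff.1 (isUnit_of_dvd_one hdvd))

theorem gcd_eq_one_of_isUnit {n : ℕ} {z : Fin n → ℤ} {k : Fin n} (h : IsUnit (z k)) :
    Finset.univ.gcd z = 1 := by
  rw [← Finset.normalize_gcd (s := Finset.univ) (f := z)]
  exact normalize_eq_one.2 (isUnit_of_dvd_unit (Finset.gcd_dvd (Finset.mem_univ k)) h)

/-- The rows of `T` with index in `U` form a basis of the common kernel of the rows of `D` with
index in `Z`, and are unit vectors when restricted to `U`. -/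
structure KernelBasis {ι : Type*} {n : ℕ} (D : Matrix ι (Fin n) ℤ) (Z : Set ι)
    (U : Finset (Fin n)) (T : Fin n → Fin n → ℤ) : Prop where
  diag : ∀ k ∈ U, ∀ l ∈ U, T k l = if k = l then 1 else 0
  ker : ∀ k ∈ U, ∀ i ∈ Z, D.mulVec (T k) i = 0
  span : ∀ x : Fin n → ℝ, (∀ i ∈ Z, (realMat D).mulVec x i = 0) →
    x = ∑ k ∈ U, x k • realVec (T k)

/-! ### Integral Gaussian elimination for kernels -/

namespace KernelBasis

variable {ι : Type*} {n : ℕ} {D : Matrix ι (Fin n) ℤ} {Z : Set ι} {U : Finset (Fin n)}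
  {T : Fin n → Fin n → ℤ}

theorem init (D : Matrix ι (Fin n) ℤ) {T : Fin n → Fin n → ℤ}
    (hT : ∀ k j, T k j = if k = j then 1 else 0) : KernelBasis D ∅ Finset.univ T where
  diag k _ l _ := hT k l
  ker k _ i hi := absurd hi (Set.notMem_empty i)
  span x _ := by
    ext j
    simp [realVec, hT]

theorem insert_of_zero (h : KernelBasis D Z U T) {i : ι}
    (hi : ∀ k ∈ U, D.mulVec (T k) i = 0) : KernelBasis D (insert i Z) U T where
  diag := h.diag
  ker k hk j hj := by
    rcases hj with rfl | hj
    · exact hi k hk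
    · exact h.ker k hk j hj
  span x hx := h.span x fun j hj => hx j (Or.inr hj)

/-- The pivot value is its own inverse, so elimination needs no fractions. The unit-vector pattern
on `U.erase p` survives because `T p` vanishes there; spanning survives because the new equation
expresses `x p` through the other free coordinates. -/
theorem insert_of_pivot (h : KernelBasis D Z U T) {i : ι} {p : Fin n} (hp : p ∈ U)
    (hpi : D.mulVec (T p) i * D.mulVec (T p) i = 1) {T' : Fin n → Fin n → ℤ}
    (hT : ∀ k ∈ U.erase p, ∀ j, T' k j = T k j - D.mulVec (T k) i * D.mulVec (T p) i * T p j) :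
    KernelBasis D (insert i Z) (U.erase p) T' := by
  have hT2 : ∀ k ∈ U.erase p, T' k = T k - (D.mulVec (T k) i * D.mulVec (T p) i) • T p := by
    intro k hk; ext j; simpa using hT k hk j
  refine ⟨fun k hk l hl => ?_, fun k hk j hj => ?_, fun x hx => ?_⟩
  · rw [hT k hk, h.diag k (Finset.mem_of_mem_erase hk) l (Finset.mem_of_mem_erase hl),
      h.diag p hp l (Finset.mem_of_mem_erase hl), if_neg (Finset.ne_of_mem_erase hl).symm]
    simp
  · have hk' := Finset.mem_of_mem_erase hk
    rw [hT2 k hk, Matrix.mulVec_sub, Matrix.mulVec_smul, Pi.sub_apply, Pi.smul_apply, smul_eq_mul]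
    rcases hj with rfl | hj
    · rw [mul_assoc, hpi]; ring
    · rw [h.ker k hk' j hj, h.ker p hp j hj]; ring
  · have h1 := h.span x fun j hj => hx j (Or.inr hj)
    rw [← Finset.add_sum_erase _ _ hp] at h1
    have h2 : (realMat D).mulVec x i = 0 := hx i (Or.inl rfl)
    have h3 : x p * (D.mulVec (T p) i : ℝ) +
        ∑ k ∈ U.erase p, x k * (D.mulVec (T k) i : ℝ) = 0 := by
      rw [h1, Matrix.mulVec_add, Matrix.mulVec_smul, Matrix.mulVec_sum] at h2
      simpa [Matrix.mulVec_smul, realMat_mulVec] using h2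
    have h4 : x p = - ∑ k ∈ U.erase p,
        x k * ((D.mulVec (T k) i : ℝ) * (D.mulVec (T p) i : ℝ)) := by
      have h5 : (D.mulVec (T p) i : ℝ) * (D.mulVec (T p) i : ℝ) = 1 := by exact_mod_cast hpi
      have h6 : ∑ k ∈ U.erase p, x k * ((D.mulVec (T k) i : ℝ) * (D.mulVec (T p) i : ℝ)) =
          (∑ k ∈ U.erase p, x k * (D.mulVec (T k) i : ℝ)) * (D.mulVec (T p) i : ℝ) := by
        rw [Finset.sum_mul]; exact Finset.sum_congr rfl fun k _ => by ring
      rw [h6]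
      linear_combination (-x p) * h5 + (D.mulVec (T p) i : ℝ) * h3
    rw [h4, neg_smul, Finset.sum_smul, ← sub_eq_neg_add, ← Finset.sum_sub_distrib] at h1
    refine h1.trans (Finset.sum_congr rfl fun k hk => ?_)
    ext j
    simp [realVec, hT k hk j]
    ring

theorem gcd_eq_one (h : KernelBasis D Z U T) {k : Fin n} (hk : k ∈ U) :
    Finset.univ.gcd (T k) = 1 :=
  gcd_eq_one_of_isUnit (k := k) (by rw [h.diag k hk k hk, if_pos rfl]; exact isUnit_one)

/-- `T k` is pinned down up to scaling by the rows in `Z` together with the unit rows of the free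
coordinates other than `k`. Appending the identity to `D` keeps it totally unimodular, so
`isSign_mulVec_of_span` controls the products with `D` and, through the unit rows, the entries of `T
k` itself. -/
theorem isSign [Fintype ι] (hD : D.IsTotallyUnimodular) (h : KernelBasis D Z U T) {k : Fin n}
    (hk : k ∈ U) : (∀ i, IsSign (D.mulVec (T k) i)) ∧ ∀ j, IsSign (T k j) := by
  have key := isSign_mulVec_of_span (E := Matrix.fromRows D (1 : Matrix (Fin n) (Fin n) ℤ))
    hD.fromRows_one (Sum.inl '' Z ∪ Sum.inr '' (U.erase k : Set (Fin n))) (h.gcd_eq_one hk) (by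
      rintro _ (⟨i, hi, rfl⟩ | ⟨l, hl, rfl⟩)
      · simpa [Matrix.fromRows_mulVec] using h.ker k hk i hi
      · have hl' := Finset.mem_coe.1 hl
        simpa [Matrix.fromRows_mulVec, (Finset.ne_of_mem_erase hl').symm] using
          h.diag k hk l (Finset.mem_of_mem_erase hl')) (by
      intro x hx
      refine ⟨x k, (h.span x fun i hi => ?_).trans (Finset.sum_eq_single_of_mem k hk ?_)⟩
      · have := hx (Sum.inl i) (Or.inl ⟨i, hi, rfl⟩)
        simpa [realMat, Matrix.fromRows_map, Matrix.fromRows_mulVec] using this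
      · intro l hl hlk
        have := hx (Sum.inr l) (Or.inr ⟨l, by simpa using ⟨hl, hlk⟩, rfl⟩)
        have h0 : x l = 0 := by
          simpa [realMat, Matrix.fromRows_map, Matrix.fromRows_mulVec, Matrix.map_one] using this
        simp [h0])
  refine ⟨fun i => ?_, fun j => ?_⟩
  · simpa [Matrix.fromRows_mulVec] using key (Sum.inl i)
  · simpa [Matrix.fromRows_mulVec] using key (Sum.inr j)

/-- The rows are imposed one at a time; `isSign` guarantees that each nonzero pivot is ±1. -/
theorem exists_of_finite [Fintype ι] (hD : D.IsTotallyUnimodular) (Z : Set ι) :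
    ∃ U T, KernelBasis D Z U T := by
  classical
  induction Z, Z.toFinite using Set.Finite.induction_on with
  | empty => exact ⟨_, _, init D (T := fun k j => if k = j then 1 else 0) fun _ _ => rfl⟩
  | @insert i Z _ _ ih =>
    obtain ⟨U, T, h⟩ := ih
    by_cases h0 : ∀ k ∈ U, D.mulVec (T k) i = 0
    · exact ⟨U, T, h.insert_of_zero h0⟩
    · push Not at h0
      obtain ⟨p, hp, hpi⟩ := h0
      refine ⟨U.erase p, _, h.insert_of_pivot hp ?_ (T' := fun k j =>
        T k j - D.mulVec (T k) i * D.mulVec (T p) i * T p j) fun _ _ _ => rfl⟩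
      rcases (h.isSign hD hp).1 i with h1 | h1 | h1
      · exact absurd h1 hpi
      · rw [h1]; rfl
      · rw [h1]; rfl

end KernelBasis

/-! ## Sign-compatible reduction -/

/-- The rows of `D` vanishing on `w` determine `w` up to scaling. -/
def SpansKernel {ι : Type*} {n : ℕ} (D : Matrix ι (Fin n) ℝ) (w : Fin n → ℝ) : Prop :=
  ∀ x, (∀ i, D.mulVec w i = 0 → D.mulVec x i = 0) → ∃ c : ℝ, x = c • w

/-- The ratios between the entries of `a` and those entries of `b` that have the same sign. -/
def ratios {ι : Type*} (a b : ι → ℝ) : Set ℝ := {r | ∃ j, 0 < a j * b j ∧ r = a j / b j}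

theorem ratio_pos {a b : ℝ} (h : 0 < a * b) : 0 < a / b := by
  rw [← mul_div_mul_right a b (right_ne_zero_of_mul h.ne')]
  exact div_pos h (mul_self_pos.2 (right_ne_zero_of_mul h.ne'))

theorem pos_of_isLeast_ratios {ι : Type*} {a b : ι → ℝ} {t : ℝ} (ht : IsLeast (ratios a b) t) :
    0 < t := by
  obtain ⟨j, hj, rfl⟩ := ht.1
  exact ratio_pos hj

/-- No entry changes sign: where `a` and `b` agree in sign, `t` is at most their ratio, and
elsewhere the product is `a i ^ 2` minus something nonpositive. -/
theorem sub_mul_nonneg_of_isLeast {ι : Type*} {a b : ι → ℝ} {t : ℝ}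
    (ht : IsLeast (ratios a b) t) (i : ι) : 0 ≤ (a i - t * b i) * a i := by
  have ht0 := pos_of_isLeast_ratios ht
  by_cases h : 0 < a i * b i
  · have h1 : t ≤ a i / b i := ht.2 ⟨i, h, rfl⟩
    have hb := right_ne_zero_of_mul h.ne'
    have h2 : (a i / b i - t) * (a i * b i) = (a i - t * b i) * a i := by field_simp
    rw [← h2]
    exact mul_nonneg (sub_nonneg.2 h1) h.le
  · nlinarith [mul_self_nonneg (a i), mul_nonneg ht0.le (sub_nonneg.2 (not_lt.1 h))]

theorem exists_isLeast_ratios {ι : Type*} [Finite ι] {a b : ι → ℝ} (h : ∃ j, 0 < a j * b j) :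
    ∃ t, IsLeast (ratios a b) t := by
  have hfin : (ratios a b).Finite := by
    refine (Set.finite_range fun j => a j / b j).subset ?_
    rintro r ⟨j, _, rfl⟩
    exact ⟨j, rfl⟩
  obtain ⟨j, hj⟩ := h
  obtain ⟨t, ht, hmin⟩ := Set.exists_min_image _ id hfin ⟨_, j, hj, rfl⟩
  exact ⟨t, ht, fun r hr => hmin r hr⟩

/-- The index attaining the minimum ratio leaves the support, and the inclusion of supports keeps
zeros of `a` at zero. -/
theorem support_sub_ssubset {ι : Type*} {a b : ι → ℝ} {t : ℝ} (ht : IsLeast (ratios a b) t)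
    (hb : Function.support b ⊆ Function.support a) :
    Function.support (a - t • b) ⊂ Function.support a := by
  refine Set.ssubset_iff_subset_ne.2 ⟨fun i hi ha => hi ?_, fun h => ?_⟩
  · have : b i = 0 := by by_contra hbi; exact hb hbi ha
    simp [ha, this]
  · obtain ⟨j, hj, rfl⟩ := ht.1
    have ha : j ∈ Function.support a := left_ne_zero_of_mul hj.ne'
    rw [← h] at ha
    apply ha
    have := right_ne_zero_of_mul hj.ne'
    simp [div_mul_cancel₀ _ this]

/-- `x` lies in the smallest sign cone containing `y`. -/
def ConformsTo {ι : Type*} (x y : ι → ℝ) : Prop :=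
  Function.support x ⊆ Function.support y ∧ ∀ i, 0 ≤ x i * y i

theorem ConformsTo.refl {ι : Type*} (x : ι → ℝ) : ConformsTo x x :=
  ⟨subset_rfl, fun _ => mul_self_nonneg _⟩

/-- The support inclusion is what makes this transitive; sign-compatibility alone is not, since a
zero entry of `y` would decouple `x` from `z`. -/
theorem ConformsTo.trans {ι : Type*} {x y z : ι → ℝ} (h : ConformsTo x y) (h' : ConformsTo y z) :
    ConformsTo x z := by
  refine ⟨h.1.trans h'.1, fun i => ?_⟩
  by_cases hx : x i = 0
  · simp [hx]
  have hy : y i ≠ 0 := h.1 hx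
  have h1 := mul_nonneg (h.2 i) (h'.2 i)
  have h2 : x i * y i * (y i * z i) = (x i * z i) * (y i * y i) := by ring
  rw [h2] at h1
  exact nonneg_of_mul_nonneg_left h1 (mul_self_pos.2 hy)

theorem conformsTo_sub {ι : Type*} {a b : ι → ℝ} {t : ℝ} (ht : IsLeast (ratios a b) t)
    (hb : Function.support b ⊆ Function.support a) : ConformsTo (a - t • b) a :=
  ⟨(support_sub_ssubset ht hb).1, sub_mul_nonneg_of_isLeast ht⟩

theorem eq_zero_of_mulVec_eq_zero {ι : Type*} [Finite ι] {n : ℕ} {D : Matrix ι (Fin n) ℝ}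
    (hD : D.rank = n) {x : Fin n → ℝ} (hx : D.mulVec x = 0) : x = 0 := by
  have := LinearMap.finrank_range_add_finrank_ker D.mulVecLin
  have h1 : Module.finrank ℝ (LinearMap.range D.mulVecLin) = n := hD
  rw [h1, Module.finrank_fin_fun] at this
  have h2 : LinearMap.ker D.mulVecLin = ⊥ := by
    rw [← Submodule.finrank_eq_zero (R := ℝ)]; omega
  exact LinearMap.ker_eq_bot'.1 h2 x (by simpa using hx)

/-- Among `x` and `-x` one has a ratio with `h`. -/
theorem exists_mul_pos_or {ι : Type*} [Finite ι] {n : ℕ} {D : Matrix ι (Fin n) ℝ} (hD : D.rank = n)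
    {h x : Fin n → ℝ} (hx : x ≠ 0)
    (hsupp : Function.support (D.mulVec x) ⊆ Function.support (D.mulVec h)) :
    (∃ j, 0 < D.mulVec h j * D.mulVec x j) ∨ ∃ j, 0 < D.mulVec h j * D.mulVec (-x) j := by
  have h1 : D.mulVec x ≠ 0 := fun h0 => hx (eq_zero_of_mulVec_eq_zero hD h0)
  obtain ⟨j, hj⟩ := Function.ne_iff.1 h1
  have h2 : D.mulVec h j ≠ 0 := hsupp hj
  rcases lt_or_gt_of_ne (mul_ne_zero h2 hj) with h3 | h3
  · right
    refine ⟨j, ?_⟩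
    rw [Matrix.mulVec_neg]
    simpa using h3
  · exact Or.inl ⟨j, h3⟩

theorem KernelBasis.exists_ne_zero {ι : Type*} {n : ℕ} {D : Matrix ι (Fin n) ℤ} {h : Fin n → ℝ}
    (h0 : h ≠ 0) {U : Finset (Fin n)} {T : Fin n → Fin n → ℤ}
    (hB : KernelBasis D {i | (realMat D).mulVec h i = 0} U T) : ∃ k ∈ U, h k ≠ 0 := by
  by_contra hc
  push Not at hc
  apply h0
  rw [hB.span h fun i hi => hi]
  exact Finset.sum_eq_zero fun k hk => by rw [hc k hk, zero_smul]

/-- A nonzero `h` is determined up to scaling by its zeros iff the corresponding kernel basis is a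
singleton. -/
theorem KernelBasis.spansKernel_iff {ι : Type*} {n : ℕ} {D : Matrix ι (Fin n) ℤ} {h : Fin n → ℝ}
    {U : Finset (Fin n)} {T : Fin n → Fin n → ℤ}
    (hB : KernelBasis D {i | (realMat D).mulVec h i = 0} U T) {k : Fin n} (hk : k ∈ U)
    (hk0 : h k ≠ 0) : SpansKernel (realMat D) h ↔ U = {k} := by
  have hh := hB.span h fun i hi => hi
  refine ⟨fun hs => ?_, fun hU x hx => ?_⟩
  · refine Finset.eq_singleton_iff_unique_mem.2 ⟨hk, fun l hl => ?_⟩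
    by_contra hlk
    obtain ⟨c, hc⟩ := hs (realVec (T l)) fun i hi => by
      rw [realMat_mulVec, hB.ker l hl i hi]; simp
    have h1 := congrFun hc k
    have h2 := congrFun hc l
    simp only [realVec, hB.diag l hl k hk, hB.diag l hl l hl, if_neg hlk, Pi.smul_apply,
      smul_eq_mul, Int.cast_zero] at h1 h2
    have hc0 : c = 0 := by
      rcases mul_eq_zero.1 h1.symm with h | h
      · exact h
      · exact absurd h hk0
    rw [hc0] at h2
    simp at h2
  · have hx2 := hB.span x fun i hi => hx i hi
    rw [hU, Finset.sum_singleton] at hx2 hh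
    refine ⟨x k / h k, ?_⟩
    have h3 : (x k / h k) • h = (x k / h k) • (h k • realVec (T k)) := congrArg _ hh
    rw [smul_smul, div_mul_cancel₀ _ hk0] at h3
    rw [h3]
    exact hx2

theorem KernelBasis.realVec_ne_zero {ι : Type*} {n : ℕ} {D : Matrix ι (Fin n) ℤ} {Z : Set ι}
    {U : Finset (Fin n)} {T : Fin n → Fin n → ℤ} (hB : KernelBasis D Z U T) {l : Fin n}
    (hl : l ∈ U) : realVec (T l) ≠ 0 := by
  intro hc
  have := congrFun hc l
  simp [realVec, hB.diag l hl l hl] at this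

theorem KernelBasis.support_subset {ι : Type*} {n : ℕ} {D : Matrix ι (Fin n) ℤ} {h : Fin n → ℝ}
    {U : Finset (Fin n)} {T : Fin n → Fin n → ℤ}
    (hB : KernelBasis D {i | (realMat D).mulVec h i = 0} U T) {l : Fin n} (hl : l ∈ U) :
    Function.support ((realMat D).mulVec (realVec (T l))) ⊆
      Function.support ((realMat D).mulVec h) := by
  intro i hi hwi
  apply hi
  rw [realMat_mulVec, hB.ker l hl i hwi]; simp

/-- Here `w` vanishes on all rows vanishing on `g`, so it is a nonzero multiple of `g`. -/
theorem SpansKernel.of_support_subset {ι : Type*} {n : ℕ} {D : Matrix ι (Fin n) ℝ}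
    {g w : Fin n → ℝ} (hg : SpansKernel D g) (hw : w ≠ 0)
    (hsupp : Function.support (D.mulVec w) ⊆ Function.support (D.mulVec g)) :
    SpansKernel D w := by
  have hgw : ∀ i, D.mulVec g i = 0 → D.mulVec w i = 0 := fun i hi => by
    by_contra hc
    exact hsupp hc hi
  obtain ⟨a, rfl⟩ := hg w hgw
  intro x hx
  obtain ⟨b, rfl⟩ := hg x fun i hi => hx i (hgw i hi)
  have ha : a ≠ 0 := by rintro rfl; simp at hw
  exact ⟨b / a, by rw [smul_smul, div_mul_cancel₀ _ ha]⟩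

/-- Subtracting from `h` as much as possible of a basis vector `T l` with `l ≠ k`, `h k ≠ 0`,
leaves a nonzero vector. -/
theorem KernelBasis.sub_ne_zero {ι : Type*} {n : ℕ} {D : Matrix ι (Fin n) ℤ} {Z : Set ι}
    {U : Finset (Fin n)} {T : Fin n → Fin n → ℤ} (hB : KernelBasis D Z U T) {h : Fin n → ℝ}
    {k l : Fin n} (hk : k ∈ U) (hl : l ∈ U) (hlk : l ≠ k) (h0 : h k ≠ 0) (t : ℝ) :
    h - t • realVec (T l) ≠ 0 := by
  intro hc
  have := congrFun hc k
  simp [realVec, hB.diag l hl k hk, hlk, h0] at this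

/-- Every nonzero vector has a conformal vector that is determined, up to scaling, by its zeros. -/
theorem exists_spansKernel {ι : Type*} [Fintype ι] {n : ℕ} {D : Matrix ι (Fin n) ℤ}
    (hD : D.IsTotallyUnimodular) (hr : (realMat D).rank = n) (w : Fin n → ℝ) (hw : w ≠ 0) :
    ∃ h, h ≠ 0 ∧ ConformsTo ((realMat D).mulVec h) ((realMat D).mulVec w) ∧
      SpansKernel (realMat D) h := by
  induction hN : (Function.support ((realMat D).mulVec w)).ncard using Nat.strong_induction_on
    generalizing w with
  | _ N ih =>
    by_cases hs : SpansKernel (realMat D) w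
    · exact ⟨w, hw, .refl _, hs⟩
    obtain ⟨U, T, hB⟩ := KernelBasis.exists_of_finite hD {i | (realMat D).mulVec w i = 0}
    obtain ⟨k, hk, hk0⟩ := hB.exists_ne_zero hw
    have : ∃ l ∈ U, l ≠ k := by
      by_contra hc
      push Not at hc
      exact hs ((hB.spansKernel_iff hk hk0).2
        (Finset.eq_singleton_iff_unique_mem.2 ⟨hk, hc⟩))
    obtain ⟨l, hl, hlk⟩ := this
    have hsupp := hB.support_subset hl
    -- `T l` lives on the support of `w`, and one of `T l`, `-T l` agrees in sign with `w` on some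
    -- row, so a minimum ratio exists. The difference is nonzero because `T l` vanishes in
    -- coordinate `k` and `w` does not.
    have key : ∃ w', w' ≠ 0 ∧ ConformsTo ((realMat D).mulVec w') ((realMat D).mulVec w) ∧
        Function.support ((realMat D).mulVec w') ⊂ Function.support ((realMat D).mulVec w) := by
      have hneg : (realMat D).mulVec (-realVec (T l)) = -(realMat D).mulVec (realVec (T l)) :=
        Matrix.mulVec_neg _ _
      rcases exists_mul_pos_or hr (hB.realVec_ne_zero hl) hsupp with hj | hj
      · obtain ⟨t, ht⟩ := exists_isLeast_ratios hj
        refine ⟨w - t • realVec (T l), hB.sub_ne_zero hk hl hlk hk0 t, ?_⟩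
        rw [Matrix.mulVec_sub, Matrix.mulVec_smul]
        exact ⟨conformsTo_sub ht hsupp, support_sub_ssubset ht hsupp⟩
      · obtain ⟨t, ht⟩ := exists_isLeast_ratios hj
        have hsupp' : Function.support ((realMat D).mulVec (-realVec (T l))) ⊆
            Function.support ((realMat D).mulVec w) := by
          rw [hneg, Function.support_neg]; exact hsupp
        refine ⟨w - t • (-realVec (T l)), ?_, ?_⟩
        · have := hB.sub_ne_zero hk hl hlk hk0 (-t)
          simpa using this
        rw [Matrix.mulVec_sub, Matrix.mulVec_smul]
        exact ⟨conformsTo_sub ht hsupp', support_sub_ssubset ht hsupp'⟩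
    obtain ⟨w', hw', hc, hss⟩ := key
    obtain ⟨h, hh, hc', hs'⟩ := ih _ (hN ▸ Set.ncard_lt_ncard hss (Set.toFinite _)) w' hw' rfl
    exact ⟨h, hh, hc'.trans hc, hs'⟩

/-! ## The rank of the vanishing rows -/

section ZeroRank

variable {mA mB n : ℕ} (A : Matrix (Fin mA) (Fin n) ℝ) (B : Matrix (Fin mB) (Fin n) ℝ)

/-- The vectors on which all rows that vanish on `w` vanish. -/
noncomputable def zeroKernel (w : Fin n → ℝ) : Submodule ℝ (Fin n → ℝ) :=
  LinearMap.ker ((Matrix.fromRows A B).submatrix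
    (Subtype.val : {j // (Matrix.fromRows A B).mulVec w j = 0} → Fin mA ⊕ Fin mB) id).mulVecLin

theorem mem_zeroKernel {w x : Fin n → ℝ} : x ∈ zeroKernel A B w ↔
    ∀ i, (Matrix.fromRows A B).mulVec w i = 0 → (Matrix.fromRows A B).mulVec x i = 0 := by
  rw [zeroKernel, LinearMap.mem_ker, Matrix.mulVecLin_apply, funext_iff, Subtype.forall]
  rfl

theorem zeroRank_add_finrank (w : Fin n → ℝ) :
    zeroRank A B w + Module.finrank ℝ (zeroKernel A B w) = n := by
  have := LinearMap.finrank_range_add_finrank_ker ((Matrix.fromRows A B).submatrix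
    (Subtype.val : {j // (Matrix.fromRows A B).mulVec w j = 0} → Fin mA ⊕ Fin mB) id).mulVecLin
  rw [Module.finrank_fin_fun] at this
  exact this

/-- The kernel of the vanishing rows always contains `w`, so by rank-nullity the condition says that
this kernel is the line through `w`. -/
theorem zeroRank_add_one_eq_iff {w : Fin n → ℝ} (hw : w ≠ 0) :
    zeroRank A B w + 1 = n ↔ SpansKernel (Matrix.fromRows A B) w := by
  have h1 := zeroRank_add_finrank A B w
  have hmem : w ∈ zeroKernel A B w := (mem_zeroKernel A B).2 fun i hi => hi
  have h2 := finrank_eq_one_iff_of_nonzero' (K := ℝ) (⟨w, hmem⟩ : zeroKernel A B w)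
    (by simpa using hw)
  have h3 : zeroRank A B w + 1 = n ↔ Module.finrank ℝ (zeroKernel A B w) = 1 := by omega
  rw [h3, h2]
  constructor
  · intro h x hx
    obtain ⟨c, hc⟩ := h ⟨x, (mem_zeroKernel A B).2 hx⟩
    exact ⟨c, (congrArg Subtype.val hc).symm⟩
  · rintro h ⟨x, hx⟩
    obtain ⟨c, hc⟩ := h x ((mem_zeroKernel A B).1 hx)
    exact ⟨c, Subtype.ext hc.symm⟩

/-- Not just the number of vanishing rows but their rank grows: a newly vanishing row is nonzero on
`w`, so `w` drops out of the kernel. -/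
theorem zeroRank_lt_zeroRank {w w' : Fin n → ℝ}
    (h : Function.support ((Matrix.fromRows A B).mulVec w') ⊂
      Function.support ((Matrix.fromRows A B).mulVec w)) :
    zeroRank A B w < zeroRank A B w' := by
  have h1 := zeroRank_add_finrank A B w
  have h2 := zeroRank_add_finrank A B w'
  have h3 : zeroKernel A B w' < zeroKernel A B w := by
    refine lt_of_le_of_ne (fun x hx => ?_) fun he => ?_
    · rw [mem_zeroKernel] at hx ⊢
      exact fun i hi => hx i (by by_contra hc; exact h.1 hc hi)
    · obtain ⟨j, hj, hj'⟩ := Set.exists_of_ssubset h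
      have hm : w ∈ zeroKernel A B w := (mem_zeroKernel A B).2 fun i hi => hi
      rw [← he, mem_zeroKernel] at hm
      exact hj (hm j (by simpa using hj'))
  have h4 := Submodule.finrank_lt_finrank_of_lt h3
  omega

theorem rank_le_zeroRank {w : Fin n → ℝ} (hw : A.mulVec w = 0) : A.rank ≤ zeroRank A B w := by
  have h1 := zeroRank_add_finrank A B w
  have h2 := LinearMap.finrank_range_add_finrank_ker A.mulVecLin
  rw [Module.finrank_fin_fun] at h2
  have h3 : zeroKernel A B w ≤ LinearMap.ker A.mulVecLin := by
    intro x hx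
    rw [mem_zeroKernel] at hx
    rw [LinearMap.mem_ker, Matrix.mulVecLin_apply]
    ext i
    have := hx (Sum.inl i) (by simp [Matrix.fromRows_mulVec, hw])
    simpa [Matrix.fromRows_mulVec] using this
  have h4 := Submodule.finrank_mono h3
  have h5 : A.rank = Module.finrank ℝ (LinearMap.range A.mulVecLin) := rfl
  omega

theorem zeroRank_lt {w : Fin n → ℝ} (hw : w ≠ 0) : zeroRank A B w < n := by
  have h1 := zeroRank_add_finrank A B w
  have h2 : 0 < Module.finrank ℝ (zeroKernel A B w) := by
    rw [Module.finrank_pos_iff_exists_ne_zero]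
    exact ⟨⟨w, (mem_zeroKernel A B).2 fun i hi => hi⟩, by simpa using hw⟩
  omega

end ZeroRank

/-! ## Circuits and the iterations of the algorithm -/

theorem realMat_fromRows {ι κ : Type*} {n : ℕ} (A : Matrix ι (Fin n) ℤ) (B : Matrix κ (Fin n) ℤ) :
    realMat (Matrix.fromRows A B) = Matrix.fromRows (realMat A) (realMat B) :=
  Matrix.fromRows_map _ _ _

/-- Circuits are defined by supports of `B x` within `ker A`, whereas the unimodularity arguments
use the stacked matrix; this translates between the two. -/
theorem support_fromRows_subset_iff {ι κ : Type*} {n : ℕ} {A : Matrix ι (Fin n) ℝ}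
    {B : Matrix κ (Fin n) ℝ} {x y : Fin n → ℝ} (hy : A.mulVec y = 0) :
    Function.support ((Matrix.fromRows A B).mulVec x) ⊆
      Function.support ((Matrix.fromRows A B).mulVec y) ↔
    A.mulVec x = 0 ∧ Function.support (B.mulVec x) ⊆ Function.support (B.mulVec y) := by
  simp only [Matrix.fromRows_mulVec, Function.support_subset_iff, Sum.forall, Sum.elim_inl,
    Sum.elim_inr, Function.mem_support]
  refine and_congr ⟨fun h => ?_, fun h i hi => ?_⟩ Iff.rfl
  · ext i
    by_contra hi
    exact h i hi (congrFun hy i)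
  · exact absurd (congrFun h i) hi

theorem support_fromRows_ssubset_iff {ι κ : Type*} {n : ℕ} {A : Matrix ι (Fin n) ℝ}
    {B : Matrix κ (Fin n) ℝ} {x y : Fin n → ℝ} (hx : A.mulVec x = 0) (hy : A.mulVec y = 0) :
    Function.support ((Matrix.fromRows A B).mulVec x) ⊂
      Function.support ((Matrix.fromRows A B).mulVec y) ↔
    Function.support (B.mulVec x) ⊂ Function.support (B.mulVec y) := by
  rw [ssubset_iff_subset_not_subset, ssubset_iff_subset_not_subset,
    support_fromRows_subset_iff hy, support_fromRows_subset_iff hx]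
  tauto

section Circuits

variable {mA mB n : ℕ} {A : Matrix (Fin mA) (Fin n) ℤ} {B : Matrix (Fin mB) (Fin n) ℤ}

/-- A competitor of smaller support vanishes wherever `z` does, so it is a nonzero multiple of `z`
and has the same support after all. -/
theorem mem_circuits_of_spansKernel {z : Fin n → ℤ} (hA : (realMat A).mulVec (realVec z) = 0)
    (h0 : realVec z ≠ 0) (hz : Finset.univ.gcd z = 1)
    (hs : SpansKernel (Matrix.fromRows (realMat A) (realMat B)) (realVec z)) :
    realVec z ∈ circuits (realMat A) (realMat B) := by
  refine ⟨hA, h0, ⟨z, fun _ => rfl, hz⟩, fun x hx hx0 hss => ?_⟩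
  rw [← support_fromRows_ssubset_iff hx hA] at hss
  obtain ⟨c, rfl⟩ := hs x fun i hi => by by_contra hc; exact hss.1 hc hi
  apply hss.2
  intro i hi hi0
  have hc : c ≠ 0 := by rintro rfl; simp at hx0
  rw [Matrix.mulVec_smul, Pi.smul_apply, smul_eq_mul, mul_eq_zero] at hi0
  exact hi (hi0.resolve_left hc)

/-- Below `g` there is a conformal vector determined by its zeros; minimality of `g` forces equal
supports, and the property passes to `g`. -/
theorem spansKernel_of_mem_circuits
    (hD : (Matrix.fromRows A B).IsTotallyUnimodular)
    (hr : (Matrix.fromRows (realMat A) (realMat B)).rank = n) {g : Fin n → ℝ}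
    (hg : g ∈ circuits (realMat A) (realMat B)) :
    SpansKernel (Matrix.fromRows (realMat A) (realMat B)) g := by
  obtain ⟨hA, h0, -, hmin⟩ := hg
  rw [← realMat_fromRows] at hr
  obtain ⟨h, hh0, hc, hs⟩ := exists_spansKernel hD hr g h0
  rw [realMat_fromRows] at hc hs
  have hAh := ((support_fromRows_subset_iff hA).1 hc.1).1
  have hnot := hmin h hAh hh0
  rw [← support_fromRows_ssubset_iff hAh hA] at hnot
  have heq : Function.support ((Matrix.fromRows (realMat A) (realMat B)).mulVec g) ⊆
      Function.support ((Matrix.fromRows (realMat A) (realMat B)).mulVec h) := by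
    by_contra hc'
    exact hnot ⟨hc.1, hc'⟩
  exact hs.of_support_subset h0 heq

theorem isSign_of_spansKernel (hD : (Matrix.fromRows A B).IsTotallyUnimodular) {z : Fin n → ℤ}
    (hz : Finset.univ.gcd z = 1)
    (hs : SpansKernel (Matrix.fromRows (realMat A) (realMat B)) (realVec z)) (i : Fin mB) :
    IsSign (B.mulVec z i) := by
  rw [← realMat_fromRows] at hs
  have := isSign_mulVec_of_span hD {i | (Matrix.fromRows A B).mulVec z i = 0} hz (fun i hi => hi)
    (fun x hx => hs x fun i hi => hx i (by rw [realMat_mulVec] at hi; exact_mod_cast hi))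
    (Sum.inr i)
  simpa [Matrix.fromRows_mulVec] using this

/-- Each entry of `x` lies between `0` and the corresponding entry of `y`. -/
def Within {ι : Type*} (x y : ι → ℝ) : Prop := ∀ i, ∃ θ : ℝ, 0 ≤ θ ∧ θ ≤ 1 ∧ x i = θ * y i

theorem Within.refl {ι : Type*} (x : ι → ℝ) : Within x x :=
  fun _ => ⟨1, zero_le_one, le_rfl, by simp⟩

theorem Within.trans {ι : Type*} {x y z : ι → ℝ} (h : Within x y) (h' : Within y z) :
    Within x z := fun i => by
  obtain ⟨a, ha, ha', hx⟩ := h i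
  obtain ⟨b, hb, hb', hy⟩ := h' i
  exact ⟨a * b, mul_nonneg ha hb, mul_le_one₀ ha' hb hb', by rw [hx, hy, mul_assoc]⟩

theorem Within.conformsTo {ι : Type*} {x y : ι → ℝ} (h : Within x y) : ConformsTo x y := by
  refine ⟨fun i hi hy => hi ?_, fun i => ?_⟩
  · obtain ⟨a, _, _, hx⟩ := h i
    rw [hx, hy, mul_zero]
  · obtain ⟨a, ha, _, hx⟩ := h i
    rw [hx, mul_assoc]
    exact mul_nonneg ha (mul_self_nonneg _)

/-- The factor is `(a - t b) a / a ^ 2`: nonnegative because signs are kept, at most 1 because `t a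
b ≥ 0`. This upper bound, which `ConformsTo` does not give, is what keeps the walk inside the
polyhedron. -/
theorem within_sub {ι : Type*} {a b : ι → ℝ} {t : ℝ} (ht : IsLeast (ratios a b) t)
    (hb : ConformsTo b a) : Within (a - t • b) a := fun i => by
  have ht0 := pos_of_isLeast_ratios ht
  by_cases ha : a i = 0
  · have : b i = 0 := by by_contra hc; exact hb.1 hc ha
    exact ⟨0, le_rfl, zero_le_one, by simp [ha, this]⟩
  · have h1 := sub_mul_nonneg_of_isLeast ht i
    have h2 := mul_self_pos.2 ha
    refine ⟨(a i - t * b i) * a i / (a i * a i), div_nonneg h1 h2.le, ?_, ?_⟩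
    · rw [div_le_one h2]
      nlinarith [mul_nonneg ht0.le (hb.2 i)]
    · simp only [Pi.sub_apply, Pi.smul_apply, smul_eq_mul]
      field_simp

theorem IsIntegralVector.exists_realVec {v : Fin n → ℝ} (h : IsIntegralVector v) :
    ∃ z : Fin n → ℤ, v = realVec z := by
  choose z hz using h
  exact ⟨z, funext hz⟩

/-- What is known about the current vector of the algorithm. -/
structure IsRemainder (A : Matrix (Fin mA) (Fin n) ℤ) (B : Matrix (Fin mB) (Fin n) ℤ)
    (u w : Fin n → ℝ) : Prop where
  ker : (realMat A).mulVec w = 0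
  ne_zero : w ≠ 0
  within : Within ((realMat B).mulVec w) ((realMat B).mulVec u)
  integral : IsIntegralVector w

/-- The minimum is attained at a row where `B g` is ±1, so the ratio is an entry of the integral
vector `B w` up to sign. The value 0 cannot occur there but is covered by `x / 0 = 0`. -/
theorem exists_ratio_eq_int (hD : (Matrix.fromRows A B).IsTotallyUnimodular)
    (hr : (Matrix.fromRows (realMat A) (realMat B)).rank = n) {g w : Fin n → ℝ}
    (hg : g ∈ circuits (realMat A) (realMat B)) (hw : IsIntegralVector w) {lam : ℝ}
    (hlam : IsLeast (ratios ((realMat B).mulVec w) ((realMat B).mulVec g)) lam) :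
    ∃ l : ℤ, lam = l := by
  have hs := spansKernel_of_mem_circuits hD hr hg
  obtain ⟨-, -, ⟨z, hz, hgcd⟩, -⟩ := hg
  obtain rfl : g = realVec z := funext hz
  obtain ⟨y, rfl⟩ := hw.exists_realVec
  obtain ⟨⟨j, hj, rfl⟩, -⟩ := hlam
  rw [realMat_mulVec, realMat_mulVec]
  rcases isSign_of_spansKernel hD hgcd hs j with h | h | h
  · exact ⟨0, by simp [h]⟩
  · exact ⟨B.mulVec y j, by simp [h]⟩
  · exact ⟨-B.mulVec y j, by simp [h, div_neg]⟩

theorem isIntegralVector_of_mem_circuits {A : Matrix (Fin mA) (Fin n) ℝ}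
    {B : Matrix (Fin mB) (Fin n) ℝ} {g : Fin n → ℝ} (hg : g ∈ circuits A B) :
    IsIntegralVector g := by
  obtain ⟨-, -, ⟨z, hz, -⟩, -⟩ := hg
  exact fun j => ⟨z j, hz j⟩

theorem IsIntegralVector.sub {v w : Fin n → ℝ} (hv : IsIntegralVector v) (hw : IsIntegralVector w) :
    IsIntegralVector (v - w) := fun j => by
  obtain ⟨a, ha⟩ := hv j
  obtain ⟨b, hb⟩ := hw j
  exact ⟨a - b, by simp [ha, hb]⟩

theorem IsIntegralVector.int_smul {v : Fin n → ℝ} (hv : IsIntegralVector v) (c : ℤ) :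
    IsIntegralVector ((c : ℝ) • v) := fun j => by
  obtain ⟨a, ha⟩ := hv j
  exact ⟨c * a, by simp [ha]⟩

theorem IsRemainder.loopStep (hD : (Matrix.fromRows A B).IsTotallyUnimodular)
    (hr : (Matrix.fromRows (realMat A) (realMat B)).rank = n) {u w g w' : Fin n → ℝ} {lam : ℝ}
    (h : IsRemainder A B u w) (hl : LoopStep (realMat A) (realMat B) w g lam w') :
    IsRemainder A B u w' ∧ zeroRank (realMat A) (realMat B) w <
      zeroRank (realMat A) (realMat B) w' := by
  obtain ⟨-, hg, hss, hsc, hleast, rfl⟩ := hl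
  have hg' := hg
  obtain ⟨hgA, hg0, hgz, hmin⟩ := hg'
  change IsLeast (ratios _ _) lam at hleast
  obtain ⟨l, hl⟩ := exists_ratio_eq_int hD hr hg h.integral hleast
  have hker : (realMat A).mulVec (w - lam • g) = 0 := by
    rw [Matrix.mulVec_sub, Matrix.mulVec_smul, hgA, h.ker]; simp
  refine ⟨⟨hker, fun h0 => ?_, ?_, ?_⟩, ?_⟩
  -- The inclusion of supports is strict, so some nonzero entry of `B w` is left untouched by the
  -- subtraction.
  · obtain ⟨j, hj, hj'⟩ := Set.exists_of_ssubset hss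
    have h1 := congrArg (fun x => (realMat B).mulVec x j) h0
    have h2 : (realMat B).mulVec g j = 0 := by simpa using hj'
    simp only [Matrix.mulVec_sub, Matrix.mulVec_smul, Matrix.mulVec_zero, Pi.sub_apply,
      Pi.smul_apply, h2, smul_zero, sub_zero, Pi.zero_apply] at h1
    exact hj h1
  · refine Within.trans ?_ h.within
    rw [Matrix.mulVec_sub, Matrix.mulVec_smul]
    exact within_sub hleast ⟨hss.1, hsc⟩
  · rw [hl]
    exact h.integral.sub ((isIntegralVector_of_mem_circuits hg).int_smul l)
  · apply zeroRank_lt_zeroRank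
    rw [support_fromRows_ssubset_iff hker h.ker, Matrix.mulVec_sub, Matrix.mulVec_smul]
    exact support_sub_ssubset hleast hss.1

theorem isRemainder_partialExecution (hD : (Matrix.fromRows A B).IsTotallyUnimodular)
    (hr : (Matrix.fromRows (realMat A) (realMat B)).rank = n) {u : Fin n → ℝ}
    (hu : IsRemainder A B u u) {t : ℕ} {w g : ℕ → Fin n → ℝ} {lam : ℕ → ℝ}
    (h : IsPartialExecution (realMat A) (realMat B) u t w g lam) :
    ∀ i ≤ t, IsRemainder A B u (w i) ∧
      (realMat A).rank + i ≤ zeroRank (realMat A) (realMat B) (w i) := by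
  intro i
  induction i with
  | zero =>
    intro _
    rw [h.1]
    exact ⟨hu, rank_le_zeroRank _ _ hu.ker⟩
  | succ i ih =>
    intro hi
    obtain ⟨h1, h2⟩ := ih (by omega)
    obtain ⟨h3, h4⟩ := h1.loopStep hD hr (h.2 i (by omega))
    exact ⟨h3, by omega⟩

/-- The rank of the vanishing rows starts at `rank A` or more, gains at least 1 per iteration and
stays below `n` since the remainder is nonzero. The `+ 1` makes room for the final iteration. -/
theorem partialExecution_length (hD : (Matrix.fromRows A B).IsTotallyUnimodular)
    (hr : (Matrix.fromRows (realMat A) (realMat B)).rank = n) {u : Fin n → ℝ}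
    (hu : IsRemainder A B u u) {t : ℕ} {w g : ℕ → Fin n → ℝ} {lam : ℕ → ℝ}
    (h : IsPartialExecution (realMat A) (realMat B) u t w g lam) :
    t + 1 ≤ n - (realMat A).rank := by
  obtain ⟨h1, h2⟩ := isRemainder_partialExecution hD hr hu h t le_rfl
  have := zeroRank_lt (realMat A) (realMat B) h1.ne_zero
  omega

/-- A kernel basis with one element yields a circuit. -/
theorem exists_circuit_of_spansKernel (hD : (Matrix.fromRows A B).IsTotallyUnimodular)
    {h : Fin n → ℝ} (h0 : h ≠ 0) (hA : (realMat A).mulVec h = 0)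
    (hs : SpansKernel (Matrix.fromRows (realMat A) (realMat B)) h) :
    ∃ g ∈ circuits (realMat A) (realMat B), ∃ c : ℝ, 0 < c ∧ h = c • g := by
  obtain ⟨U, T, hB⟩ := KernelBasis.exists_of_finite hD
    {i | (realMat (Matrix.fromRows A B)).mulVec h i = 0}
  obtain ⟨k, hk, hk0⟩ := hB.exists_ne_zero h0
  have hU := (hB.spansKernel_iff hk hk0).1 (by rwa [realMat_fromRows])
  have hh := hB.span h fun i hi => hi
  rw [hU, Finset.sum_singleton] at hh
  have key : ∀ (z : Fin n → ℤ) (c : ℝ), 0 < c → Finset.univ.gcd z = 1 → h = c • realVec z →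
      ∃ g ∈ circuits (realMat A) (realMat B), ∃ c : ℝ, 0 < c ∧ h = c • g := by
    intro z c hc hz he
    refine ⟨realVec z, mem_circuits_of_spansKernel ?_ ?_ hz ?_, c, hc, he⟩
    · rw [he, Matrix.mulVec_smul, smul_eq_zero] at hA
      exact hA.resolve_left hc.ne'
    · intro hz0; rw [hz0, smul_zero] at he; exact h0 he
    · intro x hx
      obtain ⟨c', rfl⟩ := hs x fun i hi => hx i (by
        rw [he, Matrix.mulVec_smul, Pi.smul_apply, smul_eq_mul, mul_eq_zero] at hi
        exact hi.resolve_left hc.ne')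
      exact ⟨c' * c, by rw [he, smul_smul]⟩
  -- `h` is `h k` times the basis vector, so the sign of `h k` decides which of `T k`, `-T k` is a
  -- positive multiple of `h`.
  rcases lt_or_gt_of_ne hk0 with h1 | h1
  · refine key (-T k) (-h k) (by linarith) ?_ ?_
    · refine gcd_eq_one_of_isUnit (k := k) ?_
      rw [Pi.neg_apply, hB.diag k hk k hk, if_pos rfl]
      exact isUnit_one.neg
    · conv_lhs => rw [hh]
      ext j; simp [realVec]
  · exact key _ _ h1 (hB.gcd_eq_one hk) hh

theorem exists_step (hD : (Matrix.fromRows A B).IsTotallyUnimodular)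
    (hr : (Matrix.fromRows (realMat A) (realMat B)).rank = n) {w : Fin n → ℝ}
    (hA : (realMat A).mulVec w = 0) (h0 : w ≠ 0) :
    (∃ g lam, FinalStep (realMat A) (realMat B) w g lam) ∨
      ∃ g lam w', LoopStep (realMat A) (realMat B) w g lam w' := by
  by_cases hz : zeroRank (realMat A) (realMat B) w + 1 = n
  · obtain ⟨g, hg, hc⟩ := exists_circuit_of_spansKernel hD h0 hA
      ((zeroRank_add_one_eq_iff _ _ h0).1 hz)
    exact Or.inl ⟨g, _, hz, hg, hc, rfl⟩
  · obtain ⟨h, hh0, hc, hs⟩ := exists_spansKernel hD (by rwa [realMat_fromRows]) w h0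
    rw [realMat_fromRows] at hc hs
    have hAh := ((support_fromRows_subset_iff hA).1 hc.1)
    obtain ⟨g, hg, c, hc0, rfl⟩ := exists_circuit_of_spansKernel hD hh0 hAh.1 hs
    have hsupp : Function.support ((realMat B).mulVec g) ⊆
        Function.support ((realMat B).mulVec w) := by
      have := hAh.2
      rwa [Matrix.mulVec_smul, Function.support_const_smul_of_ne_zero _ _ hc0.ne'] at this
    have hsc : SignCompatible ((realMat B).mulVec g) ((realMat B).mulVec w) := fun i => by
      have := hc.2 (Sum.inr i)
      simp only [Matrix.fromRows_mulVec, Sum.elim_inr, Matrix.mulVec_smul, Pi.smul_apply,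
        smul_eq_mul, mul_assoc] at this
      exact nonneg_of_mul_nonneg_right this hc0
    have hgs := spansKernel_of_mem_circuits hD hr hg
    -- Equality of supports would make `w` determined by its zeros along with `g`, contrary to the
    -- rank condition.
    have hss : Function.support ((realMat B).mulVec g) ⊂
        Function.support ((realMat B).mulVec w) := by
      refine ⟨hsupp, fun hsub => hz ((zeroRank_add_one_eq_iff _ _ h0).2 ?_)⟩
      have hsub' := (support_fromRows_subset_iff hg.1).2 ⟨hA, hsub⟩
      exact hgs.of_support_subset h0 hsub'
    have hgB : (realMat B).mulVec g ≠ 0 := by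
      intro hg0
      refine hg.2.1 (eq_zero_of_mulVec_eq_zero hr ?_)
      rw [Matrix.fromRows_mulVec, hg.1, hg0]
      ext i; cases i <;> rfl
    obtain ⟨j, hj⟩ := Function.ne_iff.1 hgB
    obtain ⟨t, ht⟩ := exists_isLeast_ratios (a := (realMat B).mulVec w)
      (b := (realMat B).mulVec g) ⟨j, by
        rw [mul_comm]
        exact lt_of_le_of_ne (hsc j) (mul_ne_zero hj (hsupp hj)).symm⟩
    exact Or.inr ⟨g, t, _, hz, hg, hss, hsc, ht, rfl⟩

theorem sum_partialExecution {A : Matrix (Fin mA) (Fin n) ℝ} {B : Matrix (Fin mB) (Fin n) ℝ}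
    {u : Fin n → ℝ} {t : ℕ} {w g : ℕ → Fin n → ℝ} {lam : ℕ → ℝ}
    (h : IsPartialExecution A B u t w g lam) :
    ∀ i ≤ t, ∑ j ∈ Finset.range i, lam j • g j = u - w i := by
  intro i
  induction i with
  | zero => intro _; simp [h.1]
  | succ i ih =>
    intro hi
    obtain ⟨-, -, -, -, -, h2⟩ := h.2 i (by omega)
    rw [Finset.sum_range_succ, ih (by omega), h2]
    abel

theorem FinalStep.smul_eq {A : Matrix (Fin mA) (Fin n) ℝ} {B : Matrix (Fin mB) (Fin n) ℝ}
    {w g : Fin n → ℝ} {lam : ℝ} (h : FinalStep A B w g lam) : 0 < lam ∧ w = lam • g := by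
  obtain ⟨-, hg, ⟨c, hc, rfl⟩, rfl⟩ := h
  have : ‖c • g‖ / ‖g‖ = c := by
    rw [norm_smul, mul_div_assoc, div_self (norm_ne_zero_iff.2 hg.2.1), mul_one, Real.norm_eq_abs,
      abs_of_pos hc]
  rw [this]
  exact ⟨hc, rfl⟩

/-- Row `i` takes at `v₂ - w` the value `(1 - θ) (B v₂)_i + θ (B v₁)_i`, where `θ` depends on the
row. -/
theorem sub_mem_polyhedron {A : Matrix (Fin mA) (Fin n) ℝ} {B : Matrix (Fin mB) (Fin n) ℝ}
    {b : Fin mA → ℝ} {d : Fin mB → ℝ} {v₁ v₂ w : Fin n → ℝ} (h₁ : v₁ ∈ polyhedron A B b d)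
    (h₂ : v₂ ∈ polyhedron A B b d) (hA : A.mulVec w = 0)
    (hB : Within (B.mulVec w) (B.mulVec (v₂ - v₁))) : v₂ - w ∈ polyhedron A B b d := by
  refine ⟨by rw [Matrix.mulVec_sub, hA, h₂.1, sub_zero], fun i => ?_⟩
  obtain ⟨θ, hθ, hθ', hw⟩ := hB i
  rw [Matrix.mulVec_sub, Pi.sub_apply, hw, Matrix.mulVec_sub, Pi.sub_apply]
  have h1 := h₁.2 i
  have h2 := h₂.2 i
  nlinarith

/-- After `j` non-final iterations the partial sum is `u - w j`, so the point reached is `v₂ - w j`.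
Integrality, membership and sign-compatibility all follow from what `IsRemainder` records about `w
j`. -/
theorem isOutput_spec (hD : (Matrix.fromRows A B).IsTotallyUnimodular)
    (hr : (Matrix.fromRows (realMat A) (realMat B)).rank = n) {b : Fin mA → ℝ} {d : Fin mB → ℝ}
    {v₁ v₂ : Fin n → ℝ} (h₁ : v₁ ∈ polyhedron (realMat A) (realMat B) b d)
    (h₂ : v₂ ∈ polyhedron (realMat A) (realMat B) b d) (hi₁ : IsIntegralVector v₁)
    (hi₂ : IsIntegralVector v₂) {k : ℕ} {g : ℕ → Fin n → ℝ} {lam : ℕ → ℝ}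
    (ho : IsOutput (realMat A) (realMat B) (v₂ - v₁) k g lam) :
    k ≤ n - (realMat A).rank ∧
    IsSignCompatibleCircuitWalk (realMat A) (realMat B) v₁ v₂ k (walkPoint v₁ g lam) g lam ∧
    ∀ j ≤ k, IsIntegralVector (walkPoint v₁ g lam j) ∧
      walkPoint v₁ g lam j ∈ polyhedron (realMat A) (realMat B) b d := by
  have hstep : ∀ i, walkPoint v₁ g lam (i + 1) = walkPoint v₁ g lam i + lam i • g i := fun i => by
    rw [walkPoint, walkPoint, Finset.sum_range_succ, add_assoc]
  have hzero : walkPoint v₁ g lam 0 = v₁ := by simp [walkPoint]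
  rcases ho with ⟨hu, rfl⟩ | ⟨hu, t, w, rfl, hp, hf⟩
  · refine ⟨Nat.zero_le _, ⟨hzero, ?_, by simp, by simp, by simp, by simp⟩, fun j hj => ?_⟩
    · rw [hzero]; exact (sub_eq_zero.1 hu).symm
    · obtain rfl : j = 0 := by omega
      rw [hzero]
      exact ⟨hi₁, h₁⟩
  · have hrem : IsRemainder A B (v₂ - v₁) (v₂ - v₁) :=
      ⟨by rw [Matrix.mulVec_sub, h₁.1, h₂.1, sub_self], hu, .refl _, hi₂.sub hi₁⟩
    have hall := isRemainder_partialExecution hD hr hrem hp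
    have hw : ∀ i ≤ t, walkPoint v₁ g lam i = v₂ - w i := fun i hi => by
      rw [walkPoint, sum_partialExecution hp i hi]; abel
    obtain ⟨hlam, hwt⟩ := hf.smul_eq
    have hend : walkPoint v₁ g lam (t + 1) = v₂ := by
      rw [hstep, hw t le_rfl, ← hwt]; abel
    have hconf : ∀ i < t + 1, g i ∈ circuits (realMat A) (realMat B) ∧ 0 < lam i ∧
        ConformsTo ((realMat B).mulVec (g i)) ((realMat B).mulVec (w i)) := by
      intro i hi
      rcases Nat.lt_succ_iff_lt_or_eq.1 hi with hi | rfl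
      · obtain ⟨-, hg, hss, hsc, hl, -⟩ := hp.2 i hi
        exact ⟨hg, pos_of_isLeast_ratios (a := (realMat B).mulVec (w i)) hl, hss.1, hsc⟩
      · refine ⟨hf.2.1, hlam, ?_⟩
        rw [hwt, Matrix.mulVec_smul]
        refine ⟨?_, fun j => ?_⟩
        · rw [Function.support_const_smul_of_ne_zero _ _ hlam.ne']
        · simp only [Pi.smul_apply, smul_eq_mul]
          nlinarith [mul_nonneg hlam.le (mul_self_nonneg ((realMat B).mulVec (g i) j))]
    refine ⟨partialExecution_length hD hr hrem hp, ⟨hzero, hend, fun i hi => (hconf i hi).1,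
      fun i hi => (hconf i hi).2.1, fun i _ => hstep i, fun i hi => ?_⟩, fun j hj => ?_⟩
    · exact ((hconf i hi).2.2.trans (hall i (by omega)).1.within.conformsTo).2
    · rcases Nat.le_succ_iff.1 hj with hj | rfl
      · rw [hw j hj]
        exact ⟨hi₂.sub (hall j hj).1.integral,
          sub_mem_polyhedron h₁ h₂ (hall j hj).1.ker (hall j hj).1.within⟩
      · rw [hend]
        exact ⟨hi₂, h₂⟩

end Circuits

/-! ## Structured programs and their running time -/

/-- Structured commands; `forTo x v p` runs `p` for `x = 0, …, v - 1`. -/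
inductive Cmd where
  | skip
  | assign (x : ℕ) (e : Expr)
  | write (a : ℕ) (i j e : Expr)
  | seq (p q : Cmd)
  | ite (e : Expr) (p q : Cmd)
  | forTo (x v : ℕ) (p : Cmd)

namespace Cmd

/-- The memory after running a command. -/
def run : Cmd → State → State
  | skip, σ => σ
  | assign x e, σ => σ.setVar x (e.eval σ)
  | write a i j e, σ => σ.setArr a (i.eval σ) (j.eval σ) (e.eval σ)
  | seq p q, σ => q.run (p.run σ)
  | ite e p q, σ => if e.eval σ ≠ 0 then p.run σ else q.run σ
  | .forTo x v p, σ =>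
      Nat.rec (σ.setVar x 0) (fun k τ => (p.run τ).setVar x ((k : ℤ) + 1)) (σ.var v).toNat

/-- Translation of commands into while-programs. -/
def compile : Cmd → Program
  | skip => .skip
  | assign x e => .assign x e
  | write a i j e => .write a i j e
  | seq p q => .seq p.compile q.compile
  | ite e p q => .ite e p.compile q.compile
  | .forTo x v p => .seq (.assign x (.const 0))
      (.loop (.le (.add (.var x) (.const 1)) (.var v))
        (.seq p.compile (.assign x (.add (.var x) (.const 1)))))

/-- Does the command assign to the variable `y`? -/
def assigns : Cmd → ℕ → Bool
  | skip, _ => false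
  | assign x _, y => x == y
  | write _ _ _ _, _ => false
  | seq p q, y => p.assigns y || q.assigns y
  | ite _ p q, y => p.assigns y || q.assigns y
  | .forTo x _ p, y => x == y || p.assigns y

/-- Does the command write to the array `b`? -/
def writes : Cmd → ℕ → Bool
  | skip, _ => false
  | assign _ _, _ => false
  | write a _ _ _, b => a == b
  | seq p q, b => p.writes b || q.writes b
  | ite _ p q, b => p.writes b || q.writes b
  | .forTo _ _ p, b => p.writes b

/-- This and `run_arr` are the frame rules of the verification: for concrete commands the side
condition is decided by computation, so `rfl` proves it. -/
theorem run_var (p : Cmd) (σ : State) {y : ℕ} (h : p.assigns y = false) :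
    (p.run σ).var y = σ.var y := by
  induction p generalizing σ with
  | skip => rfl
  | assign x e =>
    have : y ≠ x := by rintro rfl; simp [assigns] at h
    simp [run, State.setVar, this]
  | write a i j e => rfl
  | seq p q hp hq =>
    simp only [assigns, Bool.or_eq_false_iff] at h
    rw [run, hq _ h.2, hp _ h.1]
  | ite e p q hp hq =>
    simp only [assigns, Bool.or_eq_false_iff] at h
    rw [run]
    split
    · exact hp _ h.1
    · exact hq _ h.2
  | forTo x v p hp =>
    simp only [assigns, Bool.or_eq_false_iff] at h
    have hx : y ≠ x := by rintro rfl; simp at h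
    rw [run]
    induction (σ.var v).toNat with
    | zero => simp [State.setVar, hx]
    | succ k ih => simp only [State.setVar, if_neg hx, hp _ h.2] at ih ⊢; exact ih

theorem run_arr (p : Cmd) (σ : State) {b : ℕ} (h : p.writes b = false) :
    (p.run σ).arr b = σ.arr b := by
  induction p generalizing σ with
  | skip => rfl
  | assign x e => rfl
  | write a i j e =>
    have : b ≠ a := by rintro rfl; simp [writes] at h
    simp [run, State.setArr, this]
  | seq p q hp hq =>
    simp only [writes, Bool.or_eq_false_iff] at h
    rw [run, hq _ h.2, hp _ h.1]
  | ite e p q hp hq =>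
    simp only [writes, Bool.or_eq_false_iff] at h
    rw [run]
    split
    · exact hp _ h.1
    · exact hq _ h.2
  | forTo x v p hp =>
    rw [run]
    induction (σ.var v).toNat with
    | zero => rfl
    | succ k ih => exact (hp _ h).trans ih

/-- The invariant rule for `for` loops. The invariant need not mention what the loop leaves
unchanged. -/
theorem run_for {x v : ℕ} {p : Cmd} {σ : State} {N : ℕ} (hN : σ.var v = N)
    (I : ℕ → State → Prop) (h0 : I 0 (σ.setVar x 0))
    (hs : ∀ k τ, k < N → τ.var x = (k : ℤ) →
      (∀ y, (Cmd.forTo x v p).assigns y = false → τ.var y = σ.var y) →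
      (∀ b, p.writes b = false → τ.arr b = σ.arr b) →
      I k τ → I (k + 1) ((p.run τ).setVar x ((k : ℤ) + 1))) :
    I N ((Cmd.forTo x v p).run σ) := by
  let f : ℕ → State := fun k =>
    Nat.rec (σ.setVar x 0) (fun k τ => (p.run τ).setVar x ((k : ℤ) + 1)) k
  have key : ∀ k ≤ N, (f k).var x = k ∧
      (∀ y, (Cmd.forTo x v p).assigns y = false → (f k).var y = σ.var y) ∧
      (∀ b, p.writes b = false → (f k).arr b = σ.arr b) ∧ I k (f k) := by
    intro k
    induction k with
    | zero =>
      intro _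
      refine ⟨by simp [f, State.setVar], fun y hy => ?_, fun b _ => rfl, h0⟩
      have hx : y ≠ x := by rintro rfl; simp [assigns] at hy
      simp [f, State.setVar, hx]
    | succ k ih =>
      intro hk
      obtain ⟨h1, h2, h3, h4⟩ := ih (by omega)
      refine ⟨by simp [f, State.setVar], fun y hy => ?_, fun b hb => ?_,
        hs k _ (by omega) h1 h2 h3 h4⟩
      · have hx : y ≠ x := by rintro rfl; simp [assigns] at hy
        simp only [f, State.setVar, if_neg hx]
        rw [run_var _ _ (by simp [assigns] at hy; exact hy.2)]
        exact h2 y hy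
      · exact (run_arr _ _ hb).trans (h3 b hb)
  have := (key N le_rfl).2.2.2
  rw [run, hN, Int.toNat_natCast]
  exact this

end Cmd

/-! ### Growth of values without multiplication -/

/-- Expressions without multiplication. -/
def Expr.mulFree : Expr → Bool
  | .const _ => true
  | .var _ => true
  | .read _ i j => i.mulFree && j.mulFree
  | .add e f => e.mulFree && f.mulFree
  | .sub e f => e.mulFree && f.mulFree
  | .mul _ _ => false
  | .div e f => e.mulFree && f.mulFree
  | .le e f => e.mulFree && f.mulFree
  | .eq e f => e.mulFree && f.mulFree

/-- A bound for the growth factor and the number of nodes of an expression. -/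
def Expr.weight : Expr → ℕ
  | .const c => c.natAbs + 1
  | .var _ => 1
  | .read _ i j => i.weight + j.weight + 1
  | .add e f => e.weight + f.weight + 1
  | .sub e f => e.weight + f.weight + 1
  | .mul e f => e.weight + f.weight + 1
  | .div e f => e.weight + f.weight + 1
  | .le e f => e.weight + f.weight + 1
  | .eq e f => e.weight + f.weight + 1

/-- All values in memory are at most `M` in absolute value. -/
def State.BoundedBy (σ : State) (M : ℕ) : Prop :=
  (∀ x, (σ.var x).natAbs ≤ M) ∧ ∀ a i j, (σ.arr a i j).natAbs ≤ M

theorem State.BoundedBy.mono {σ : State} {M M' : ℕ} (h : σ.BoundedBy M) (hM : M ≤ M') :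
    σ.BoundedBy M' := ⟨fun x => (h.1 x).trans hM, fun a i j => (h.2 a i j).trans hM⟩

theorem State.BoundedBy.setVar {σ : State} {M : ℕ} (h : σ.BoundedBy M) (x : ℕ) {z : ℤ}
    (hz : z.natAbs ≤ M) : (σ.setVar x z).BoundedBy M := by
  refine ⟨fun y => ?_, h.2⟩
  simp only [State.setVar]
  split
  · exact hz
  · exact h.1 y

theorem State.BoundedBy.setArr {σ : State} {M : ℕ} (h : σ.BoundedBy M) (a : ℕ) (i j : ℤ) {z : ℤ}
    (hz : z.natAbs ≤ M) : (σ.setArr a i j z).BoundedBy M := by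
  refine ⟨h.1, fun a' i' j' => ?_⟩
  simp only [State.setArr]
  split
  · exact hz
  · exact h.2 a' i' j'

theorem natAbs_ite_le_one (P : Prop) [Decidable P] : (if P then (1 : ℤ) else 0).natAbs ≤ 1 := by
  split <;> simp

/-- Sums and differences add the growth factors, and integer division never increases the absolute
value. The growth factor depends on the expression only, so one assignment adds a constant number of
bits; a product could double it. -/
theorem Expr.natAbs_eval_le {e : Expr} (he : e.mulFree) {σ : State} {M : ℕ} (hM : 1 ≤ M)
    (hσ : σ.BoundedBy M) : (e.eval σ).natAbs ≤ e.weight * M := by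
  induction e with
  | const c => simp only [eval, weight]; nlinarith [Nat.mul_le_mul_left c.natAbs hM]
  | var x => simpa [eval, weight] using hσ.1 x
  | read a i j => simp only [eval, weight]; nlinarith [hσ.2 a (i.eval σ) (j.eval σ)]
  | add e f ihe ihf =>
    simp only [mulFree, Bool.and_eq_true] at he
    simp only [eval, weight]
    nlinarith [ihe he.1, ihf he.2, Int.natAbs_add_le (e.eval σ) (f.eval σ)]
  | sub e f ihe ihf =>
    simp only [mulFree, Bool.and_eq_true] at he
    simp only [eval, weight]
    nlinarith [ihe he.1, ihf he.2, Int.natAbs_sub_le (e.eval σ) (f.eval σ)]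
  | mul e f => simp [mulFree] at he
  | div e f ihe ihf =>
    simp only [mulFree, Bool.and_eq_true] at he
    simp only [eval, weight]
    nlinarith [ihe he.1, Int.natAbs_ediv_le_natAbs (e.eval σ) (f.eval σ)]
  | le e f =>
    simp only [eval, weight]
    nlinarith [natAbs_ite_le_one (e.eval σ ≤ f.eval σ)]
  | eq e f =>
    simp only [eval, weight]
    nlinarith [natAbs_ite_le_one (e.eval σ = f.eval σ)]

theorem bitLength_le {z : ℤ} {M : ℕ} (h : z.natAbs ≤ M) : bitLength z ≤ M.size + 1 :=
  Nat.succ_le_succ (Nat.size_le_size h)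

/-- The weight also bounds the number of nodes, and each node's value has at most `C` bits because
subexpressions have smaller weight. -/
theorem Expr.cost_le {e : Expr} (he : e.mulFree) {σ : State} {M C : ℕ} (hM : 1 ≤ M)
    (hσ : σ.BoundedBy M) (hC : (e.weight * M).size + 1 ≤ C) : e.cost σ ≤ e.weight * C := by
  have hval := bitLength_le (natAbs_eval_le he hM hσ)
  have mono : ∀ {a b : ℕ}, a ≤ b → (b * M).size + 1 ≤ C → (a * M).size + 1 ≤ C := fun hab hb =>
    (Nat.succ_le_succ (Nat.size_le_size (Nat.mul_le_mul_right _ hab))).trans hb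
  induction e with
  | const c =>
    simp only [cost, eval, weight] at hval hC ⊢
    nlinarith [Nat.zero_le (c.natAbs * C)]
  | var x =>
    simp only [cost, eval, weight] at hval hC ⊢
    omega
  | read a e f ihe ihf | add e f ihe ihf | sub e f ihe ihf | div e f ihe ihf | le e f ihe ihf
  | eq e f ihe ihf =>
    simp only [mulFree, Bool.and_eq_true] at he
    have h1 := ihe he.1 (mono (by simp only [weight]; omega) hC)
      (bitLength_le (natAbs_eval_le he.1 hM hσ))
    have h2 := ihf he.2 (mono (by simp only [weight]; omega) hC)
      (bitLength_le (natAbs_eval_le he.2 hM hσ))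
    simp only [cost, weight] at hval hC ⊢
    nlinarith
  | mul e f => simp [mulFree] at he

/-! ### Running time from the syntax of commands -/

namespace Cmd

/-- Well-formed commands: no multiplication, expressions of weight at most `K`, loops bounded by
the variables `2` and `3`, which are never assigned to. -/
def wellFormed (K : ℕ) : Cmd → Bool
  | skip => true
  | assign x e => e.mulFree && decide (e.weight ≤ K) && x != 2 && x != 3
  | write _ i j e => i.mulFree && j.mulFree && e.mulFree && decide (i.weight ≤ K) &&
      decide (j.weight ≤ K) && decide (e.weight ≤ K)
  | seq p q => p.wellFormed K && q.wellFormed K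
  | ite e p q => e.mulFree && decide (e.weight ≤ K) && p.wellFormed K && q.wellFormed K
  | .forTo x v p => x != 2 && x != 3 && (v == 2 || v == 3) && !p.assigns x && p.wellFormed K

/-- A bound for the number of steps if all loops are bounded by `N`, as a polynomial in `N`. -/
noncomputable def steps : Cmd → Polynomial ℕ
  | skip => 1
  | assign _ _ => 1
  | write _ _ _ _ => 1
  | seq p q => p.steps + q.steps
  | ite _ p q => 1 + p.steps + q.steps
  | .forTo _ _ p => 2 + Polynomial.X * (p.steps + 2)

theorem not_assigns_bound {K : ℕ} {p : Cmd} (h : p.wellFormed K) :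
    p.assigns 2 = false ∧ p.assigns 3 = false := by
  induction p with
  | skip => exact ⟨rfl, rfl⟩
  | assign x e => simp [wellFormed, assigns] at h ⊢; exact ⟨h.1.2, h.2⟩
  | write a i j e => exact ⟨rfl, rfl⟩
  | seq p q hp hq =>
    simp only [wellFormed, Bool.and_eq_true] at h
    simp [assigns, hp h.1, hq h.2]
  | ite e p q hp hq =>
    simp only [wellFormed, Bool.and_eq_true] at h
    simp [assigns, hp h.1.2, hq h.2]
  | forTo x v p hp =>
    simp only [wellFormed, Bool.and_eq_true] at h
    simp [assigns, hp h.2]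
    simpa using h.1.1.1

/-- Running times are polynomial, by the structure of the command. -/
theorem exec_compile {K N Mcap C : ℕ} (hK : 6 ≤ K) (hC : 3 * (K * ((K * Mcap).size + 1)) + 1 ≤ C)
    {p : Cmd} (hp : p.wellFormed K) {M : ℕ} {σ : State} (hM : 1 ≤ M) (hσ : σ.BoundedBy M)
    (hcap : M * K ^ (p.steps.eval N) ≤ Mcap) (h2 : σ.var 2 ≤ N) (h3 : σ.var 3 ≤ N) :
    ∃ c, Exec p.compile σ (p.run σ) c ∧ c ≤ p.steps.eval N * C ∧
      (p.run σ).BoundedBy (M * K ^ (p.steps.eval N)) := by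
  have hK1 : 1 ≤ K := by omega
  have hcost : ∀ {e : Expr} {M' : ℕ} {τ : State}, e.mulFree → e.weight ≤ K → 1 ≤ M' →
      τ.BoundedBy M' → M' ≤ Mcap → e.cost τ ≤ K * ((K * Mcap).size + 1) := by
    intro e M' τ he hw hM' hτ hc
    refine (Expr.cost_le he hM' hτ (C := (K * Mcap).size + 1) ?_).trans
      (Nat.mul_le_mul_right _ hw)
    exact Nat.succ_le_succ (Nat.size_le_size (Nat.mul_le_mul hw hc))
  have hval : ∀ {e : Expr} {M' : ℕ} {τ : State}, e.mulFree → e.weight ≤ K → 1 ≤ M' →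
      τ.BoundedBy M' → (e.eval τ).natAbs ≤ M' * K := by
    intro e M' τ he hw hM' hτ
    refine (Expr.natAbs_eval_le he hM' hτ).trans ?_
    rw [mul_comm]
    exact Nat.mul_le_mul_left _ hw
  have hpow : ∀ {a b : ℕ}, a ≤ b → M * K ^ a ≤ M * K ^ b := fun h =>
    Nat.mul_le_mul_left _ (Nat.pow_le_pow_right hK1 h)
  have hMK : M ≤ M * K := Nat.le_mul_of_pos_right _ hK1
  induction p generalizing M σ with
  | skip =>
    refine ⟨1, .skip σ, ?_, ?_⟩
    · simp only [steps, Polynomial.eval_one]; omega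
    · simp only [steps, Polynomial.eval_one, pow_one, run]
      exact hσ.mono hMK
  | assign x e =>
    simp only [wellFormed, Bool.and_eq_true, decide_eq_true_eq] at hp
    simp only [steps, Polynomial.eval_one, pow_one] at hcap ⊢
    refine ⟨_, .assign σ x e, ?_, ?_⟩
    · have := hcost hp.1.1.1 hp.1.1.2 hM hσ (hMK.trans hcap)
      omega
    · exact (hσ.mono hMK).setVar x (hval hp.1.1.1 hp.1.1.2 hM hσ)
  | write a i j e =>
    simp only [wellFormed, Bool.and_eq_true, decide_eq_true_eq] at hp
    obtain ⟨⟨⟨⟨⟨p1, p2⟩, p3⟩, p4⟩, p5⟩, p6⟩ := hp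
    simp only [steps, Polynomial.eval_one, pow_one] at hcap ⊢
    refine ⟨_, .write σ a i j e, ?_, ?_⟩
    -- Three expressions are evaluated here, whence the factor 3 in `hC`.
    · have c1 := hcost p1 p4 hM hσ (hMK.trans hcap)
      have c2 := hcost p2 p5 hM hσ (hMK.trans hcap)
      have c3 := hcost p3 p6 hM hσ (hMK.trans hcap)
      omega
    · exact (hσ.mono hMK).setArr a _ _ (hval p3 p6 hM hσ)
  | seq p q ihp ihq =>
    simp only [wellFormed, Bool.and_eq_true] at hp
    simp only [steps, Polynomial.eval_add] at hcap ⊢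
    obtain ⟨c, he, hc, hb⟩ := ihp hp.1 hM hσ ((hpow (Nat.le_add_right _ _)).trans hcap) h2 h3 hpow
      hMK
    have hM' : 1 ≤ M * K ^ (p.steps.eval N) := hM.trans (Nat.le_mul_of_pos_right _ (by positivity))
    have hna := not_assigns_bound hp.1
    obtain ⟨c', he', hc', hb'⟩ := ihq hp.2 hM' hb (by rwa [mul_assoc, ← pow_add])
      (by rwa [run_var _ _ hna.1]) (by rwa [run_var _ _ hna.2])
      (fun h => Nat.mul_le_mul_left _ (Nat.pow_le_pow_right hK1 h))
      (Nat.le_mul_of_pos_right _ hK1)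
    refine ⟨c + c', .seq he he', by rw [add_mul]; omega, ?_⟩
    rw [pow_add, ← mul_assoc]
    exact hb'
  | ite e p q ihp ihq =>
    simp only [wellFormed, Bool.and_eq_true, decide_eq_true_eq] at hp
    simp only [steps, Polynomial.eval_add, Polynomial.eval_one] at hcap ⊢
    have c1 := hcost hp.1.1.1 hp.1.1.2 hM hσ (by
      refine le_trans ?_ hcap
      exact Nat.le_mul_of_pos_right _ (by positivity))
    by_cases h0 : e.eval σ = 0
    · obtain ⟨c, he, hc, hb⟩ := ihq hp.2 hM hσ ((hpow (by omega)).trans hcap) h2 h3 hpow hMK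
      refine ⟨_, .iteFalse h0 (by rw [run, if_neg (not_not.2 h0)]; exact he), ?_, ?_⟩
      · rw [add_mul, add_mul]; omega
      · rw [run, if_neg (not_not.2 h0)]
        exact hb.mono (hpow (by omega))
    · obtain ⟨c, he, hc, hb⟩ := ihp hp.1.2 hM hσ ((hpow (by omega)).trans hcap) h2 h3 hpow hMK
      refine ⟨_, .iteTrue h0 (by rw [run, if_pos h0]; exact he), ?_, ?_⟩
      · rw [add_mul, add_mul]; omega
      · rw [run, if_pos h0]
        exact hb.mono (hpow (by omega))
  | forTo x v p ih =>
    simp only [wellFormed, Bool.and_eq_true, Bool.or_eq_true, bne_iff_ne, beq_iff_eq,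
      Bool.not_eq_true'] at hp
    obtain ⟨⟨⟨⟨hx2, hx3⟩, hv⟩, hpx⟩, hp⟩ := hp
    simp only [steps, Polynomial.eval_add, Polynomial.eval_mul, Polynomial.eval_X,
      Polynomial.eval_ofNat] at hcap ⊢
    set s := p.steps.eval N with hs
    set R := (σ.var v).toNat with hR
    have hna := not_assigns_bound hp
    have hvx : v ≠ x := by rcases hv with rfl | rfl <;> omega
    have hpv : p.assigns v = false := by rcases hv with rfl | rfl; exacts [hna.1, hna.2]
    have hRN : R ≤ N := by rcases hv with rfl | rfl <;> omega
    let τ : ℕ → State := fun k =>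
      Nat.rec (σ.setVar x 0) (fun k τ => (p.run τ).setVar x ((k : ℤ) + 1)) k
    have hτ : ∀ k, τ (k + 1) = (p.run (τ k)).setVar x ((k : ℤ) + 1) := fun _ => rfl
    have hτx : ∀ k, (τ k).var x = k := by
      intro k; cases k <;> simp [τ, State.setVar]
    have hτy : ∀ y, y ≠ x → p.assigns y = false → ∀ k, (τ k).var y = σ.var y := by
      intro y hy hpy k
      induction k with
      | zero => simp [τ, State.setVar, hy]
      | succ k ihk => rw [hτ]; simp only [State.setVar, if_neg hy]; rw [run_var _ _ hpy, ihk]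
    have hexp : ∀ k < R, 1 + (k + 1) * (s + 1) ≤ 2 + N * (s + 2) := fun k hk => by
      have : (k + 1) * (s + 1) ≤ N * (s + 2) := Nat.mul_le_mul (by omega) (by omega)
      omega
    have hw1 : (Expr.add (.var x) (.const 1)).weight ≤ K := by
      simp only [Expr.weight]; norm_num; omega
    -- The exponent counts growth steps: 1 for initialising the counter, then in each round `s` for
    -- the body and 1 for the increment.
    have hbody : ∀ k < R, (τ k).BoundedBy (M * K ^ (1 + k * (s + 1))) → ∃ c,
        Exec (.seq p.compile (.assign x (.add (.var x) (.const 1)))) (τ k) (τ (k + 1)) c ∧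
        c ≤ (s + 1) * C ∧ (τ (k + 1)).BoundedBy (M * K ^ (1 + (k + 1) * (s + 1))) := by
      intro k hk hb
      have hM' : 1 ≤ M * K ^ (1 + k * (s + 1)) :=
        hM.trans (Nat.le_mul_of_pos_right _ (by positivity))
      have he1 : 1 + (k + 1) * (s + 1) = 1 + k * (s + 1) + s + 1 := by ring
      have hle := hexp k hk
      obtain ⟨c, he, hc, hb'⟩ := ih hp hM' hb (by
          rw [mul_assoc, ← pow_add]
          exact (hpow (by omega)).trans hcap)
        (by rwa [hτy 2 (Ne.symm hx2) hna.1]) (by rwa [hτy 3 (Ne.symm hx3) hna.2])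
        (fun h => Nat.mul_le_mul_left _ (Nat.pow_le_pow_right hK1 h))
        (Nat.le_mul_of_pos_right _ hK1)
      rw [mul_assoc, ← pow_add] at hb'
      have hM'' : 1 ≤ M * K ^ (1 + k * (s + 1) + s) :=
        hM.trans (Nat.le_mul_of_pos_right _ (by positivity))
      -- `run` sets the counter outright while the compiled loop increments it; they agree because
      -- the body does not assign to `x`.
      have hev : (Expr.add (.var x) (.const 1)).eval (p.run (τ k)) = (k : ℤ) + 1 := by
        simp [Expr.eval, run_var _ _ hpx, hτx]
      have hc2 := hcost (e := Expr.add (.var x) (.const 1)) rfl hw1 hM'' hb'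
        ((hpow (by omega)).trans hcap)
      have hv2 := hval (e := Expr.add (.var x) (.const 1)) rfl hw1 hM'' hb'
      have hex := Exec.assign (p.run (τ k)) x (.add (.var x) (.const 1))
      rw [hev] at hex hv2
      refine ⟨_, .seq he hex, ?_, ?_⟩
      · rw [add_mul]; omega
      · rw [he1, pow_succ K (1 + k * (s + 1) + s), ← mul_assoc, hτ]
        exact (hb'.mono (Nat.le_mul_of_pos_right _ hK1)).setVar x hv2
    have hbound : ∀ k ≤ R, (τ k).BoundedBy (M * K ^ (1 + k * (s + 1))) := by
      intro k
      induction k with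
      | zero =>
        intro _
        refine (hσ.mono ?_).setVar x (by simp)
        exact Nat.le_mul_of_pos_right _ (by positivity)
      | succ k ihk =>
        intro hk
        obtain ⟨_, _, _, h⟩ := hbody k (by omega) (ihk (by omega))
        exact h
    -- The loop test has weight 6, which is the reason for `6 ≤ K`.
    have htest : ∀ k ≤ R, (Expr.le (.add (.var x) (.const 1)) (.var v)).cost (τ k) + 1 ≤ C := by
      intro k hk
      have := hcost (e := Expr.le (.add (.var x) (.const 1)) (.var v)) rfl
        (by simp only [Expr.weight]; norm_num; omega)
        (hM.trans (Nat.le_mul_of_pos_right M (by positivity))) (hbound k hk) (by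
          refine (hpow ?_).trans hcap
          have : k * (s + 1) ≤ N * (s + 2) := Nat.mul_le_mul (by omega) (by omega)
          omega)
      omega
    have heval : ∀ k, (Expr.le (.add (.var x) (.const 1)) (.var v)).eval (τ k) =
        if (k : ℤ) + 1 ≤ σ.var v then 1 else 0 := by
      intro k
      simp [Expr.eval, hτx, hτy v hvx hpv]
    -- Induction on the number `r` of rounds still to run. A round costs at most `s + 2` units
    -- (body, increment, test); the extra unit is the failing test at the end.
    have hloop : ∀ r ≤ R, ∃ c, Exec (.loop (.le (.add (.var x) (.const 1)) (.var v))
        (.seq p.compile (.assign x (.add (.var x) (.const 1))))) (τ (R - r)) (τ R) c ∧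
        c ≤ (r * (s + 2) + 1) * C := by
      intro r
      induction r with
      | zero =>
        intro _
        refine ⟨_, .loopFalse ?_, ?_⟩
        · rw [Nat.sub_zero, heval, if_neg (by omega)]
        · have := htest (R - 0) (by omega)
          omega
      | succ r ihr =>
        intro hr
        obtain ⟨c, he, hc⟩ := ihr (by omega)
        obtain ⟨c', he', hc', -⟩ := hbody (R - (r + 1)) (by omega) (hbound _ (by omega))
        have e1 : R - (r + 1) + 1 = R - r := by omega
        rw [e1] at he'
        refine ⟨_, .loopTrue ?_ he' he, ?_⟩
        · rw [heval, if_pos (by omega)]; exact one_ne_zero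
        · have := htest (R - (r + 1)) (by omega)
          have e2 : ((r + 1) * (s + 2) + 1) * C =
              (r * (s + 2) + 1) * C + (s + 1) * C + C := by ring
          omega
    obtain ⟨c, he, hc⟩ := hloop R le_rfl
    rw [Nat.sub_self] at he
    have hinit := Exec.assign σ x (.const 0)
    have hci := hcost (e := Expr.const 0) rfl (by simp [Expr.weight]; omega) hM hσ
      ((Nat.le_mul_of_pos_right _ (by positivity)).trans hcap)
    refine ⟨_, .seq hinit he, ?_, ?_⟩
    · have e3 : (2 + N * (s + 2)) * C = C + (N * (s + 2) + 1) * C := by ring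
      have e4 : (R * (s + 2) + 1) * C ≤ (N * (s + 2) + 1) * C :=
        Nat.mul_le_mul_right _ (Nat.succ_le_succ (Nat.mul_le_mul_right _ hRN))
      omega
    · refine (hbound R le_rfl).mono (hpow ?_)
      have : R * (s + 1) ≤ N * (s + 2) := Nat.mul_le_mul (by omega) (by omega)
      omega

end Cmd

/-! ## The program -/

/-- This lets the program divide wherever it would multiply by a sign, which keeps it
multiplication-free. The case `s = 0` rests on `x / 0 = 0`. -/
theorem IsSign.div_eq_mul {s : ℤ} (h : IsSign s) (z : ℤ) : z / s = z * s := by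
  rcases h with rfl | rfl | rfl <;> simp

theorem IsSign.mul {s t : ℤ} (h : IsSign s) (h' : IsSign t) : IsSign (s * t) := by
  rcases h with rfl | rfl | rfl <;> rcases h' with rfl | rfl | rfl <;> simp [IsSign]

theorem IsSign.neg {s : ℤ} (h : IsSign s) : IsSign (-s) := by
  rcases h with rfl | rfl | rfl <;> simp [IsSign]

/-- Row `ρ` of array `a` as an integer vector. -/
def State.vec (σ : State) (n a : ℕ) (ρ : ℤ) : Fin n → ℤ := fun j => σ.arr a ρ ((j : ℕ) : ℤ)

namespace Cmd

/-- Variable `s` becomes the product of row `var 5` of array `4`, which has entries `0`, `1`, `-1`,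
with row `r` of array `a`. -/
def dot (s a : ℕ) (r : Expr) : Cmd :=
  .seq (.assign s (.const 0)) (.forTo 6 2 (.assign s
    (.add (.var s) (.div (.read a r (.var 6)) (.read 4 (.var 5) (.var 6))))))

/-- Row `r` of array `a` is filled with the values of `e` for `var 6 = 0, …, n - 1`. -/
def fill (a : ℕ) (r e : Expr) : Cmd := .forTo 6 2 (.write a r (.var 6) e)

/-- Variable `x` becomes some `k < n` for which `e` is nonzero at `var 7 = k`, or `-1`. -/
def search (x : ℕ) (e : Expr) : Cmd :=
  .seq (.assign x (.const (-1))) (.forTo 7 2 (.ite e (.assign x (.var 7)) .skip))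

/-- Array `7` receives the products of row `var 5` of array `4` with the rows of array `5`. -/
def products : Cmd :=
  .forTo 7 2 (.seq (.dot 9 5 (.var 7)) (.write 7 (.const 0) (.var 7) (.var 9)))

/-- Elimination in the marked rows of array `5` by means of row `var 10`. -/
def eliminate : Cmd :=
  .forTo 7 2 (.ite (.read 6 (.const 0) (.var 7))
    (.fill 5 (.var 7) (.sub (.read 5 (.var 7) (.var 6)) (.div (.read 5 (.var 10) (.var 6))
      (.div (.read 7 (.const 0) (.var 7)) (.read 7 (.const 0) (.var 10)))))) .skip)

/-- Restriction of a kernel basis to the kernel of row `var 5`. -/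
def pivot : Cmd :=
  .seq .products <|
  .seq (.search 10 (.div (.read 7 (.const 0) (.var 7)) (.read 6 (.const 0) (.var 7)))) <|
  .ite (.le (.const 0) (.var 10))
    (.seq (.write 6 (.const 0) (.var 10) (.const 0)) .eliminate) .skip

/-- Array `5` becomes the identity matrix, with all rows marked in array `6`. -/
def identity : Cmd :=
  .forTo 7 2 (.seq (.write 6 (.const 0) (.var 7) (.const 1))
    (.fill 5 (.var 7) (.eq (.var 7) (.var 6))))

/-- The marked rows of array `5` become a kernel basis for the rows that vanish on the vector in
array `9`. -/
def gauss : Cmd :=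
  .seq .identity (.forTo 5 3 (.seq (.dot 8 9 (.const 0)) (.ite (.var 8) .skip .pivot)))

/-- Variable `11` becomes the least positive ratio between the products of the rows of array `4`
with the vectors in arrays `a` and `10`, or `0`. -/
def ratio (a : ℕ) : Cmd :=
  .seq (.assign 11 (.const 0)) (.forTo 5 3 (.seq (.dot 8 10 (.const 0)) <|
    .seq (.dot 9 a (.const 0)) <|
    .seq (.assign 9 (.div (.var 9) (.var 8))) <|
    .ite (.le (.const 1) (.var 9))
      (.ite (.eq (.var 11) (.const 0)) (.assign 11 (.var 9))
        (.ite (.le (.var 9) (.var 11)) (.assign 11 (.var 9)) .skip)) .skip))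

/-- The vector in array `10` is negated if necessary, and subtracted from the vector in array `a`
as often as possible. -/
def orient (a : ℕ) : Cmd :=
  .seq (.ratio a) <|
  .seq (.ite (.var 11) .skip
    (.seq (.fill 10 (.const 0) (.sub (.const 0) (.read 10 (.const 0) (.var 6)))) (.ratio a))) <|
  .fill a (.const 0) (.sub (.read a (.const 0) (.var 6))
    (.div (.var 11) (.read 10 (.const 0) (.var 6))))

/-- A kernel basis for the zeros of the vector in array `9`, and an index of a basis vector
that occurs in it. -/
def solve : Cmd :=
  .seq .gauss (.search 12 (.div (.read 9 (.const 0) (.var 7)) (.read 6 (.const 0) (.var 7))))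

/-- The vector in array `9` gets more zeros, if possible. -/
def reduce : Cmd :=
  .seq .solve <|
  .seq (.search 13 (.div (.read 6 (.const 0) (.var 7))
    (.sub (.const 1) (.eq (.var 7) (.var 12))))) <|
  .ite (.le (.const 0) (.var 13))
    (.seq (.fill 10 (.const 0) (.read 5 (.var 13) (.var 6))) (.orient 9)) .skip

/-- One iteration of the algorithm, for the vector in array `8`. -/
def iteration : Cmd :=
  .seq (.fill 9 (.const 0) (.read 8 (.const 0) (.var 6))) <|
  .seq (.forTo 15 3 .reduce) <|
  .seq .solve <|
  .seq (.fill 10 (.const 0) (.read 5 (.var 12) (.var 6))) (.orient 8)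

/-- The circuit, its coefficient and the next point of the walk are written to the output. -/
def output : Cmd :=
  .seq (.fill 0 (.var 0) (.read 10 (.const 0) (.var 6))) <|
  .seq (.write 1 (.var 0) (.const 0) (.var 11)) <|
  .seq (.assign 0 (.add (.var 0) (.const 1)))
    (.fill 2 (.var 0) (.sub (.read 3 (.const 0) (.var 6)) (.read 8 (.const 0) (.var 6))))

/-- Array `4` becomes the matrix with the rows of arrays `0` and `1`. -/
def stack : Cmd :=
  .forTo 5 3 (.ite (.le (.add (.var 5) (.const 1)) (.var 4))
    (.fill 4 (.var 5) (.read 0 (.var 5) (.var 6)))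
    (.fill 4 (.var 5) (.read 1 (.sub (.var 5) (.var 4)) (.var 6))))

/-- The whole algorithm, when the variables `3` and `4` hold `m_A + m_B` and `m_A`. -/
def main : Cmd :=
  .seq .stack <|
  .seq (.fill 8 (.const 0) (.sub (.read 3 (.const 0) (.var 6)) (.read 2 (.const 0) (.var 6)))) <|
  .seq (.assign 0 (.const 0)) <|
  .forTo 14 2 (.seq (.search 16 (.read 8 (.const 0) (.var 7)))
    (.ite (.le (.const 0) (.var 16)) (.seq .iteration .output) .skip))

/-- The value 100 is generous: any constant that is at least 6 and bounds the weights of all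
expressions in the program would do. -/
theorem main_wellFormed : main.wellFormed 100 := by decide

end Cmd

/-- The memory holds the dimensions and the matrix `D`. -/
structure Holds {m n : ℕ} (σ : State) (D : Matrix (Fin m) (Fin n) ℤ) : Prop where
  cols : σ.var 2 = n
  rows : σ.var 3 = m
  entry : ∀ (i : Fin m) (j : Fin n), σ.arr 4 ((i : ℕ) : ℤ) ((j : ℕ) : ℤ) = D i j

/-! ### Correctness of the elementary commands -/

section Basic

variable {m n : ℕ} {D : Matrix (Fin m) (Fin n) ℤ} {σ : State}

theorem Holds.congr (h : Holds σ D) {τ : State} (h2 : τ.var 2 = σ.var 2) (h3 : τ.var 3 = σ.var 3)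
    (h4 : τ.arr 4 = σ.arr 4) : Holds τ D :=
  ⟨h2.trans h.cols, h3.trans h.rows, fun i j => by rw [h4]; exact h.entry i j⟩

theorem Holds.run (h : Holds σ D) {p : Cmd} (h2 : p.assigns 2 = false) (h3 : p.assigns 3 = false)
    (h4 : p.writes 4 = false) : Holds (p.run σ) D :=
  h.congr (p.run_var σ h2) (p.run_var σ h3) (p.run_arr σ h4)

/-- Each summand is divided by an entry of `D`, which is a sign, so division is multiplication. `hr`
asks that the row expression be unaffected by the accumulator and the loop counter. -/
theorem run_dot (hD : ∀ i j, IsSign (D i j)) (h : Holds σ D) {s a : ℕ} {r : Expr} {ρ : ℤ}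
    (hs2 : s ≠ 2) (hs5 : s ≠ 5) (hs6 : s ≠ 6) {i : Fin m} (hi : σ.var 5 = ((i : ℕ) : ℤ))
    (hr : ∀ τ : State, (∀ y, y ≠ s → y ≠ 6 → τ.var y = σ.var y) → r.eval τ = ρ) :
    ((Cmd.dot s a r).run σ).var s = D.mulVec (σ.vec n a ρ) i := by
  have key := Cmd.run_for (x := 6) (v := 2) (p := .assign s
    (.add (.var s) (.div (.read a r (.var 6)) (.read 4 (.var 5) (.var 6)))))
    (σ := σ.setVar s 0) (N := n) (by simp [State.setVar, hs2.symm, h.cols])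
    (fun k τ => τ.var s = ∑ j ∈ Finset.range k, σ.arr 4 ((i : ℕ) : ℤ) (j : ℤ) * σ.arr a ρ (j : ℤ))
    (by simp [State.setVar, hs6])
    (by
      intro k τ hk hτ6 hτv hτa hI
      have hvar : ∀ y, y ≠ s → y ≠ 6 → τ.var y = σ.var y := fun y hys hy6 => by
        rw [hτv y (by simp [Cmd.assigns, Ne.symm hys, Ne.symm hy6])]
        simp [State.setVar, hys]
      have harr : τ.arr = σ.arr := by
        funext b; exact hτa b rfl
      have h5 : τ.var 5 = ((i : ℕ) : ℤ) := by rw [hvar 5 hs5.symm (by norm_num), hi]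
      have hsgn : IsSign (σ.arr 4 ((i : ℕ) : ℤ) (k : ℤ)) := by
        have := h.entry i ⟨k, hk⟩
        simp only at this
        rw [this]
        exact hD _ _
      rw [Finset.sum_range_succ]
      simp only [Cmd.run, Expr.eval, State.setVar, if_neg hs6, hr τ hvar, hτ6, h5, harr, if_true,
        hsgn.div_eq_mul, hI]
      ring)
  refine key.trans ?_
  rw [Finset.sum_range (n := n), Matrix.mulVec, dotProduct]
  exact Finset.sum_congr rfl fun j _ => by rw [h.entry i j]; rfl

/-- The expression `e` may read array `a` itself: other rows, and the entry about to be overwritten,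
still have their initial values. The long hypothesis `he` grants exactly this. -/
theorem run_fill (h2 : σ.var 2 = n) {a : ℕ} {r e : Expr} {ρ : ℤ} {f : Fin n → ℤ}
    (hr : ∀ τ : State, (∀ y, y ≠ 6 → τ.var y = σ.var y) → r.eval τ = ρ)
    (he : ∀ (τ : State) (j : Fin n), (∀ y, y ≠ 6 → τ.var y = σ.var y) → τ.var 6 = ((j : ℕ) : ℤ) →
      (∀ b, b ≠ a → τ.arr b = σ.arr b) → (∀ i, i ≠ ρ → τ.arr a i = σ.arr a i) →
      τ.arr a ρ ((j : ℕ) : ℤ) = σ.arr a ρ ((j : ℕ) : ℤ) → e.eval τ = f j) :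
    ((Cmd.fill a r e).run σ).vec n a ρ = f ∧
      ∀ i, i ≠ ρ → ((Cmd.fill a r e).run σ).arr a i = σ.arr a i := by
  have key := Cmd.run_for (x := 6) (v := 2) (p := .write a r (.var 6) e) (σ := σ) (N := n) h2
    (fun k τ => (∀ j : Fin n, (j : ℕ) < k → τ.arr a ρ ((j : ℕ) : ℤ) = f j) ∧
      (∀ j : Fin n, k ≤ (j : ℕ) → τ.arr a ρ ((j : ℕ) : ℤ) = σ.arr a ρ ((j : ℕ) : ℤ)) ∧
      ∀ i, i ≠ ρ → τ.arr a i = σ.arr a i)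
    ⟨fun j hj => absurd hj (Nat.not_lt_zero _), fun _ _ => rfl, fun _ _ => rfl⟩
    (by
      rintro k τ hk hτ6 hτv hτa ⟨hlt, hge, hne⟩
      have hvar : ∀ y, y ≠ 6 → τ.var y = σ.var y := fun y hy => hτv y (by
        simp [Cmd.assigns, hy.symm])
      have harr : ∀ b, b ≠ a → τ.arr b = σ.arr b := fun b hb => hτa b (by
        simp [Cmd.writes, hb.symm])
      have hev := he τ ⟨k, hk⟩ hvar hτ6 harr hne (hge ⟨k, hk⟩ le_rfl)
      refine ⟨fun j hj => ?_, fun j hj => ?_, fun i hi => ?_⟩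
      · simp only [Cmd.run, Expr.eval, State.setVar, State.setArr, hr τ hvar, hτ6, hev, true_and,
          Nat.cast_inj]
        split_ifs with hjk
        · congr 1
          exact Fin.ext hjk.symm
        · exact hlt j (by omega)
      · simp only [Cmd.run, Expr.eval, State.setVar, State.setArr, hr τ hvar, hτ6, true_and,
          Nat.cast_inj]
        rw [if_neg (by omega)]
        exact hge j (by omega)
      · funext j
        simp only [Cmd.run, Expr.eval, State.setVar, State.setArr, hr τ hvar, hi, false_and,
          and_false, if_false]
        rw [hne i hi])
  exact ⟨funext fun j => key.1 j j.2, key.2.2⟩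

/-- The last hit overwrites earlier ones, and -1 survives only if there is none. -/
theorem run_search (h2 : σ.var 2 = n) {x : ℕ} {e : Expr} (hx2 : x ≠ 2) (hx7 : x ≠ 7)
    {P : Fin n → Prop}
    (he : ∀ (τ : State) (k : Fin n), (∀ y, y ≠ x → y ≠ 7 → τ.var y = σ.var y) →
      τ.arr = σ.arr → τ.var 7 = ((k : ℕ) : ℤ) → (e.eval τ ≠ 0 ↔ P k)) :
    (((Cmd.search x e).run σ).var x = -1 ∧ ∀ k, ¬ P k) ∨
      ∃ k : Fin n, ((Cmd.search x e).run σ).var x = ((k : ℕ) : ℤ) ∧ P k := by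
  have key := Cmd.run_for (x := 7) (v := 2) (p := .ite e (.assign x (.var 7)) .skip)
    (σ := σ.setVar x (-1)) (N := n) (by simp [State.setVar, hx2.symm, h2])
    (fun k τ => (τ.var x = -1 ∧ ∀ l : Fin n, (l : ℕ) < k → ¬ P l) ∨
      ∃ l : Fin n, τ.var x = ((l : ℕ) : ℤ) ∧ P l)
    (Or.inl ⟨by simp [State.setVar, hx7], fun l hl => absurd hl (Nat.not_lt_zero _)⟩)
    (by
      intro k τ hk hτ7 hτv hτa hI
      have hvar : ∀ y, y ≠ x → y ≠ 7 → τ.var y = σ.var y := fun y hyx hy7 => by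
        rw [hτv y (by simp [Cmd.assigns, Ne.symm hyx, Ne.symm hy7])]
        simp [State.setVar, hyx]
      have hP := he τ ⟨k, hk⟩ hvar (funext fun b => hτa b rfl) hτ7
      by_cases h0 : P ⟨k, hk⟩
      · refine Or.inr ⟨⟨k, hk⟩, ?_, h0⟩
        simp [Cmd.run, hP.2 h0, State.setVar, hx7, Expr.eval, hτ7]
      · have h1 : e.eval τ = 0 := by by_contra hc; exact h0 (hP.1 hc)
        simp only [Cmd.run, h1, ne_eq, not_true, if_false, State.setVar, if_neg hx7]
        rcases hI with ⟨hI, hl⟩ | hI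
        · refine Or.inl ⟨hI, fun l hlk => ?_⟩
          rcases Nat.lt_succ_iff_lt_or_eq.1 hlk with h | h
          · exact hl l h
          · have : l = ⟨k, hk⟩ := Fin.ext h
            rw [this]; exact h0
        · exact Or.inr hI)
  rcases key with ⟨h, hl⟩ | h
  · exact Or.inl ⟨h, fun l => hl l l.2⟩
  · exact Or.inr h

end Basic

/-- The marked indices. -/
def State.marked (σ : State) (n : ℕ) : Finset (Fin n) :=
  Finset.univ.filter fun k => σ.arr 6 0 ((k : ℕ) : ℤ) ≠ 0

/-- The rows of array `5`. -/
def State.basis (σ : State) (n : ℕ) : Fin n → Fin n → ℤ := fun k => σ.vec n 5 ((k : ℕ) : ℤ)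

theorem State.mem_marked {σ : State} {n : ℕ} {k : Fin n} :
    k ∈ σ.marked n ↔ σ.arr 6 0 ((k : ℕ) : ℤ) ≠ 0 := by simp [State.marked]

theorem State.vec_congr {σ τ : State} {n a : ℕ} {ρ : ℤ} (h : τ.arr a = σ.arr a) :
    τ.vec n a ρ = σ.vec n a ρ := by
  funext j; simp [State.vec, h]

/-- The memory holds a kernel basis for the rows of `D` with index in `Z`. -/
structure HoldsBasis {m n : ℕ} (σ : State) (D : Matrix (Fin m) (Fin n) ℤ) (Z : Set (Fin m)) :
    Prop where
  basis : KernelBasis D Z (σ.marked n) (σ.basis n)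
  flag : ∀ k : Fin n, σ.arr 6 0 ((k : ℕ) : ℤ) = 0 ∨ σ.arr 6 0 ((k : ℕ) : ℤ) = 1

theorem HoldsBasis.congr {m n : ℕ} {σ τ : State} {D : Matrix (Fin m) (Fin n) ℤ} {Z : Set (Fin m)}
    (h : HoldsBasis σ D Z) (h5 : τ.arr 5 = σ.arr 5) (h6 : τ.arr 6 = σ.arr 6) :
    HoldsBasis τ D Z := by
  have e1 : τ.marked n = σ.marked n := by ext k; simp [State.mem_marked, h6]
  have e2 : τ.basis n = σ.basis n := funext fun k => State.vec_congr h5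
  exact ⟨by rw [e1, e2]; exact h.basis, by rw [h6]; exact h.flag⟩

/-! ### Correctness of Gaussian elimination -/

section Gauss

variable {m n : ℕ} {D : Matrix (Fin m) (Fin n) ℤ} {σ : State}

theorem run_identity (h : Holds σ D) : HoldsBasis (Cmd.identity.run σ) D ∅ := by
  have key := Cmd.run_for (x := 7) (v := 2) (p := .seq (.write 6 (.const 0) (.var 7) (.const 1))
      (.fill 5 (.var 7) (.eq (.var 7) (.var 6)))) (σ := σ) (N := n) h.cols
    (fun k τ => ∀ l : Fin n, (l : ℕ) < k → τ.arr 6 0 ((l : ℕ) : ℤ) = 1 ∧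
      τ.basis n l = fun j => if l = j then 1 else 0)
    (fun l hl => absurd hl (Nat.not_lt_zero _))
    (by
      intro k τ hk hτ7 hτv hτa hI l hl
      let τ₁ := τ.setArr 6 0 (k : ℤ) 1
      have hrun : (Cmd.seq (.write 6 (.const 0) (.var 7) (.const 1))
          (.fill 5 (.var 7) (.eq (.var 7) (.var 6)))).run τ =
          (Cmd.fill 5 (.var 7) (.eq (.var 7) (.var 6))).run τ₁ := by
        simp only [Cmd.run, Expr.eval, hτ7, τ₁]
      rw [hrun]
      have h2 : τ₁.var 2 = n := by
        rw [← h.cols]; exact hτv 2 rfl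
      obtain ⟨f1, f2⟩ := run_fill (σ := τ₁) h2 (a := 5) (r := .var 7) (e := .eq (.var 7) (.var 6))
        (ρ := (k : ℤ)) (f := fun j => if (⟨k, hk⟩ : Fin n) = j then 1 else 0)
        (fun υ hυ => (hυ 7 (by norm_num)).trans hτ7)
        (fun υ j hυ hυ6 _ _ _ => by
          simp only [Expr.eval, hυ6, (hυ 7 (by norm_num)).trans hτ7, Nat.cast_inj, Fin.ext_iff])
      have h6 : ((Cmd.fill 5 (.var 7) (.eq (.var 7) (.var 6))).run τ₁).arr 6 = τ₁.arr 6 :=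
        Cmd.run_arr _ _ rfl
      have hflag : ((Cmd.fill 5 (.var 7) (.eq (.var 7) (.var 6))).run τ₁).arr 6 0 ((l : ℕ) : ℤ) =
          if (l : ℕ) = k then 1 else τ.arr 6 0 ((l : ℕ) : ℤ) := by
        rw [h6]
        simp [τ₁, State.setArr]
      refine ⟨hflag.trans ?_, ?_⟩
      · split_ifs with hlk
        · rfl
        · exact (hI l (by omega)).1
      · by_cases hlk : (l : ℕ) = k
        · obtain rfl : l = ⟨k, hk⟩ := Fin.ext hlk
          exact f1
        · rw [← (hI l (by omega)).2]
          funext j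
          have := congrFun (f2 ((l : ℕ) : ℤ) (by exact_mod_cast hlk)) ((j : ℕ) : ℤ)
          exact this)
  refine ⟨?_, fun k => Or.inr (key k k.2).1⟩
  have hm : (Cmd.identity.run σ).marked n = Finset.univ := by
    ext k
    simp only [State.mem_marked, Finset.mem_univ, iff_true]
    have := (key k k.2).1
    change _ = _ at this
    rw [Cmd.identity, this]
    exact one_ne_zero
  rw [hm]
  exact KernelBasis.init D fun k j => congrFun (key k k.2).2 j

theorem run_products (hD : ∀ i j, IsSign (D i j)) (h : Holds σ D) {i : Fin m}
    (hi : σ.var 5 = ((i : ℕ) : ℤ)) (l : Fin n) :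
    (Cmd.products.run σ).arr 7 0 ((l : ℕ) : ℤ) = D.mulVec (σ.basis n l) i := by
  have key := Cmd.run_for (x := 7) (v := 2)
    (p := .seq (.dot 9 5 (.var 7)) (.write 7 (.const 0) (.var 7) (.var 9)))
    (σ := σ) (N := n) h.cols
    (fun k τ => ∀ l : Fin n, (l : ℕ) < k →
      τ.arr 7 0 ((l : ℕ) : ℤ) = D.mulVec (σ.basis n l) i)
    (fun l hl => absurd hl (Nat.not_lt_zero _))
    (by
      intro k τ hk hτ7 hτv hτa hI l hl
      have hh : Holds τ D := h.congr (hτv 2 rfl) (hτv 3 rfl) (hτa 4 rfl)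
      have hdot := run_dot (σ := τ) hD hh (s := 9) (a := 5) (r := .var 7) (ρ := (k : ℤ))
        (by norm_num) (by norm_num) (by norm_num) (i := i) ((hτv 5 rfl).trans hi)
        (fun υ hυ => (hυ 7 (by norm_num) (by norm_num)).trans hτ7)
      have h7 : ((Cmd.dot 9 5 (.var 7)).run τ).var 7 = k := (Cmd.run_var _ _ rfl).trans hτ7
      have ha : ((Cmd.dot 9 5 (.var 7)).run τ).arr 7 = τ.arr 7 := Cmd.run_arr _ _ rfl
      have hv : τ.vec n 5 (k : ℤ) = σ.vec n 5 (k : ℤ) := State.vec_congr (hτa 5 rfl)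
      simp only [Cmd.run, Expr.eval, State.setVar, State.setArr, hdot, h7, ha, true_and,
        Nat.cast_inj, hv]
      split_ifs with hlk
      · simp [State.basis, hlk]
      · exact hI l (by omega))
  exact key l l.2

/-- Row `p` has been unmarked beforehand (`hp0`), so it stays fixed while the others change. The
nested quotient `T p / (c l / c p)` equals `c l * c p * T p` for signs; if `c l = 0`, the zero
divisor correctly gives 0. -/
theorem run_eliminate (h2 : σ.var 2 = n) {p : Fin n} (hp : σ.var 10 = ((p : ℕ) : ℤ))
    (hp0 : σ.arr 6 0 ((p : ℕ) : ℤ) = 0) {c : Fin n → ℤ}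
    (hc : ∀ l : Fin n, σ.arr 7 0 ((l : ℕ) : ℤ) = c l) (hcp : IsSign (c p))
    (hcs : ∀ l ∈ σ.marked n, IsSign (c l)) (l : Fin n) (hl : l ∈ σ.marked n) (j : Fin n) :
    (Cmd.eliminate.run σ).basis n l j = σ.basis n l j - c l * c p * σ.basis n p j := by
  have key := Cmd.run_for (x := 7) (v := 2) (p := .ite (.read 6 (.const 0) (.var 7))
    (.fill 5 (.var 7) (.sub (.read 5 (.var 7) (.var 6)) (.div (.read 5 (.var 10) (.var 6))
      (.div (.read 7 (.const 0) (.var 7)) (.read 7 (.const 0) (.var 10)))))) .skip)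
    (σ := σ) (N := n) h2
    (fun k τ => ∀ l : Fin n, τ.basis n l = if (l : ℕ) < k ∧ l ∈ σ.marked n then
      σ.basis n l - (c l * c p) • σ.basis n p else σ.basis n l)
    (fun l => by rw [if_neg (by omega)]; rfl)
    (by
      intro k τ hk hτ7 hτv hτa hI l
      have h6 : τ.arr 6 = σ.arr 6 := hτa 6 rfl
      have h7 : τ.arr 7 = σ.arr 7 := hτa 7 rfl
      have hev : (Expr.read 6 (.const 0) (.var 7)).eval τ = σ.arr 6 0 (k : ℤ) := by
        simp only [Expr.eval, h6, hτ7]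
      by_cases hkm : (⟨k, hk⟩ : Fin n) ∈ σ.marked n
      · have hk0 := State.mem_marked.1 hkm
        simp only [Cmd.run, hev, hk0, ne_eq, not_false_eq_true, if_true]
        have hbp : τ.basis n p = σ.basis n p := by
          rw [hI p, if_neg fun h => State.mem_marked.1 h.2 hp0]
        have hbk : τ.basis n ⟨k, hk⟩ = σ.basis n ⟨k, hk⟩ := by
          rw [hI, if_neg fun h => lt_irrefl _ h.1]
        have hpk : (p : ℕ) ≠ k := fun hpk => by
          have : p = ⟨k, hk⟩ := Fin.ext hpk
          exact State.mem_marked.1 (this ▸ hkm) hp0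
        obtain ⟨f1, f2⟩ := run_fill (σ := τ) ((hτv 2 rfl).trans h2) (a := 5) (r := .var 7)
          (e := .sub (.read 5 (.var 7) (.var 6)) (.div (.read 5 (.var 10) (.var 6))
            (.div (.read 7 (.const 0) (.var 7)) (.read 7 (.const 0) (.var 10)))))
          (ρ := (k : ℤ)) (f := σ.basis n ⟨k, hk⟩ - (c ⟨k, hk⟩ * c p) • σ.basis n p)
          (fun υ hυ => (hυ 7 (by norm_num)).trans hτ7)
          (fun υ j hυ hυ6 hυa hυr hυj => by
            have e1 : υ.arr 5 (k : ℤ) ((j : ℕ) : ℤ) = σ.basis n ⟨k, hk⟩ j := by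
              rw [hυj, ← hbk]; rfl
            have e2 : υ.arr 5 ((p : ℕ) : ℤ) ((j : ℕ) : ℤ) = σ.basis n p j := by
              rw [hυr _ (by exact_mod_cast hpk), ← hbp]; rfl
            have e3 : ∀ l : Fin n, υ.arr 7 0 ((l : ℕ) : ℤ) = c l := fun l => by
              rw [hυa 7 (by norm_num), h7, hc]
            have e4 := e3 ⟨k, hk⟩
            simp only at e4
            have e5 : υ.var 10 = ((p : ℕ) : ℤ) := by
              rw [hυ 10 (by norm_num), hτv 10 rfl, hp]
            simp only [Expr.eval, hυ6, (hυ 7 (by norm_num)).trans hτ7, e1, e2, e3, e4, e5]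
            rw [hcp.div_eq_mul, ((hcs _ hkm).mul hcp).div_eq_mul]
            simp [mul_comm])
        by_cases hlk : (l : ℕ) = k
        · obtain rfl : l = ⟨k, hk⟩ := Fin.ext hlk
          rw [if_pos ⟨Nat.lt_succ_self _, hkm⟩]
          exact f1
        · have e6 : ((Cmd.fill 5 (.var 7) (.sub (.read 5 (.var 7) (.var 6))
              (.div (.read 5 (.var 10) (.var 6)) (.div (.read 7 (.const 0) (.var 7))
                (.read 7 (.const 0) (.var 10)))))).run τ).basis n l = τ.basis n l := by
            funext j
            exact congrFun (f2 ((l : ℕ) : ℤ) (by exact_mod_cast hlk)) ((j : ℕ) : ℤ)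
          refine (e6.trans (hI l)).trans ?_
          have : (l : ℕ) < k + 1 ↔ (l : ℕ) < k := by omega
          simp only [this]
      · have hk0 : σ.arr 6 0 (k : ℤ) = 0 := by
          by_contra hc; exact hkm (State.mem_marked.2 hc)
        simp only [Cmd.run, hev, hk0, ne_eq, not_true, if_false]
        refine (hI l).trans ?_
        have : ((l : ℕ) < k + 1 ∧ l ∈ σ.marked n) ↔ ((l : ℕ) < k ∧ l ∈ σ.marked n) := by
          refine and_congr_left fun hl => ⟨fun h => ?_, fun h => by omega⟩
          refine lt_of_le_of_ne (Nat.lt_succ_iff.1 h) fun hlk => hkm ?_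
          have : l = ⟨k, hk⟩ := Fin.ext hlk
          exact this ▸ hl
        simp only [this])
  have := congrFun (key l) j
  rw [if_pos ⟨l.2, hl⟩] at this
  exact this

/-- If every marked row has product 0 with row `i`, the basis already fits. Otherwise the product
found is ±1 by `KernelBasis.isSign` and serves as the pivot of `insert_of_pivot`. -/
theorem run_pivot (hTU : D.IsTotallyUnimodular) (hD : ∀ i j, IsSign (D i j)) (h : Holds σ D)
    {Z : Set (Fin m)} (hB : HoldsBasis σ D Z) {i : Fin m} (hi : σ.var 5 = ((i : ℕ) : ℤ)) :
    HoldsBasis (Cmd.pivot.run σ) D (insert i Z) := by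
  let σ₁ := Cmd.products.run σ
  let σ₂ :=
    (Cmd.search 10 (.div (.read 7 (.const 0) (.var 7)) (.read 6 (.const 0) (.var 7)))).run σ₁
  have hrun : Cmd.pivot.run σ = if (Expr.le (.const 0) (.var 10)).eval σ₂ ≠ 0 then
      Cmd.eliminate.run (σ₂.setArr 6 0 (σ₂.var 10) 0) else σ₂ := rfl
  have hc := run_products hD h hi
  have hB₁ : HoldsBasis σ₁ D Z := hB.congr (Cmd.run_arr _ _ rfl) (Cmd.run_arr _ _ rfl)
  have hb₁ : σ₁.basis n = σ.basis n := funext fun k => State.vec_congr (Cmd.run_arr _ _ rfl)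
  have hB₂ : HoldsBasis σ₂ D Z := hB₁.congr (Cmd.run_arr _ _ rfl) (Cmd.run_arr _ _ rfl)
  have hb₂ : σ₂.basis n = σ.basis n :=
    (funext fun k => State.vec_congr (Cmd.run_arr _ _ rfl)).trans hb₁
  have h6 : σ₂.arr 6 = σ₁.arr 6 := Cmd.run_arr _ _ rfl
  have hm₂ : σ₂.marked n = σ₁.marked n := by ext k; simp [State.mem_marked, h6]
  -- Dividing by the flag acts as a conjunction: `x / 1 = x` and `x / 0 = 0`, so only marked rows
  -- with nonzero product are found.
  have hsearch := run_search (σ := σ₁) (n := n) ((Cmd.run_var _ _ rfl).trans h.cols) (x := 10)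
    (e := .div (.read 7 (.const 0) (.var 7)) (.read 6 (.const 0) (.var 7)))
    (by norm_num) (by norm_num) (P := fun k => k ∈ σ₁.marked n ∧ D.mulVec (σ.basis n k) i ≠ 0)
    (fun τ k _ hτa hτ7 => by
      simp only [Expr.eval, hτa, hτ7, State.mem_marked]
      rw [show σ₁.arr 7 0 ((k : ℕ) : ℤ) = _ from hc k]
      rcases hB₁.flag k with h | h <;> simp [h])
  rw [hrun]
  rcases hsearch with ⟨hx, hnone⟩ | ⟨p, hx, hpm, hp0⟩
  · rw [if_neg (by simp only [Expr.eval, σ₂, hx]; norm_num)]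
    refine ⟨hB₂.basis.insert_of_zero fun k hk => ?_, hB₂.flag⟩
    by_contra hne
    exact hnone k ⟨hm₂ ▸ hk, by rwa [hb₂] at hne⟩
  · have hx' : σ₂.var 10 = ((p : ℕ) : ℤ) := hx
    rw [if_pos (by simp [Expr.eval, hx']), hx']
    let σ₃ := σ₂.setArr 6 0 ((p : ℕ) : ℤ) 0
    have hflag : ∀ k : Fin n, σ₃.arr 6 0 ((k : ℕ) : ℤ) = if k = p then 0 else
        σ₂.arr 6 0 ((k : ℕ) : ℤ) := fun k => by
      simp [σ₃, State.setArr, Fin.ext_iff]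
    have hm₃ : σ₃.marked n = (σ₂.marked n).erase p := by
      ext k
      rw [State.mem_marked, hflag, Finset.mem_erase, State.mem_marked]
      split_ifs with hkp <;> simp [hkp]
    have hb₃ : σ₃.basis n = σ₂.basis n := rfl
    have hsgn : ∀ k ∈ σ₂.marked n, IsSign (D.mulVec (σ₂.basis n k) i) := fun k hk =>
      (hB₂.basis.isSign hTU hk).1 i
    have hpm₂ : p ∈ σ₂.marked n := hm₂ ▸ hpm
    have helim := run_eliminate (σ := σ₃) (n := n)
      ((Cmd.run_var _ σ₁ rfl).trans ((Cmd.run_var _ _ rfl).trans h.cols))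
      (p := p) hx' (by rw [hflag, if_pos rfl])
      (c := fun k => D.mulVec (σ₂.basis n k) i) (fun l => by
        have e1 : σ₃.arr 7 = σ₁.arr 7 := (Cmd.run_arr _ σ₁ rfl : σ₂.arr 7 = σ₁.arr 7)
        rw [e1, hb₂]; exact hc l)
      (hsgn p hpm₂) (fun l hl => hsgn l (by
        rw [hm₃] at hl; exact Finset.mem_of_mem_erase hl))
    have h6' : (Cmd.eliminate.run σ₃).arr 6 = σ₃.arr 6 := Cmd.run_arr _ _ rfl
    have hm₄ : (Cmd.eliminate.run σ₃).marked n = (σ₂.marked n).erase p := by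
      rw [← hm₃]; ext k; simp [State.mem_marked, h6']
    refine ⟨?_, fun k => ?_⟩
    · rw [hm₄]
      refine hB₂.basis.insert_of_pivot hpm₂ ?_ fun k hk j => ?_
      · rcases hsgn p hpm₂ with h1 | h1 | h1
        · rw [hb₂] at h1; exact absurd h1 hp0
        · rw [h1]; rfl
        · rw [h1]; rfl
      · exact helim k (by rw [hm₃]; exact hk) j
    · rw [h6', hflag]
      split_ifs
      · exact Or.inl rfl
      · exact hB₂.flag k

theorem run_gauss (hTU : D.IsTotallyUnimodular) (hD : ∀ i j, IsSign (D i j)) (h : Holds σ D) :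
    HoldsBasis (Cmd.gauss.run σ) D {i | D.mulVec (σ.vec n 9 0) i = 0} := by
  let σ₁ := Cmd.identity.run σ
  have h₁ : Holds σ₁ D := h.run rfl rfl rfl
  have key := Cmd.run_for (x := 5) (v := 3)
    (p := .seq (.dot 8 9 (.const 0)) (.ite (.var 8) .skip .pivot))
    (σ := σ₁) (N := m) h₁.rows
    (fun k τ => HoldsBasis τ D {i | (i : ℕ) < k ∧ D.mulVec (σ.vec n 9 0) i = 0})
    (by
      have := run_identity h
      refine HoldsBasis.congr (σ := σ₁) ?_ rfl rfl
      simpa using this)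
    (by
      intro k τ hk hτ5 hτv hτa hI
      have hh : Holds τ D := h₁.congr (hτv 2 rfl) (hτv 3 rfl) (hτa 4 rfl)
      let τ₁ := (Cmd.dot 8 9 (.const 0)).run τ
      have hdot : τ₁.var 8 = D.mulVec (τ.vec n 9 0) ⟨k, hk⟩ :=
        run_dot (σ := τ) hD hh (s := 8) (a := 9) (r := .const 0) (ρ := 0)
          (by norm_num) (by norm_num) (by norm_num) (i := ⟨k, hk⟩) hτ5 fun _ _ => rfl
      have hv : τ.vec n 9 0 = σ.vec n 9 0 :=
        State.vec_congr ((hτa 9 rfl).trans (Cmd.run_arr _ _ rfl))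
      rw [hv] at hdot
      have hB₁ : HoldsBasis τ₁ D {i | (i : ℕ) < k ∧ D.mulVec (σ.vec n 9 0) i = 0} :=
        hI.congr (Cmd.run_arr _ _ rfl) (Cmd.run_arr _ _ rfl)
      have hrun : (Cmd.seq (.dot 8 9 (.const 0)) (.ite (.var 8) .skip .pivot)).run τ =
        if τ₁.var 8 ≠ 0 then τ₁ else Cmd.pivot.run τ₁ := rfl
      rw [hrun]
      by_cases h0 : D.mulVec (σ.vec n 9 0) ⟨k, hk⟩ = 0
      · rw [if_neg (by rw [hdot, h0]; simp)]
        have := run_pivot hTU hD (hh.run (p := .dot 8 9 (.const 0)) rfl rfl rfl) hB₁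
          (i := ⟨k, hk⟩) ((Cmd.run_var _ _ rfl).trans hτ5)
        have hset : {i : Fin m | (i : ℕ) < k + 1 ∧ D.mulVec (σ.vec n 9 0) i = 0} =
            insert ⟨k, hk⟩ {i : Fin m | (i : ℕ) < k ∧ D.mulVec (σ.vec n 9 0) i = 0} := by
          ext i
          simp only [Set.mem_ofPred_eq, Set.mem_insert_iff]
          constructor
          · rintro ⟨h1, h2⟩
            rcases Nat.lt_succ_iff_lt_or_eq.1 h1 with h1 | h1
            · exact Or.inr ⟨h1, h2⟩
            · exact Or.inl (Fin.ext h1)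
          · rintro (rfl | ⟨h1, h2⟩)
            · exact ⟨Nat.lt_succ_self _, h0⟩
            · exact ⟨by omega, h2⟩
        rw [hset]
        exact this.congr rfl rfl
      · rw [if_pos (by rw [hdot]; exact h0)]
        have hset : {i : Fin m | (i : ℕ) < k + 1 ∧ D.mulVec (σ.vec n 9 0) i = 0} =
            {i : Fin m | (i : ℕ) < k ∧ D.mulVec (σ.vec n 9 0) i = 0} := by
          ext i
          simp only [Set.mem_ofPred_eq]
          refine and_congr_left fun h2 => ⟨fun h1 => ?_, fun h1 => by omega⟩
          refine lt_of_le_of_ne (Nat.lt_succ_iff.1 h1) fun h3 => h0 ?_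
          have : i = ⟨k, hk⟩ := Fin.ext h3
          exact this ▸ h2
        rw [hset]
        exact hB₁.congr rfl rfl)
  have hset : {i : Fin m | D.mulVec (σ.vec n 9 0) i = 0} =
      {i : Fin m | (i : ℕ) < m ∧ D.mulVec (σ.vec n 9 0) i = 0} := by
    ext i; simp
  rw [hset]
  exact key

/-- The kernel basis for the zeros of the vector in array `9`. -/
theorem run_solve (hTU : D.IsTotallyUnimodular) (hD : ∀ i j, IsSign (D i j)) (h : Holds σ D)
    (h0 : realVec (σ.vec n 9 0) ≠ 0) :
    HoldsBasis (Cmd.solve.run σ) D {i | (realMat D).mulVec (realVec (σ.vec n 9 0)) i = 0} ∧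
    ∃ k ∈ (Cmd.solve.run σ).marked n, realVec (σ.vec n 9 0) k ≠ 0 ∧
      (Cmd.solve.run σ).var 12 = ((k : ℕ) : ℤ) := by
  have hg := run_gauss hTU hD h
  have hset : {i | D.mulVec (σ.vec n 9 0) i = 0} =
      {i | (realMat D).mulVec (realVec (σ.vec n 9 0)) i = 0} := by
    ext i; simp [realMat_mulVec]
  rw [hset] at hg
  let σ₁ := Cmd.gauss.run σ
  let e : Expr := .div (.read 9 (.const 0) (.var 7)) (.read 6 (.const 0) (.var 7))
  have hrun : Cmd.solve.run σ = (Cmd.search 12 e).run σ₁ := rfl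
  have h6 : ((Cmd.search 12 e).run σ₁).arr 6 = σ₁.arr 6 := Cmd.run_arr _ _ rfl
  have hm : ((Cmd.search 12 e).run σ₁).marked n = σ₁.marked n := by
    ext k; simp [State.mem_marked, h6]
  have h9 : σ₁.arr 9 = σ.arr 9 := Cmd.run_arr _ _ rfl
  rw [hrun, hm]
  refine ⟨hg.congr (Cmd.run_arr _ _ rfl) h6, ?_⟩
  have hs := run_search (σ := σ₁) (n := n) ((Cmd.run_var _ _ rfl).trans h.cols) (x := 12)
    (e := e) (by norm_num) (by norm_num)
    (P := fun k => k ∈ σ₁.marked n ∧ realVec (σ.vec n 9 0) k ≠ 0)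
    (fun τ k _ hτa hτ7 => by
      simp only [e, Expr.eval, hτa, hτ7, State.mem_marked, h9, realVec, State.vec]
      rcases hg.flag k with h | h <;> simp [show σ₁.arr 6 0 ((k : ℕ) : ℤ) = _ from h])
  rcases hs with ⟨-, hnone⟩ | ⟨k, hk, hkm, hk0⟩
  · obtain ⟨k, hk, hk0⟩ := hg.basis.exists_ne_zero h0
    exact absurd ⟨hk, hk0⟩ (hnone k)
  · exact ⟨k, hkm, hk0, hk⟩

end Gauss

/-- `x'` is `x` or `-x`, and `t` is the largest multiple of it that can be subtracted from `v`
sign-compatibly. -/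
structure Oriented {m n : ℕ} (D : Matrix (Fin m) (Fin n) ℤ) (v x x' : Fin n → ℤ) (t : ℤ) :
    Prop where
  eq_or : x' = x ∨ x' = -x
  pos : 0 < t
  attained : ∃ i, t = D.mulVec v i * D.mulVec x' i
  least : ∀ i, 0 < D.mulVec v i * D.mulVec x' i → t ≤ D.mulVec v i * D.mulVec x' i

/-! ### Orientation, step length and reduction -/

section Orient

variable {m n : ℕ} {D : Matrix (Fin m) (Fin n) ℤ} {σ : State}

/-- As the entries of `D x` are signs, the ratio at row `i` is the product `q i`, with 0 for a zero
divisor. Only values of at least 1 compete, so 0 in variable `11` can stand for "none yet". -/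
theorem run_ratio (hD : ∀ i j, IsSign (D i j)) (h : Holds σ D) (a : ℕ)
    (hx : ∀ i, IsSign (D.mulVec (σ.vec n 10 0) i)) :
    (((Cmd.ratio a).run σ).var 11 = 0 ∧
      ∀ i, D.mulVec (σ.vec n a 0) i * D.mulVec (σ.vec n 10 0) i ≤ 0) ∨
    (0 < ((Cmd.ratio a).run σ).var 11 ∧
      (∃ i, ((Cmd.ratio a).run σ).var 11 =
        D.mulVec (σ.vec n a 0) i * D.mulVec (σ.vec n 10 0) i) ∧
      ∀ i, 0 < D.mulVec (σ.vec n a 0) i * D.mulVec (σ.vec n 10 0) i →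
        ((Cmd.ratio a).run σ).var 11 ≤
          D.mulVec (σ.vec n a 0) i * D.mulVec (σ.vec n 10 0) i) := by
  set q : Fin m → ℤ := fun i => D.mulVec (σ.vec n a 0) i * D.mulVec (σ.vec n 10 0) i with hq
  have key := Cmd.run_for (x := 5) (v := 3)
    (p := .seq (.dot 8 10 (.const 0)) <| .seq (.dot 9 a (.const 0)) <|
      .seq (.assign 9 (.div (.var 9) (.var 8))) <|
      .ite (.le (.const 1) (.var 9))
        (.ite (.eq (.var 11) (.const 0)) (.assign 11 (.var 9))
          (.ite (.le (.var 9) (.var 11)) (.assign 11 (.var 9)) .skip)) .skip)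
    (σ := σ.setVar 11 0) (N := m) h.rows
    (fun k τ => (τ.var 11 = 0 ∧ ∀ i : Fin m, (i : ℕ) < k → q i ≤ 0) ∨
      (0 < τ.var 11 ∧ (∃ i, τ.var 11 = q i) ∧
        ∀ i : Fin m, (i : ℕ) < k → 0 < q i → τ.var 11 ≤ q i))
    (Or.inl ⟨rfl, fun i hi => absurd hi (Nat.not_lt_zero _)⟩)
    (by
      intro k τ hk hτ5 hτv hτa hI
      have hh : Holds τ D := h.congr (hτv 2 rfl) (hτv 3 rfl) (hτa 4 rfl)
      let τ₁ := (Cmd.dot 8 10 (.const 0)).run τ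
      let τ₂ := (Cmd.dot 9 a (.const 0)).run τ₁
      have hh₁ : Holds τ₁ D := hh.run (p := .dot 8 10 (.const 0)) rfl rfl rfl
      have d1 : τ₁.var 8 = D.mulVec (τ.vec n 10 0) ⟨k, hk⟩ :=
        run_dot (σ := τ) hD hh (s := 8) (a := 10) (r := .const 0) (ρ := 0)
          (by norm_num) (by norm_num) (by norm_num) (i := ⟨k, hk⟩) hτ5 fun _ _ => rfl
      have d2 : τ₂.var 9 = D.mulVec (τ₁.vec n a 0) ⟨k, hk⟩ :=
        run_dot (σ := τ₁) hD hh₁ (s := 9) (a := a) (r := .const 0) (ρ := 0)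
          (by norm_num) (by norm_num) (by norm_num) (i := ⟨k, hk⟩)
          ((Cmd.run_var _ _ rfl).trans hτ5) fun _ _ => rfl
      have hv1 : τ.vec n 10 0 = σ.vec n 10 0 := State.vec_congr (hτa 10 rfl)
      have hv2 : τ₁.vec n a 0 = σ.vec n a 0 :=
        State.vec_congr ((Cmd.run_arr _ _ rfl).trans (hτa a rfl))
      have d1' : τ₂.var 8 = D.mulVec (σ.vec n 10 0) ⟨k, hk⟩ := by
        rw [← hv1, ← d1]; exact Cmd.run_var _ _ rfl
      rw [hv2] at d2
      have hdiv : τ₂.var 9 / τ₂.var 8 = q ⟨k, hk⟩ := by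
        rw [d1', d2, (hx _).div_eq_mul]
      have h11 : τ₂.var 11 = τ.var 11 :=
        (Cmd.run_var _ _ rfl).trans (Cmd.run_var _ _ rfl)
      have hfin : ∀ i : Fin m, (i : ℕ) < k + 1 → (i : ℕ) < k ∨ i = ⟨k, hk⟩ := fun i hi => by
        rcases Nat.lt_succ_iff_lt_or_eq.1 hi with h | h
        · exact Or.inl h
        · exact Or.inr (Fin.ext h)
      have hrun : (((Cmd.seq (.dot 8 10 (.const 0)) <| .seq (.dot 9 a (.const 0)) <|
          .seq (.assign 9 (.div (.var 9) (.var 8))) <|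
          .ite (.le (.const 1) (.var 9))
            (.ite (.eq (.var 11) (.const 0)) (.assign 11 (.var 9))
              (.ite (.le (.var 9) (.var 11)) (.assign 11 (.var 9)) .skip)) .skip).run τ).setVar 5
            ((k : ℤ) + 1)).var 11 =
          if 1 ≤ q ⟨k, hk⟩ then
            if τ.var 11 = 0 then q ⟨k, hk⟩
            else if q ⟨k, hk⟩ ≤ τ.var 11 then q ⟨k, hk⟩ else τ.var 11
          else τ.var 11 := by
        have e : (Cmd.seq (.dot 8 10 (.const 0)) <| .seq (.dot 9 a (.const 0)) <|
          .seq (.assign 9 (.div (.var 9) (.var 8))) <|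
          .ite (.le (.const 1) (.var 9))
            (.ite (.eq (.var 11) (.const 0)) (.assign 11 (.var 9))
              (.ite (.le (.var 9) (.var 11)) (.assign 11 (.var 9)) .skip)) .skip).run τ =
          (Cmd.ite (.le (.const 1) (.var 9))
            (.ite (.eq (.var 11) (.const 0)) (.assign 11 (.var 9))
              (.ite (.le (.var 9) (.var 11)) (.assign 11 (.var 9)) .skip)) .skip).run
            (τ₂.setVar 9 (q ⟨k, hk⟩)) := by
          rw [← hdiv]; rfl
        rw [e]
        by_cases c1 : 1 ≤ q ⟨k, hk⟩ <;> by_cases c2 : τ.var 11 = 0 <;>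
          by_cases c3 : q ⟨k, hk⟩ ≤ τ.var 11 <;>
          simp [Cmd.run, Expr.eval, State.setVar, h11, c1, c2, c3]
      simp only [hrun]
      rcases hI with ⟨h0, hle⟩ | ⟨h0, hex, hle⟩
      · by_cases c1 : 1 ≤ q ⟨k, hk⟩
        · rw [if_pos c1, if_pos h0]
          refine Or.inr ⟨by omega, ⟨_, rfl⟩, fun i hi hpos => ?_⟩
          rcases hfin i hi with h | rfl
          · have := hle i h; omega
          · exact le_rfl
        · rw [if_neg c1]
          refine Or.inl ⟨h0, fun i hi => ?_⟩
          rcases hfin i hi with h | rfl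
          · exact hle i h
          · omega
      · right
        by_cases c1 : 1 ≤ q ⟨k, hk⟩
        · rw [if_pos c1, if_neg h0.ne']
          by_cases c3 : q ⟨k, hk⟩ ≤ τ.var 11
          · rw [if_pos c3]
            refine ⟨by omega, ⟨_, rfl⟩, fun i hi hpos => ?_⟩
            rcases hfin i hi with h | rfl
            · exact c3.trans (hle i h hpos)
            · exact le_rfl
          · rw [if_neg c3]
            refine ⟨h0, hex, fun i hi hpos => ?_⟩
            rcases hfin i hi with h | rfl
            · exact hle i h hpos
            · omega
        · rw [if_neg c1]
          refine ⟨h0, hex, fun i hi hpos => ?_⟩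
          rcases hfin i hi with h | rfl
          · exact hle i h hpos
          · omega)
  rcases key with ⟨h0, hle⟩ | ⟨h0, hex, hle⟩
  · exact Or.inl ⟨h0, fun i => hle i i.2⟩
  · exact Or.inr ⟨h0, hex, fun i => hle i i.2⟩

/-- If no product is positive, `hne` provides a negative one, which negation turns positive. The
final subtraction of `t / x'_j` subtracts `t * x'_j`, because the entries of the vector are signs
too. -/
theorem run_orient (hD : ∀ i j, IsSign (D i j)) (h : Holds σ D) {a : ℕ} (ha : a ≠ 10)
    (hx : ∀ i, IsSign (D.mulVec (σ.vec n 10 0) i)) (hx' : ∀ j, IsSign (σ.vec n 10 0 j))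
    (hne : ∃ i, D.mulVec (σ.vec n a 0) i * D.mulVec (σ.vec n 10 0) i ≠ 0) :
    Oriented D (σ.vec n a 0) (σ.vec n 10 0) (((Cmd.orient a).run σ).vec n 10 0)
        (((Cmd.orient a).run σ).var 11) ∧
      ((Cmd.orient a).run σ).vec n a 0 = σ.vec n a 0 -
        ((Cmd.orient a).run σ).var 11 • ((Cmd.orient a).run σ).vec n 10 0 := by
  let neg : Cmd := .fill 10 (.const 0) (.sub (.const 0) (.read 10 (.const 0) (.var 6)))
  let σ₁ := (Cmd.ratio a).run σ
  let σ₂ := (Cmd.ite (.var 11) .skip (.seq neg (.ratio a))).run σ₁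
  let last : Cmd := .fill a (.const 0) (.sub (.read a (.const 0) (.var 6))
    (.div (.var 11) (.read 10 (.const 0) (.var 6))))
  have hrun : (Cmd.orient a).run σ = last.run σ₂ := rfl
  have h₁ : Holds σ₁ D := h.run (p := .ratio a) rfl rfl rfl
  have hv₁ : ∀ b, σ₁.vec n b 0 = σ.vec n b 0 := fun b => State.vec_congr (Cmd.run_arr _ _ rfl)
  have claim : Oriented D (σ.vec n a 0) (σ.vec n 10 0) (σ₂.vec n 10 0) (σ₂.var 11) ∧
      σ₂.vec n a 0 = σ.vec n a 0 ∧ Holds σ₂ D := by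
    rcases run_ratio hD h a hx with ⟨h0, hle⟩ | ⟨h0, hex, hle⟩
    · have e : σ₂ = (Cmd.ratio a).run (neg.run σ₁) := by
        change (if σ₁.var 11 ≠ 0 then _ else _) = _
        rw [if_neg (not_not.2 h0)]
        rfl
      obtain ⟨f1, -⟩ := run_fill (σ := σ₁) h₁.cols (a := 10) (r := .const 0)
        (e := .sub (.const 0) (.read 10 (.const 0) (.var 6))) (ρ := 0) (f := -σ.vec n 10 0)
        (fun _ _ => rfl) (fun τ j _ h6 _ _ hj => by
          simp only [Expr.eval, h6, hj, zero_sub]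
          rw [← hv₁]; rfl)
      have hh : Holds (neg.run σ₁) D := h₁.run (p := neg) rfl rfl rfl
      have hva : (neg.run σ₁).vec n a 0 = σ.vec n a 0 := by
        rw [← hv₁]
        exact State.vec_congr (Cmd.run_arr _ _ (by simp [neg, Cmd.fill, Cmd.writes, ha.symm]))
      have hx10 : (neg.run σ₁).vec n 10 0 = -σ.vec n 10 0 := f1
      have hr := run_ratio hD hh a (fun i => by
        rw [hx10, Matrix.mulVec_neg]; exact (hx i).neg)
      rw [hva, hx10, ← e] at hr
      have hv10 : σ₂.vec n 10 0 = -σ.vec n 10 0 := by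
        rw [e, ← hx10]; exact State.vec_congr (Cmd.run_arr _ _ rfl)
      refine ⟨?_, ?_, e ▸ hh.run (p := .ratio a) rfl rfl rfl⟩
      · rw [hv10]
        rcases hr with ⟨-, hle'⟩ | ⟨h1, h2, h3⟩
        · exfalso
          obtain ⟨i, hi⟩ := hne
          have h1 := hle i
          have h2 := hle' i
          rw [Matrix.mulVec_neg, Pi.neg_apply, mul_neg] at h2
          omega
        · exact ⟨Or.inr rfl, h1, h2, h3⟩
      · rw [e, ← hva]; exact State.vec_congr (Cmd.run_arr _ _ rfl)
    · have e : σ₂ = σ₁ := by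
        change (if σ₁.var 11 ≠ 0 then _ else _) = _
        rw [if_pos h0.ne']
        rfl
      rw [e, hv₁, hv₁]
      exact ⟨⟨Or.inl rfl, h0, hex, hle⟩, rfl, h₁⟩
  obtain ⟨ho, hva, hh⟩ := claim
  have h11 : (last.run σ₂).var 11 = σ₂.var 11 := Cmd.run_var _ _ rfl
  have h10 : (last.run σ₂).arr 10 = σ₂.arr 10 :=
    Cmd.run_arr _ _ (by simp [last, Cmd.fill, Cmd.writes, ha])
  rw [hrun, h11, State.vec_congr h10]
  refine ⟨ho, ?_⟩
  have hxs : ∀ j, IsSign (σ₂.vec n 10 0 j) := fun j => by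
    rcases ho.eq_or with h | h
    · rw [h]; exact hx' j
    · rw [h]; exact (hx' j).neg
  exact (run_fill (σ := σ₂) hh.cols (a := a) (r := .const 0) (ρ := 0)
    (f := σ.vec n a 0 - σ₂.var 11 • σ₂.vec n 10 0) (fun _ _ => rfl) (fun τ j hv h6 hb _ hj => by
      have e1 : σ₂.arr a 0 ((j : ℕ) : ℤ) = σ.vec n a 0 j := by rw [← hva]; rfl
      have e2 : σ₂.arr 10 0 ((j : ℕ) : ℤ) = σ₂.vec n 10 0 j := rfl
      simp only [Expr.eval, h6, hj, hb 10 ha.symm, hv 11 (by norm_num), e1, e2,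
        (hxs j).div_eq_mul]
      rfl)).1

theorem Oriented.isSign {v x x' : Fin n → ℤ} {t : ℤ} (ho : Oriented D v x x' t)
    (hx : ∀ i, IsSign (D.mulVec x i)) (i : Fin m) : IsSign (D.mulVec x' i) := by
  rcases ho.eq_or with rfl | rfl
  · exact hx i
  · rw [Matrix.mulVec_neg]; exact (hx i).neg

theorem isLeast_ratios_of_int {ι : Type*} {a b : ι → ℤ} {t : ℤ} (hb : ∀ i, IsSign (b i))
    (hpos : 0 < t) (hex : ∃ i, t = a i * b i) (hle : ∀ i, 0 < a i * b i → t ≤ a i * b i) :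
    IsLeast (ratios (fun i => (a i : ℝ)) fun i => (b i : ℝ)) (t : ℝ) := by
  have hr : ∀ i, (a i : ℝ) / b i = ((a i * b i : ℤ) : ℝ) := fun i => by
    rcases hb i with h | h | h <;> simp [h, div_neg]
  refine ⟨?_, ?_⟩
  · obtain ⟨i, hi⟩ := hex
    refine ⟨i, ?_, ?_⟩
    · have : 0 < a i * b i := hi ▸ hpos
      beta_reduce
      exact_mod_cast this
    · rw [hr, hi]
  · rintro r ⟨i, hi, rfl⟩
    rw [hr]
    beta_reduce at hi
    have : 0 < a i * b i := by exact_mod_cast hi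
    exact_mod_cast hle i this

theorem Oriented.isLeast {v x x' : Fin n → ℤ} {t : ℤ} (ho : Oriented D v x x' t)
    (hx : ∀ i, IsSign (D.mulVec x i)) :
    IsLeast (ratios ((realMat D).mulVec (realVec v)) ((realMat D).mulVec (realVec x')))
      (t : ℝ) := by
  have := isLeast_ratios_of_int (ho.isSign hx) ho.pos ho.attained ho.least
  convert this using 2 <;> exact funext fun i => realMat_mulVec _ _ _

theorem realVec_sub_smul (v x : Fin n → ℤ) (t : ℤ) :
    realVec (v - t • x) = realVec v - (t : ℝ) • realVec x := by
  ext j; simp [realVec]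

theorem realVec_neg (x : Fin n → ℤ) : realVec (-x) = -realVec x := by
  ext j; simp [realVec]

/-- This supplies the hypothesis `hne` of `run_orient`: full rank gives a row nonzero on `x`, and
the chain of supports makes it nonzero on `v`. -/
theorem exists_mul_ne_zero (hr : (realMat D).rank = n) {h : Fin n → ℝ} {x v : Fin n → ℤ}
    (hx : realVec x ≠ 0)
    (hs : Function.support ((realMat D).mulVec (realVec x)) ⊆
      Function.support ((realMat D).mulVec h))
    (hs' : Function.support ((realMat D).mulVec h) ⊆
      Function.support ((realMat D).mulVec (realVec v))) :
    ∃ i, D.mulVec v i * D.mulVec x i ≠ 0 := by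
  have h1 : (realMat D).mulVec (realVec x) ≠ 0 := fun h0 => hx (eq_zero_of_mulVec_eq_zero hr h0)
  obtain ⟨i, hi⟩ := Function.ne_iff.1 h1
  have h2 := hs' (hs hi)
  refine ⟨i, mul_ne_zero ?_ ?_⟩
  · rw [Function.mem_support, realMat_mulVec] at h2
    exact_mod_cast h2
  · rw [realMat_mulVec, Pi.zero_apply] at hi
    exact_mod_cast hi

/-- Copying a row of array `5`. -/
theorem run_copy (h : Holds σ D) {x : ℕ} (hx6 : x ≠ 6) {l : Fin n}
    (hx : σ.var x = ((l : ℕ) : ℤ)) :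
    ((Cmd.fill 10 (.const 0) (.read 5 (.var x) (.var 6))).run σ).vec n 10 0 = σ.basis n l :=
  (run_fill (σ := σ) h.cols (a := 10) (r := .const 0) (ρ := 0) (fun _ _ => rfl)
    (fun τ j hv h6 hb _ _ => by
      simp only [Expr.eval, h6, hb 5 (by norm_num), hv x hx6, hx]
      rfl)).1

/-- A reduction preserves the vector if it is determined by its zeros, and otherwise yields a
conformal vector with more zeros. -/
theorem run_reduce (hTU : D.IsTotallyUnimodular) (hD : ∀ i j, IsSign (D i j))
    (hr : (realMat D).rank = n) (h : Holds σ D) (h0 : realVec (σ.vec n 9 0) ≠ 0) :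
    (SpansKernel (realMat D) (realVec (σ.vec n 9 0)) ∧
      (Cmd.reduce.run σ).vec n 9 0 = σ.vec n 9 0) ∨
    (realVec ((Cmd.reduce.run σ).vec n 9 0) ≠ 0 ∧
      ConformsTo ((realMat D).mulVec (realVec ((Cmd.reduce.run σ).vec n 9 0)))
        ((realMat D).mulVec (realVec (σ.vec n 9 0))) ∧
      Function.support ((realMat D).mulVec (realVec ((Cmd.reduce.run σ).vec n 9 0))) ⊂
        Function.support ((realMat D).mulVec (realVec (σ.vec n 9 0)))) := by
  obtain ⟨hB, k, hk, hk0, h12⟩ := run_solve hTU hD h h0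
  let σ₁ := Cmd.solve.run σ
  let e : Expr := .div (.read 6 (.const 0) (.var 7)) (.sub (.const 1) (.eq (.var 7) (.var 12)))
  let σ₂ := (Cmd.search 13 e).run σ₁
  let copy : Cmd := .fill 10 (.const 0) (.read 5 (.var 13) (.var 6))
  have hrun : Cmd.reduce.run σ = if (Expr.le (.const 0) (.var 13)).eval σ₂ ≠ 0 then
    (Cmd.orient 9).run (copy.run σ₂) else σ₂ := rfl
  have h₁ : Holds σ₁ D := h.run rfl rfl rfl
  have h₂ : Holds σ₂ D := h₁.run (p := .search 13 e) rfl rfl rfl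
  have hv₂ : σ₂.vec n 9 0 = σ.vec n 9 0 :=
    (State.vec_congr (Cmd.run_arr _ σ₁ rfl)).trans (State.vec_congr (Cmd.run_arr _ _ rfl))
  -- The divisor is 0 at the index `k` and 1 elsewhere, so the search looks for a marked index other
  -- than `k`.
  have hs := run_search (σ := σ₁) (n := n) h₁.cols (x := 13) (e := e) (by norm_num) (by norm_num)
    (P := fun l => l ∈ σ₁.marked n ∧ l ≠ k)
    (fun τ l hτv hτa hτ7 => by
      have e1 : τ.var 12 = ((k : ℕ) : ℤ) := (hτv 12 (by norm_num) (by norm_num)).trans h12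
      simp only [e, Expr.eval, hτa, hτ7, State.mem_marked, e1, Nat.cast_inj, ← Fin.ext_iff]
      by_cases hlk : l = k <;> simp [hlk])
  rcases hs with ⟨hx, hnone⟩ | ⟨l, hx, hl, hlk⟩
  · left
    refine ⟨(hB.basis.spansKernel_iff hk hk0).2 (Finset.eq_singleton_iff_unique_mem.2
      ⟨hk, fun l hl => by_contra fun hlk => hnone l ⟨hl, hlk⟩⟩), ?_⟩
    have hx' : σ₂.var 13 = -1 := hx
    rw [hrun, if_neg (by simp [Expr.eval, hx'])]
    exact hv₂
  · right
    have hx' : σ₂.var 13 = ((l : ℕ) : ℤ) := hx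
    rw [hrun, if_pos (by simp [Expr.eval, hx'])]
    let σ₃ := copy.run σ₂
    have h₃ : Holds σ₃ D := h₂.run (p := copy) rfl rfl rfl
    have hb₂ : σ₂.basis n = σ₁.basis n := funext fun k => State.vec_congr (Cmd.run_arr _ _ rfl)
    have hx10 : σ₃.vec n 10 0 = σ₁.basis n l := by
      rw [← hb₂]; exact run_copy h₂ (by norm_num) hx'
    have hv₃ : σ₃.vec n 9 0 = σ.vec n 9 0 :=
      (State.vec_congr (Cmd.run_arr _ _ rfl)).trans hv₂
    have hsign := hB.basis.isSign hTU hl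
    have hsupp := hB.basis.support_subset hl
    obtain ⟨ho, hsub⟩ := run_orient hD h₃ (a := 9) (by norm_num) (by rw [hx10]; exact hsign.1)
      (by rw [hx10]; exact hsign.2) (by
        rw [hx10, hv₃]
        exact exists_mul_ne_zero hr (hB.basis.realVec_ne_zero hl) hsupp subset_rfl)
    rw [hv₃, hx10] at ho
    rw [hv₃] at hsub
    change realVec (((Cmd.orient 9).run σ₃).vec n 9 0) ≠ 0 ∧ _
    set x' := ((Cmd.orient 9).run σ₃).vec n 10 0
    set t := ((Cmd.orient 9).run σ₃).var 11
    have hsupp' : Function.support ((realMat D).mulVec (realVec x')) ⊆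
        Function.support ((realMat D).mulVec (realVec (σ.vec n 9 0))) := by
      rcases ho.eq_or with e | e
      · rw [e]; exact hsupp
      · rw [e, realVec_neg, Matrix.mulVec_neg, Function.support_neg]; exact hsupp
    have hleast := ho.isLeast hsign.1
    have hne : realVec (((Cmd.orient 9).run σ₃).vec n 9 0) ≠ 0 := by
      rw [hsub, realVec_sub_smul]
      rcases ho.eq_or with e | e
      · rw [e]
        exact hB.basis.sub_ne_zero hk hl hlk hk0 _
      · rw [e, realVec_neg, smul_neg, ← neg_smul]
        exact hB.basis.sub_ne_zero hk hl hlk hk0 _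
    refine ⟨hne, ?_⟩
    have e4 : (Cmd.orient 9).run (copy.run σ₂) = (Cmd.orient 9).run σ₃ := rfl
    rw [e4, hsub, realVec_sub_smul, Matrix.mulVec_sub, Matrix.mulVec_smul]
    exact ⟨conformsTo_sub hleast hsupp', support_sub_ssubset hleast hsupp'⟩

end Orient

/-! ### Correctness of one iteration -/

section Iteration

/-- `x` is a circuit direction for `w`, and `t` the largest multiple of it that can be
subtracted. -/
structure IsStep {ι : Type*} {n : ℕ} (D : Matrix ι (Fin n) ℝ) (w : Fin n → ℝ) (x : Fin n → ℤ)
    (t : ℝ) : Prop where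
  spans : SpansKernel D (realVec x)
  gcd : Finset.univ.gcd x = 1
  conforms : ConformsTo (D.mulVec (realVec x)) (D.mulVec w)
  least : IsLeast (ratios (D.mulVec w) (D.mulVec (realVec x))) t

/-- The program numbers the rows of `A` and `B` consecutively, while the algorithm indexes them by a
sum type. -/
theorem IsStep.reindex {ι κ : Type*} {n : ℕ} {D : Matrix ι (Fin n) ℝ} {w : Fin n → ℝ}
    {x : Fin n → ℤ} {t : ℝ} (e : κ ≃ ι) (h : IsStep (D.submatrix e id) w x t) :
    IsStep D w x t := by
  have hm : ∀ v, (D.submatrix e id).mulVec v = D.mulVec v ∘ e := fun v => rfl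
  obtain ⟨h1, h2, h3, h4⟩ := h
  rw [hm, hm] at h3 h4
  refine ⟨fun y hy => h1 y fun i hi => hy (e i) hi, h2, ⟨fun i hi => ?_, fun i => ?_⟩, ?_⟩
  · have := h3.1 (show e.symm i ∈ Function.support _ by simpa using hi)
    simpa using this
  · simpa using h3.2 (e.symm i)
  · have : ratios (D.mulVec w ∘ e) (D.mulVec (realVec x) ∘ e) =
        ratios (D.mulVec w) (D.mulVec (realVec x)) := by
      ext r
      exact e.surjective.exists (p := fun j => 0 < D.mulVec w j * D.mulVec (realVec x) j ∧
        r = D.mulVec w j / D.mulVec (realVec x) j) |>.symm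
    rwa [← this]

variable {m n : ℕ} {D : Matrix (Fin m) (Fin n) ℤ} {σ : State}

/-- The reduction loop arrives at a vector that is determined by its zeros. -/
theorem run_reductions (hTU : D.IsTotallyUnimodular) (hD : ∀ i j, IsSign (D i j))
    (hr : (realMat D).rank = n) (h : Holds σ D) (h0 : realVec (σ.vec n 9 0) ≠ 0) :
    realVec (((Cmd.forTo 15 3 .reduce).run σ).vec n 9 0) ≠ 0 ∧
    ConformsTo ((realMat D).mulVec (realVec (((Cmd.forTo 15 3 .reduce).run σ).vec n 9 0)))
      ((realMat D).mulVec (realVec (σ.vec n 9 0))) ∧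
    SpansKernel (realMat D) (realVec (((Cmd.forTo 15 3 .reduce).run σ).vec n 9 0)) := by
  have key := Cmd.run_for (x := 15) (v := 3) (p := .reduce) (σ := σ) (N := m) h.rows
    -- As long as the vector is not determined by its zeros, each round removes at least one row
    -- from its support.
    (fun k τ => realVec (τ.vec n 9 0) ≠ 0 ∧
      ConformsTo ((realMat D).mulVec (realVec (τ.vec n 9 0)))
        ((realMat D).mulVec (realVec (σ.vec n 9 0))) ∧
      (SpansKernel (realMat D) (realVec (τ.vec n 9 0)) ∨
        (Function.support ((realMat D).mulVec (realVec (τ.vec n 9 0)))).ncard + k ≤ m))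
    ⟨h0, ConformsTo.refl _, Or.inr (by
      have := Set.ncard_le_card
        (Function.support ((realMat D).mulVec (realVec (σ.vec n 9 0))))
      rw [Nat.card_eq_fintype_card, Fintype.card_fin] at this
      exact this)⟩
    (by
      rintro k τ hk hτ15 hτv hτa ⟨i0, i1, i2⟩
      have hh : Holds τ D := h.congr (hτv 2 rfl) (hτv 3 rfl) (hτa 4 rfl)
      change realVec ((Cmd.reduce.run τ).vec n 9 0) ≠ 0 ∧
        ConformsTo ((realMat D).mulVec (realVec ((Cmd.reduce.run τ).vec n 9 0))) _ ∧
        (SpansKernel _ (realVec ((Cmd.reduce.run τ).vec n 9 0)) ∨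
        (Function.support ((realMat D).mulVec (realVec ((Cmd.reduce.run τ).vec n 9 0)))).ncard
          + (k + 1) ≤ m)
      by_cases hs : SpansKernel (realMat D) (realVec (τ.vec n 9 0))
      · rcases run_reduce hTU hD hr hh i0 with ⟨-, he⟩ | ⟨r1, r2, r3⟩
        · rw [he]
          exact ⟨i0, i1, Or.inl hs⟩
        · refine ⟨r1, r2.trans i1, Or.inl ?_⟩
          exact hs.of_support_subset r1 r3.1
      · rcases run_reduce hTU hD hr hh i0 with ⟨hs', -⟩ | ⟨r1, r2, r3⟩
        · exact absurd hs' hs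
        · refine ⟨r1, r2.trans i1, Or.inr ?_⟩
          have := i2.resolve_left hs
          have := Set.ncard_lt_ncard r3 (Set.toFinite _)
          omega)
  -- After `m` rounds the counting alternative would leave an empty support, hence the zero vector
  -- by full rank.
  refine ⟨key.1, key.2.1, key.2.2.resolve_right fun hc => ?_⟩
  have : Function.support ((realMat D).mulVec
      (realVec (((Cmd.forTo 15 3 .reduce).run σ).vec n 9 0))) = ∅ := by
    rw [← Set.ncard_eq_zero (Set.toFinite _)]; omega
  exact key.1 (eq_zero_of_mulVec_eq_zero hr (Function.support_eq_empty_iff.1 this))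

/-- The reduced copy `v` of `w` is a nonzero multiple of the single remaining basis vector, and that
vector is the circuit up to sign. The sign and the step length are then determined against `w`
itself. -/
theorem run_iteration (hTU : D.IsTotallyUnimodular) (hD : ∀ i j, IsSign (D i j))
    (hr : (realMat D).rank = n) (h : Holds σ D) (h0 : realVec (σ.vec n 8 0) ≠ 0) :
    IsStep (realMat D) (realVec (σ.vec n 8 0)) ((Cmd.iteration.run σ).vec n 10 0)
      ((Cmd.iteration.run σ).var 11) ∧
    (Cmd.iteration.run σ).vec n 8 0 = σ.vec n 8 0 -
      (Cmd.iteration.run σ).var 11 • (Cmd.iteration.run σ).vec n 10 0 := by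
  let σ₁ := (Cmd.fill 9 (.const 0) (.read 8 (.const 0) (.var 6))).run σ
  let σ₂ := (Cmd.forTo 15 3 .reduce).run σ₁
  let σ₃ := Cmd.solve.run σ₂
  let σ₄ := (Cmd.fill 10 (.const 0) (.read 5 (.var 12) (.var 6))).run σ₃
  have hrun : Cmd.iteration.run σ = (Cmd.orient 8).run σ₄ := rfl
  have h₁ : Holds σ₁ D := h.run
    (p := .fill 9 (.const 0) (.read 8 (.const 0) (.var 6))) rfl rfl rfl
  have h₂ : Holds σ₂ D := h₁.run (p := .forTo 15 3 .reduce) rfl rfl rfl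
  have h₃ : Holds σ₃ D := h₂.run (p := .solve) rfl rfl rfl
  have h₄ : Holds σ₄ D := h₃.run
    (p := .fill 10 (.const 0) (.read 5 (.var 12) (.var 6))) rfl rfl rfl
  have hv₁ : σ₁.vec n 9 0 = σ.vec n 8 0 :=
    (run_fill (σ := σ) h.cols (a := 9) (r := .const 0) (ρ := 0) (fun _ _ => rfl)
      (fun τ j _ h6 hb _ _ => by
        simp only [Expr.eval, h6, hb 8 (by norm_num)]
        rfl)).1
  obtain ⟨g0, g1, g2⟩ := run_reductions hTU hD hr h₁ (by rw [hv₁]; exact h0)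
  rw [hv₁] at g1
  set w := σ.vec n 8 0 with hw
  set v := σ₂.vec n 9 0 with hv
  obtain ⟨hB, k, hk, hk0, h12⟩ := run_solve hTU hD h₂ g0
  have hU : σ₃.marked n = {k} := (hB.basis.spansKernel_iff hk hk0).1 g2
  have hhv : realVec v = realVec v k • realVec (σ₃.basis n k) := by
    have := hB.basis.span (realVec v) fun i hi => hi
    rw [show (Cmd.solve.run σ₂).marked n = {k} from hU, Finset.sum_singleton] at this
    exact this
  have hx10 : σ₄.vec n 10 0 = σ₃.basis n k := run_copy h₃ (by norm_num) h12
  have hw₄ : σ₄.vec n 8 0 = w :=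
    (((State.vec_congr (Cmd.run_arr _ σ₃ rfl)).trans
      (State.vec_congr (Cmd.run_arr _ σ₂ rfl))).trans
      (State.vec_congr (Cmd.run_arr _ σ₁ rfl))).trans (State.vec_congr (Cmd.run_arr _ σ rfl))
  have hsign := hB.basis.isSign hTU hk
  obtain ⟨ho, hsub⟩ := run_orient hD h₄ (a := 8) (by norm_num) (by rw [hx10]; exact hsign.1)
    (by rw [hx10]; exact hsign.2) (by
      rw [hx10, hw₄]
      exact exists_mul_ne_zero hr (hB.basis.realVec_ne_zero hk) (hB.basis.support_subset hk) g1.1)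
  rw [hx10, hw₄] at ho
  rw [hw₄] at hsub
  rw [hrun]
  refine ⟨?_, hsub⟩
  set x := ((Cmd.orient 8).run σ₄).vec n 10 0
  set t := ((Cmd.orient 8).run σ₄).var 11
  have hleast := ho.isLeast hsign.1
  have hgk := hB.basis.gcd_eq_one hk
  have hdiag : σ₃.basis n k k = 1 := by
    have := hB.basis.diag k hk k hk
    rwa [if_pos rfl] at this
  have hgcd : Finset.univ.gcd x = 1 := by
    refine gcd_eq_one_of_isUnit (k := k) ?_
    rcases ho.eq_or with e | e
    · rw [e, hdiag]; exact isUnit_one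
    · rw [e, Pi.neg_apply, hdiag]; exact isUnit_one.neg
  obtain ⟨c, hc0, hc⟩ : ∃ c : ℝ, c ≠ 0 ∧ realVec v = c • realVec x := by
    rcases ho.eq_or with e | e
    · exact ⟨_, hk0, by rw [e]; exact hhv⟩
    · exact ⟨_, neg_ne_zero.2 hk0, by rw [e, realVec_neg, smul_neg, neg_smul, neg_neg]; exact hhv⟩
  -- The orientation was chosen by `w`, not `v`. On the row attaining the minimum, `D x` and `D w`
  -- agree in sign; `v = c x` conforms to `w`, so `c` is positive.
  have hcpos : 0 < c := by
    obtain ⟨i, hi⟩ := ho.attained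
    have h1 := g1.2 i
    have h2 : 0 < D.mulVec w i * D.mulVec x i := hi ▸ ho.pos
    have h3 : (0 : ℝ) < (D.mulVec w i : ℝ) * (D.mulVec x i : ℝ) := by exact_mod_cast h2
    change 0 ≤ (realMat D).mulVec (realVec v) i * _ at h1
    rw [hc, Matrix.mulVec_smul, Pi.smul_apply, realMat_mulVec, realMat_mulVec, smul_eq_mul,
      mul_assoc, mul_comm (D.mulVec x i : ℝ)] at h1
    exact lt_of_le_of_ne (nonneg_of_mul_nonneg_left h1 h3) hc0.symm
  have hx : realVec x = c⁻¹ • realVec v := by rw [hc, smul_smul, inv_mul_cancel₀ hc0, one_smul]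
  refine ⟨fun y hy => ?_, hgcd, ?_, hleast⟩
  · obtain ⟨b, hb⟩ := g2 y fun i hi => hy i (by
      rw [hx, Matrix.mulVec_smul, Pi.smul_apply]
      change (realMat D).mulVec (realVec v) i = 0 at hi
      rw [hi, smul_zero])
    refine ⟨b * c, ?_⟩
    rw [hb, mul_smul, ← hc]
  · rw [hx, Matrix.mulVec_smul]
    refine ⟨?_, fun i => ?_⟩
    · rw [Function.support_const_smul_of_ne_zero _ _ (inv_ne_zero hc0)]
      exact g1.1
    · simp only [Pi.smul_apply, smul_eq_mul, mul_assoc]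
      exact mul_nonneg (inv_nonneg.2 hcpos.le) (g1.2 i)

end Iteration

/-! ### From program steps to steps of the algorithm -/

section Steps

variable {mA mB n : ℕ} {A : Matrix (Fin mA) (Fin n) ℤ} {B : Matrix (Fin mB) (Fin n) ℤ}
  {w : Fin n → ℝ} {x : Fin n → ℤ} {t : ℝ}

theorem realVec_ne_zero_of_gcd (hx : Finset.univ.gcd x = 1) : realVec x ≠ 0 := by
  intro h
  have : Finset.univ.gcd x = 0 := by
    rw [Finset.gcd_eq_zero_iff]
    intro j _
    have := congrFun h j
    simpa [realVec] using this
  omega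

theorem IsStep.mem_circuits (h : IsStep (Matrix.fromRows (realMat A) (realMat B)) w x t)
    (hA : (realMat A).mulVec w = 0) : realVec x ∈ circuits (realMat A) (realMat B) :=
  mem_circuits_of_spansKernel ((support_fromRows_subset_iff hA).1 h.conforms.1).1
    (realVec_ne_zero_of_gcd h.gcd) h.gcd h.spans

/-- If `w` is determined by its zeros, then `x = a w` for some `a`; every ratio equals `1 / a`, so
`t x` is all of `w`. -/
theorem IsStep.finalStep (h : IsStep (Matrix.fromRows (realMat A) (realMat B)) w x t)
    (hA : (realMat A).mulVec w = 0) (hw : w ≠ 0)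
    (hs : SpansKernel (Matrix.fromRows (realMat A) (realMat B)) w) :
    FinalStep (realMat A) (realMat B) w (realVec x) t := by
  have hmem := h.mem_circuits hA
  obtain ⟨a, ha⟩ := hs (realVec x) fun i hi => by
    by_contra hc; exact h.conforms.1 hc hi
  have ht := pos_of_isLeast_ratios h.least
  have hwt : w = t • realVec x := by
    obtain ⟨⟨j, hj, hjt⟩, -⟩ := h.least
    rw [ha, Matrix.mulVec_smul, Pi.smul_apply, smul_eq_mul] at hj hjt
    have hw0 := left_ne_zero_of_mul hj.ne'
    have ha0 := left_ne_zero_of_mul (right_ne_zero_of_mul hj.ne')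
    have : t * a = 1 := by rw [hjt]; field_simp
    rw [ha, smul_smul, this, one_smul]
  refine ⟨(zeroRank_add_one_eq_iff _ _ hw).2 hs, hmem, ⟨t, ht, hwt⟩, ?_⟩
  rw [hwt, norm_smul, mul_div_assoc, div_self (norm_ne_zero_iff.2 hmem.2.1), mul_one,
    Real.norm_eq_abs, abs_of_pos ht]

/-- The support inclusion is strict since `w` would otherwise inherit from `x` that it is determined
by its zeros. Rows of `A` vanish on `w`, so they add no ratios. -/
theorem IsStep.loopStep (h : IsStep (Matrix.fromRows (realMat A) (realMat B)) w x t)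
    (hA : (realMat A).mulVec w = 0) (hw : w ≠ 0)
    (hs : ¬ SpansKernel (Matrix.fromRows (realMat A) (realMat B)) w) :
    LoopStep (realMat A) (realMat B) w (realVec x) t (w - t • realVec x) := by
  have hmem := h.mem_circuits hA
  have hsupp := (support_fromRows_subset_iff hA).1 h.conforms.1
  refine ⟨fun hz => hs ((zeroRank_add_one_eq_iff _ _ hw).1 hz), hmem, ⟨hsupp.2, fun hsub => ?_⟩,
    fun i => ?_, ?_, rfl⟩
  · exact hs (h.spans.of_support_subset hw ((support_fromRows_subset_iff hmem.1).2 ⟨hA, hsub⟩))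
  · simpa [Matrix.fromRows_mulVec] using h.conforms.2 (Sum.inr i)
  · have := h.least
    have he : ratios ((Matrix.fromRows (realMat A) (realMat B)).mulVec w)
        ((Matrix.fromRows (realMat A) (realMat B)).mulVec (realVec x)) =
        ratios ((realMat B).mulVec w) ((realMat B).mulVec (realVec x)) := by
      ext r
      simp [ratios, Matrix.fromRows_mulVec, hA]
    rwa [he] at this

end Steps

/-! ## Correctness and running time of the whole program -/

section Main

variable {mA mB n : ℕ}

/-- The matrix with the rows of `A` and `B`, numbered consecutively. -/
def stacked (A : Matrix (Fin mA) (Fin n) ℤ) (B : Matrix (Fin mB) (Fin n) ℤ) :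
    Matrix (Fin (mA + mB)) (Fin n) ℤ :=
  (Matrix.fromRows A B).submatrix finSumFinEquiv.symm id

theorem realMat_stacked (A : Matrix (Fin mA) (Fin n) ℤ) (B : Matrix (Fin mB) (Fin n) ℤ) :
    realMat (stacked A B) =
      (Matrix.fromRows (realMat A) (realMat B)).submatrix finSumFinEquiv.symm id := by
  rw [← realMat_fromRows]; rfl

theorem toArray_apply {r s : ℕ} (M : Matrix (Fin r) (Fin s) ℤ) (i : Fin r) (j : Fin s) :
    toArray M ((i : ℕ) : ℤ) ((j : ℕ) : ℤ) = M i j := by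
  simp [toArray]

theorem run_stack {σ : State} {A : Matrix (Fin mA) (Fin n) ℤ} {B : Matrix (Fin mB) (Fin n) ℤ}
    (h2 : σ.var 2 = n) (h3 : σ.var 3 = ((mA + mB : ℕ) : ℤ)) (h4 : σ.var 4 = mA)
    (hA : σ.arr 0 = toArray A) (hB : σ.arr 1 = toArray B) :
    Holds (Cmd.stack.run σ) (stacked A B) := by
  have key := Cmd.run_for (x := 5) (v := 3)
    (p := .ite (.le (.add (.var 5) (.const 1)) (.var 4))
      (.fill 4 (.var 5) (.read 0 (.var 5) (.var 6)))
      (.fill 4 (.var 5) (.read 1 (.sub (.var 5) (.var 4)) (.var 6)))) (σ := σ) h3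
    (fun k τ => ∀ i : Fin (mA + mB), (i : ℕ) < k →
      τ.vec n 4 ((i : ℕ) : ℤ) = stacked A B i)
    (fun i hi => absurd hi (Nat.not_lt_zero _))
    (by
      intro k τ hk hτ5 hτv hτa hI
      have h2' : τ.var 2 = n := (hτv 2 rfl).trans h2
      have h4' : τ.var 4 = mA := (hτv 4 rfl).trans h4
      have hA' : τ.arr 0 = toArray A := (hτa 0 rfl).trans hA
      have hB' : τ.arr 1 = toArray B := (hτa 1 rfl).trans hB
      have hgen : ∀ e : Expr, (∀ (υ : State) (j : Fin n), (∀ y, y ≠ 6 → υ.var y = τ.var y) →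
          υ.var 6 = ((j : ℕ) : ℤ) → (∀ b, b ≠ 4 → υ.arr b = τ.arr b) →
          e.eval υ = stacked A B ⟨k, hk⟩ j) → ∀ i : Fin (mA + mB), (i : ℕ) < k + 1 →
          ((Cmd.fill 4 (.var 5) e).run τ).vec n 4 ((i : ℕ) : ℤ) = stacked A B i := by
        intro e he i hi
        obtain ⟨f1, f2⟩ := run_fill (σ := τ) h2' (a := 4) (r := .var 5) (e := e) (ρ := (k : ℤ))
          (f := stacked A B ⟨k, hk⟩) (fun υ hυ => (hυ 5 (by norm_num)).trans hτ5)
          (fun υ j hυ h6 hb _ _ => he υ j hυ h6 hb)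
        by_cases hik : (i : ℕ) = k
        · obtain rfl : i = ⟨k, hk⟩ := Fin.ext hik
          exact f1
        · rw [← hI i (by omega)]
          funext j
          exact congrFun (f2 ((i : ℕ) : ℤ) (by exact_mod_cast hik)) ((j : ℕ) : ℤ)
      have hev : (Expr.le (.add (.var 5) (.const 1)) (.var 4)).eval τ =
          if k < mA then 1 else 0 := by
        simp only [Expr.eval, hτ5, h4']
        congr 1
        exact propext (by omega)
      by_cases hkA : k < mA
      · have hrun : (Cmd.ite (.le (.add (.var 5) (.const 1)) (.var 4))
            (.fill 4 (.var 5) (.read 0 (.var 5) (.var 6)))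
            (.fill 4 (.var 5) (.read 1 (.sub (.var 5) (.var 4)) (.var 6)))).run τ =
            (Cmd.fill 4 (.var 5) (.read 0 (.var 5) (.var 6))).run τ := by
          rw [Cmd.run, hev, if_pos hkA, if_pos one_ne_zero]
        rw [hrun]
        refine hgen _ fun υ j hυ h6 hb => ?_
        have e1 : (⟨k, hk⟩ : Fin (mA + mB)) = Fin.castAdd mB ⟨k, hkA⟩ := rfl
        simp only [Expr.eval, h6, hυ 5 (by norm_num), hτ5, hb 0 (by norm_num), hA']
        rw [e1, stacked, Matrix.submatrix_apply, finSumFinEquiv_symm_apply_castAdd]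
        exact toArray_apply A ⟨k, hkA⟩ j
      · have hrun : (Cmd.ite (.le (.add (.var 5) (.const 1)) (.var 4))
            (.fill 4 (.var 5) (.read 0 (.var 5) (.var 6)))
            (.fill 4 (.var 5) (.read 1 (.sub (.var 5) (.var 4)) (.var 6)))).run τ =
            (Cmd.fill 4 (.var 5) (.read 1 (.sub (.var 5) (.var 4)) (.var 6))).run τ := by
          rw [Cmd.run, hev, if_neg hkA, if_neg (not_not.2 rfl)]
        rw [hrun]
        refine hgen _ fun υ j hυ h6 hb => ?_
        have hkB : k - mA < mB := by omega
        have e1 : (⟨k, hk⟩ : Fin (mA + mB)) = Fin.natAdd mA ⟨k - mA, hkB⟩ :=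
          Fin.ext (by simp; omega)
        have e2 : (k : ℤ) - (mA : ℤ) = ((k - mA : ℕ) : ℤ) := by omega
        simp only [Expr.eval, h6, hυ 5 (by norm_num), hτ5, hυ 4 (by norm_num), h4',
          hb 1 (by norm_num), hB', e2]
        rw [e1, stacked, Matrix.submatrix_apply, finSumFinEquiv_symm_apply_natAdd]
        exact toArray_apply B ⟨k - mA, hkB⟩ j)
  exact ⟨(Cmd.run_var _ _ rfl).trans h2, (Cmd.run_var _ _ rfl).trans h3,
    fun i j => congrFun (key i i.2) j⟩

theorem IsPartialExecution.snoc {A : Matrix (Fin mA) (Fin n) ℝ} {B : Matrix (Fin mB) (Fin n) ℝ}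
    {u : Fin n → ℝ} {t : ℕ} {w g w' g' : ℕ → Fin n → ℝ} {lam lam' : ℕ → ℝ}
    (h : IsPartialExecution A B u t w g lam) (hw : ∀ i ≤ t, w' i = w i)
    (hg : ∀ i < t, g' i = g i) (hl : ∀ i < t, lam' i = lam i)
    (hs : LoopStep A B (w t) (g' t) (lam' t) (w' (t + 1))) :
    IsPartialExecution A B u (t + 1) w' g' lam' := by
  refine ⟨(hw 0 (Nat.zero_le _)).trans h.1, fun i hi => ?_⟩
  rcases Nat.lt_succ_iff_lt_or_eq.1 hi with hi | rfl
  · rw [hw i hi.le, hg i hi, hl i hi, hw (i + 1) hi]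
    exact h.2 i hi
  · rw [hw i le_rfl]
    exact hs

theorem IsPartialExecution.congr {A : Matrix (Fin mA) (Fin n) ℝ} {B : Matrix (Fin mB) (Fin n) ℝ}
    {u : Fin n → ℝ} {t : ℕ} {w g w' g' : ℕ → Fin n → ℝ} {lam lam' : ℕ → ℝ}
    (h : IsPartialExecution A B u t w g lam) (hw : ∀ i ≤ t, w' i = w i)
    (hg : ∀ i < t, g' i = g i) (hl : ∀ i < t, lam' i = lam i) :
    IsPartialExecution A B u t w' g' lam' := by
  refine ⟨(hw 0 (Nat.zero_le _)).trans h.1, fun i hi => ?_⟩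
  rw [hw i hi.le, hg i hi, hl i hi, hw (i + 1) hi]
  exact h.2 i hi

/-- What `output` does to the memory. -/
theorem run_output {σ : State} (h2 : σ.var 2 = n) {c : ℕ} (hc : σ.var 0 = c) :
    let τ := Cmd.output.run σ
    τ.var 0 = ((c + 1 : ℕ) : ℤ) ∧ τ.vec n 0 c = σ.vec n 10 0 ∧
    (∀ i : ℤ, i ≠ c → τ.vec n 0 i = σ.vec n 0 i) ∧ τ.arr 1 c 0 = σ.var 11 ∧
    (∀ i : ℤ, i ≠ c → τ.arr 1 i 0 = σ.arr 1 i 0) ∧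
    τ.vec n 2 ((c + 1 : ℕ) : ℤ) = σ.vec n 3 0 - σ.vec n 8 0 ∧
    ∀ i : ℤ, i ≠ ((c + 1 : ℕ) : ℤ) → τ.vec n 2 i = σ.vec n 2 i := by
  intro τ
  let σ₁ := (Cmd.fill 0 (.var 0) (.read 10 (.const 0) (.var 6))).run σ
  let σ₂ := (σ₁.setArr 1 (σ₁.var 0) 0 (σ₁.var 11)).setVar 0 (σ₁.var 0 + 1)
  have hτ : τ = (Cmd.fill 2 (.var 0) (.sub (.read 3 (.const 0) (.var 6))
      (.read 8 (.const 0) (.var 6)))).run σ₂ := rfl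
  have hc₁ : σ₁.var 0 = c := (Cmd.run_var _ _ rfl).trans hc
  have h11 : σ₁.var 11 = σ.var 11 := Cmd.run_var _ _ rfl
  have hc₂ : σ₂.var 0 = ((c + 1 : ℕ) : ℤ) := by
    simp [σ₂, State.setVar, hc₁]
  have hn₂ : σ₂.var 2 = n := (Cmd.run_var _ σ rfl : σ₁.var 2 = σ.var 2).trans h2
  have ha₂ : ∀ b, b ≠ 0 → b ≠ 1 → σ₂.arr b = σ.arr b := fun b hb0 hb1 => by
    have e1 : σ₂.arr b = σ₁.arr b := by
      simp [σ₂, State.setVar, State.setArr, hb1]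
    rw [e1]
    exact Cmd.run_arr _ _ (by simp [Cmd.fill, Cmd.writes, hb0.symm])
  obtain ⟨f1, f2⟩ := run_fill (σ := σ) h2 (a := 0) (r := .var 0)
    (e := .read 10 (.const 0) (.var 6)) (ρ := (c : ℤ)) (f := σ.vec n 10 0)
    (fun υ hυ => (hυ 0 (by norm_num)).trans hc) (fun υ j hυ h6 hb _ _ => by
      simp only [Expr.eval, h6, hb 10 (by norm_num)]; rfl)
  obtain ⟨g1, g2⟩ := run_fill (σ := σ₂) hn₂ (a := 2) (r := .var 0)
    (e := .sub (.read 3 (.const 0) (.var 6)) (.read 8 (.const 0) (.var 6)))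
    (ρ := ((c + 1 : ℕ) : ℤ)) (f := σ.vec n 3 0 - σ.vec n 8 0)
    (fun υ hυ => (hυ 0 (by norm_num)).trans hc₂) (fun υ j hυ h6 hb _ _ => by
      simp only [Expr.eval, h6, hb 3 (by norm_num), hb 8 (by norm_num),
        ha₂ 3 (by norm_num) (by norm_num), ha₂ 8 (by norm_num) (by norm_num)]; rfl)
  have h0 : τ.arr 0 = σ₁.arr 0 := by
    have : σ₂.arr 0 = σ₁.arr 0 := by simp [σ₂, State.setVar, State.setArr]
    rw [hτ, ← this]; exact Cmd.run_arr _ _ rfl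
  have h1 : ∀ i, τ.arr 1 i 0 = if i = (c : ℤ) then σ.var 11 else σ.arr 1 i 0 := fun i => by
    have e1 : τ.arr 1 = σ₂.arr 1 := by rw [hτ]; exact Cmd.run_arr _ _ rfl
    have e2 : σ₁.arr 1 = σ.arr 1 := Cmd.run_arr _ _ rfl
    rw [e1]
    simp [σ₂, State.setVar, State.setArr, hc₁, h11, e2]
  refine ⟨?_, ?_, fun i hi => ?_, by rw [h1, if_pos rfl], fun i hi => by rw [h1, if_neg hi], g1,
    fun i hi => ?_⟩
  · rw [← hc₂, hτ]; exact Cmd.run_var _ _ rfl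
  · rw [State.vec_congr h0]; exact f1
  · rw [State.vec_congr h0]
    funext j
    exact congrFun (f2 i hi) ((j : ℕ) : ℤ)
  · funext j
    have := congrFun (g2 i hi) ((j : ℕ) : ℤ)
    rw [ha₂ 2 (by norm_num) (by norm_num)] at this
    exact this

/-- The state of the computation after `k` rounds of the main loop: either `k` non-final
iterations have been carried out, or the algorithm has ended. -/
def Progress (A : Matrix (Fin mA) (Fin n) ℤ) (B : Matrix (Fin mB) (Fin n) ℤ) (v₁ v₂ : Fin n → ℤ)
    (k : ℕ) (σ : State) : Prop :=
  (realVec (σ.vec n 8 0) ≠ 0 ∧ σ.var 0 = k ∧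
    IsPartialExecution (realMat A) (realMat B) (realVec v₂ - realVec v₁) k
      (fun i => realVec v₂ - σ.row n 2 i) (fun i => σ.row n 0 i) (fun i => (σ.arr 1 i 0 : ℝ)) ∧
    realVec (σ.vec n 8 0) = realVec v₂ - σ.row n 2 k) ∨
  (realVec (σ.vec n 8 0) = 0 ∧ ∃ c : ℕ, σ.var 0 = c ∧
    IsOutput (realMat A) (realMat B) (realVec v₂ - realVec v₁) c (fun i => σ.row n 0 i)
      (fun i => (σ.arr 1 i 0 : ℝ)) ∧
    ∀ j ≤ c, σ.row n 2 j =
      walkPoint (realVec v₁) (fun i => σ.row n 0 i) (fun i => (σ.arr 1 i 0 : ℝ)) j)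

variable {A : Matrix (Fin mA) (Fin n) ℤ} {B : Matrix (Fin mB) (Fin n) ℤ} {v₁ v₂ : Fin n → ℤ}

/-- The remainders are not stored separately: they are recovered as `v₂ - y_i` from the points
already written. Round `k` touches only row `k` of arrays `0` and `1` and row `k + 1` of array `2`,
so the earlier record persists; once the remainder is zero, rounds are idle. -/
theorem run_round (hTU : (Matrix.fromRows A B).IsTotallyUnimodular)
    (hD : ∀ i j, IsSign (stacked A B i j))
    (hr : (Matrix.fromRows (realMat A) (realMat B)).rank = n)
    (hu : (realMat A).mulVec (realVec v₂ - realVec v₁) = 0) {k : ℕ} {σ : State}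
    (h : Holds σ (stacked A B)) (h3 : σ.vec n 3 0 = v₂) (hP : Progress A B v₁ v₂ k σ) :
    Progress A B v₁ v₂ (k + 1) ((Cmd.seq (.search 16 (.read 8 (.const 0) (.var 7)))
      (.ite (.le (.const 0) (.var 16)) (.seq .iteration .output) .skip)).run σ) := by
  let e : Expr := .read 8 (.const 0) (.var 7)
  let σ₁ := (Cmd.search 16 e).run σ
  have hrun : (Cmd.seq (.search 16 (.read 8 (.const 0) (.var 7)))
      (.ite (.le (.const 0) (.var 16)) (.seq .iteration .output) .skip)).run σ =
      if (Expr.le (.const 0) (.var 16)).eval σ₁ ≠ 0 then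
        Cmd.output.run (Cmd.iteration.run σ₁) else σ₁ := rfl
  have hs := run_search (σ := σ) (n := n) h.cols (x := 16) (e := e) (by norm_num) (by norm_num)
    (P := fun l => realVec (σ.vec n 8 0) l ≠ 0)
    (fun τ l hτv hτa hτ7 => by
      simp only [e, Expr.eval, hτa, hτ7, realVec, State.vec]
      simp)
  have ha₁ : σ₁.arr = σ.arr := funext fun b => Cmd.run_arr _ _ rfl
  have h0₁ : σ₁.var 0 = σ.var 0 := Cmd.run_var _ _ rfl
  rw [hrun]
  rcases hs with ⟨hx, hnone⟩ | ⟨l, hx, hl⟩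
  · have hx' : σ₁.var 16 = -1 := hx
    rw [if_neg (by simp [Expr.eval, hx'])]
    rcases hP with ⟨hw, -⟩ | ⟨hw, c, hc, hrest⟩
    · exact absurd (funext fun l => by simpa using hnone l) hw
    · right
      have hrow : ∀ a i, σ₁.row n a i = σ.row n a i := fun a i => by
        funext j; simp [State.row, ha₁]
      simp only [State.vec_congr (congrFun ha₁ 8), hrow, ha₁, h0₁]
      exact ⟨hw, c, hc, hrest⟩
  · have hx' : σ₁.var 16 = ((l : ℕ) : ℤ) := hx
    rw [if_pos (by simp [Expr.eval, hx'])]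
    rcases hP with ⟨hw, hk, hpart, hcur⟩ | ⟨hw, -⟩
    · have h₁ : Holds σ₁ (stacked A B) := h.run (p := .search 16 e) rfl rfl rfl
      have hv₁ : ∀ b i, σ₁.vec n b i = σ.vec n b i := fun b i =>
        State.vec_congr (congrFun ha₁ b)
      have hTU' : (stacked A B).IsTotallyUnimodular := hTU.submatrix _ _
      have hr' : (realMat (stacked A B)).rank = n := by
        rw [realMat_stacked]
        exact (Matrix.rank_submatrix _ finSumFinEquiv.symm (Equiv.refl _)).trans hr
      obtain ⟨hstep, hw'⟩ := run_iteration hTU' hD hr' h₁ (by rw [hv₁]; exact hw)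
      rw [realMat_stacked] at hstep
      have hstep := hstep.reindex
      rw [hv₁] at hstep hw'
      set σ₂ := Cmd.iteration.run σ₁ with hσ₂
      set x := σ₂.vec n 10 0
      set t := σ₂.var 11
      set w := σ.vec n 8 0
      have hk₂ : σ₂.var 0 = k := ((Cmd.run_var _ _ rfl).trans h0₁).trans hk
      have hn₂ : σ₂.var 2 = n := (Cmd.run_var _ _ rfl).trans h₁.cols
      have ha0 : ∀ i, σ₂.vec n 0 i = σ.vec n 0 i := fun i =>
        (State.vec_congr (Cmd.run_arr _ _ rfl)).trans (hv₁ 0 i)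
      have ha2 : ∀ i, σ₂.vec n 2 i = σ.vec n 2 i := fun i =>
        (State.vec_congr (Cmd.run_arr _ _ rfl)).trans (hv₁ 2 i)
      have ha3 : σ₂.vec n 3 0 = v₂ :=
        ((State.vec_congr (Cmd.run_arr _ _ rfl)).trans (hv₁ 3 0)).trans h3
      have ha1 : σ₂.arr 1 = σ.arr 1 := (Cmd.run_arr _ _ rfl).trans (congrFun ha₁ 1)
      obtain ⟨o0, o1, o2, o3, o4, o5, o6⟩ := run_output hn₂ hk₂
      have h8 : (Cmd.output.run σ₂).vec n 8 0 = w - t • x :=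
        (State.vec_congr (Cmd.run_arr _ _ rfl)).trans hw'
      set τ := Cmd.output.run σ₂
      -- The remainder is `u` minus a combination of circuits, all of which lie in `ker A`.
      have hker : (realMat A).mulVec (realVec w) = 0 := by
        have hsum := sum_partialExecution hpart k le_rfl
        rw [hcur]
        have h1 : realVec v₂ - σ.row n 2 k = (realVec v₂ - realVec v₁) -
            ∑ j ∈ Finset.range k, (σ.arr 1 j 0 : ℝ) • σ.row n 0 j := by
          rw [hsum]; abel
        rw [h1, Matrix.mulVec_sub, hu, Matrix.mulVec_sum, zero_sub, neg_eq_zero]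
        refine Finset.sum_eq_zero fun j hj => ?_
        rw [Matrix.mulVec_smul, (hpart.2 j (Finset.mem_range.1 hj)).2.1.1, smul_zero]
      have g0 : τ.row n 0 k = realVec x := congrArg realVec o1
      have g1 : ∀ i < k, τ.row n 0 i = σ.row n 0 i := fun i hi => by
        have := o2 i (by exact_mod_cast hi.ne)
        rw [ha0] at this
        exact congrArg realVec this
      have g2 : ∀ i < k, (τ.arr 1 i 0 : ℝ) = (σ.arr 1 i 0 : ℝ) := fun i hi => by
        rw [o4 i (by exact_mod_cast hi.ne), ha1]
      have g3 : ∀ i ≤ k, τ.row n 2 i = σ.row n 2 i := fun i hi => by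
        have := o6 i (by exact_mod_cast (Nat.lt_succ_of_le hi).ne)
        rw [ha2] at this
        exact congrArg realVec this
      have g4 : τ.row n 2 (k + 1) = realVec v₂ - (realVec w - (t : ℝ) • realVec x) := by
        have : τ.row n 2 (k + 1) = realVec (v₂ - (w - t • x)) := by
          rw [← ha3, ← hw']; exact congrArg realVec o5
        rw [this, ← realVec_sub_smul]
        ext j; simp [realVec]
      have g5 : (τ.arr 1 k 0 : ℝ) = t := by rw [o3]
      by_cases hsp : SpansKernel (Matrix.fromRows (realMat A) (realMat B)) (realVec w)
      · have hf := hstep.finalStep hker hw hsp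
        have hwt := hf.smul_eq.2
        right
        refine ⟨by rw [h8, realVec_sub_smul, ← hwt, sub_self], k + 1, o0, ?_, ?_⟩
        · refine Or.inr ⟨?_, k, (fun i => realVec v₂ - σ.row n 2 i), rfl,
            hpart.congr (fun _ _ => rfl) g1 g2, ?_⟩
          -- Either no iteration has run and the remainder is `u` itself, or the first one needed a
          -- proper subset of the support of `B u`, which would be empty.
          · intro hu0
            rcases Nat.eq_zero_or_pos k with hk0 | hk0
            · have h1 := hpart.1
              rw [hk0] at hcur
              rw [hcur] at hw
              exact hw (h1.trans hu0)
            · have h1 := (hpart.2 0 hk0).2.2.1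
              rw [hpart.1, hu0, Matrix.mulVec_zero, Function.support_zero] at h1
              exact h1.2 (Set.empty_subset _)
          · change FinalStep _ _ (realVec v₂ - σ.row n 2 k) (τ.row n 0 k) (τ.arr 1 k 0 : ℝ)
            rw [g0, g5, ← hcur]
            exact hf
        · have hpart' := hpart.congr (w' := fun i => realVec v₂ - σ.row n 2 i)
            (fun _ _ => rfl) g1 g2
          have hpt : ∀ j ≤ k, walkPoint (realVec v₁) (fun i => τ.row n 0 i)
              (fun i => (τ.arr 1 i 0 : ℝ)) j = σ.row n 2 j := fun j hj => by
            rw [walkPoint, sum_partialExecution hpart' j hj]; abel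
          intro j hj
          rcases Nat.le_succ_iff.1 hj with hj | rfl
          · rw [hpt j hj, g3 j hj]
          · have hsucc : walkPoint (realVec v₁) (fun i => τ.row n 0 i)
                (fun i => (τ.arr 1 i 0 : ℝ)) (k + 1) = walkPoint (realVec v₁)
                (fun i => τ.row n 0 i) (fun i => (τ.arr 1 i 0 : ℝ)) k +
                (τ.arr 1 k 0 : ℝ) • τ.row n 0 k := by
              rw [walkPoint, walkPoint, Finset.sum_range_succ, add_assoc]
            rw [hsucc, hpt k le_rfl, g4, g0, g5, ← hwt, hcur]
            abel
      · have hl' := hstep.loopStep hker hw hsp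
        have hnz : realVec w - (t : ℝ) • realVec x ≠ 0 := by
          intro h0
          have hss := hl'.2.2.1
          have h1 := support_sub_ssubset hl'.2.2.2.2.1 hss.1
          obtain ⟨j, hj, hj'⟩ := Set.exists_of_ssubset hss
          have h2 := congrArg (fun y => (realMat B).mulVec y j) h0
          have h3 : (realMat B).mulVec (realVec x) j = 0 := by simpa using hj'
          simp only [Matrix.mulVec_sub, Matrix.mulVec_smul, Matrix.mulVec_zero, Pi.sub_apply,
            Pi.smul_apply, h3, smul_zero, sub_zero, Pi.zero_apply] at h2
          exact hj h2
        left
        refine ⟨by rw [h8, realVec_sub_smul]; exact hnz, o0, ?_, ?_⟩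
        · refine hpart.snoc (fun i hi => by rw [g3 i hi]) g1 g2 ?_
          rw [g0, g5, g4, ← hcur, sub_sub_cancel]
          exact hl'
        · rw [h8, realVec_sub_smul, g4, sub_sub_cancel]
    · exact absurd (congrFun hw l) hl

theorem run_main (hTU : (Matrix.fromRows A B).IsTotallyUnimodular)
    (hr : (Matrix.fromRows (realMat A) (realMat B)).rank = n)
    (hu : (realMat A).mulVec (realVec v₂ - realVec v₁) = 0) {σ : State}
    (h2 : σ.var 2 = n) (h3 : σ.var 3 = ((mA + mB : ℕ) : ℤ)) (h4 : σ.var 4 = mA)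
    (hA : σ.arr 0 = toArray A) (hB : σ.arr 1 = toArray B)
    (hv₁ : σ.vec n 2 0 = v₁) (hv₂ : σ.vec n 3 0 = v₂) :
    ∃ c : ℕ, (Cmd.main.run σ).var 0 = c ∧
      IsOutput (realMat A) (realMat B) (realVec v₂ - realVec v₁) c
        (fun i => (Cmd.main.run σ).row n 0 i) (fun i => ((Cmd.main.run σ).arr 1 i 0 : ℝ)) ∧
      ∀ j ≤ c, (Cmd.main.run σ).row n 2 j =
        walkPoint (realVec v₁) (fun i => (Cmd.main.run σ).row n 0 i)
          (fun i => ((Cmd.main.run σ).arr 1 i 0 : ℝ)) j := by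
  have hD : ∀ i j, IsSign (stacked A B i j) := fun i j => by
    obtain ⟨s, hs⟩ := hTU.apply (finSumFinEquiv.symm i) j
    change _ = stacked A B i j at hs
    rw [← hs]
    cases s
    · exact Or.inl rfl
    · exact Or.inr (Or.inr rfl)
    · exact Or.inr (Or.inl rfl)
  let σ₁ := Cmd.stack.run σ
  let σ₂ := (Cmd.fill 8 (.const 0) (.sub (.read 3 (.const 0) (.var 6))
    (.read 2 (.const 0) (.var 6)))).run σ₁
  let σ₃ := σ₂.setVar 0 0
  have hrun : Cmd.main.run σ = (Cmd.forTo 14 2 (.seq (.search 16 (.read 8 (.const 0) (.var 7)))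
    (.ite (.le (.const 0) (.var 16)) (.seq .iteration .output) .skip))).run σ₃ := rfl
  have h₁ : Holds σ₁ (stacked A B) := run_stack h2 h3 h4 hA hB
  have h₂ : Holds σ₂ (stacked A B) := h₁.run (p := .fill 8 (.const 0)
    (.sub (.read 3 (.const 0) (.var 6)) (.read 2 (.const 0) (.var 6)))) rfl rfl rfl
  have h₃ : Holds σ₃ (stacked A B) := h₂.congr rfl rfl rfl
  have e2 : σ₁.vec n 2 0 = v₁ := (State.vec_congr (Cmd.run_arr _ _ rfl)).trans hv₁
  have e3 : σ₁.vec n 3 0 = v₂ := (State.vec_congr (Cmd.run_arr _ _ rfl)).trans hv₂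
  have e2' : σ₃.vec n 2 0 = v₁ := (State.vec_congr (Cmd.run_arr _ σ₁ rfl)).trans e2
  have e3' : σ₃.vec n 3 0 = v₂ := (State.vec_congr (Cmd.run_arr _ σ₁ rfl)).trans e3
  have e8 : σ₃.vec n 8 0 = v₂ - v₁ :=
    (run_fill (σ := σ₁) h₁.cols (a := 8) (r := .const 0)
      (e := .sub (.read 3 (.const 0) (.var 6)) (.read 2 (.const 0) (.var 6))) (ρ := 0)
      (f := v₂ - v₁) (fun _ _ => rfl) (fun τ j _ h6 hb _ _ => by
        simp only [Expr.eval, h6, hb 3 (by norm_num), hb 2 (by norm_num), ← e2, ← e3]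
        rfl)).1
  have hsub : realVec (v₂ - v₁) = realVec v₂ - realVec v₁ := by ext j; simp [realVec]
  have hrow : σ₃.row n 2 0 = realVec v₁ := congrArg realVec e2'
  have hP₀ : Progress A B v₁ v₂ 0 σ₃ := by
    by_cases h0 : realVec (v₂ - v₁) = 0
    · right
      refine ⟨by rw [e8]; exact h0, 0, rfl, Or.inl ⟨by rw [← hsub]; exact h0, rfl⟩, fun j hj => ?_⟩
      obtain rfl : j = 0 := by omega
      rw [hrow]
      simp [walkPoint]
    · left
      refine ⟨by rw [e8]; exact h0, rfl, ⟨?_, fun i hi => absurd hi (Nat.not_lt_zero _)⟩, ?_⟩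
      · change realVec v₂ - σ₃.row n 2 0 = _
        rw [hrow]
      · rw [e8, hrow, hsub]
  have key := Cmd.run_for (x := 14) (v := 2)
    (p := .seq (.search 16 (.read 8 (.const 0) (.var 7)))
      (.ite (.le (.const 0) (.var 16)) (.seq .iteration .output) .skip)) (σ := σ₃) h₃.cols
    (fun k τ => Progress A B v₁ v₂ k τ) hP₀
    (fun k τ hk _ hτv hτa hI => run_round hTU hD hr hu
      (h₃.congr (hτv 2 rfl) (hτv 3 rfl) (hτa 4 rfl))
      ((State.vec_congr (hτa 3 rfl)).trans e3') hI)
  rw [hrun]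
  rcases key with ⟨hw, hk, hpart, hcur⟩ | ⟨-, hrest⟩
  -- The main loop runs `n` rounds; that many non-final iterations would contradict
  -- `partialExecution_length`.
  · exfalso
    have hu0 : realVec v₂ - realVec v₁ ≠ 0 := by
      intro hu0
      rcases Nat.eq_zero_or_pos n with hn | hn
      · subst hn; exact hw (Subsingleton.elim _ _)
      · have h1 := (hpart.2 0 hn).2.2.1
        rw [hpart.1, hu0, Matrix.mulVec_zero, Function.support_zero] at h1
        exact h1.2 (Set.empty_subset _)
    have hrem : IsRemainder A B (realVec v₂ - realVec v₁) (realVec v₂ - realVec v₁) :=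
      ⟨hu, hu0, .refl _, fun j => ⟨v₂ j - v₁ j, by simp [realVec]⟩⟩
    have := partialExecution_length hTU hr hrem hpart
    omega
  · exact hrest

end Main

/-! ## The time bound -/

/-- The program, with the dimensions of the stacked matrix computed first. -/
def walkProgram : Program :=
  .seq (.assign 3 (.add (.var 0) (.var 1))) (.seq (.assign 4 (.var 0)) Cmd.main.compile)

/-- The polynomial bounding the running time of `walkProgram`. -/
noncomputable def timeBound : Polynomial ℕ :=
  Cmd.main.steps * (300 * (100 * (Cmd.main.steps + 1) + Polynomial.X + 1) + 1) +
    (4 * Polynomial.X + 6)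

theorem bitLength_natCast_le (k : ℕ) : bitLength (k : ℤ) ≤ k + 1 := by
  simp only [bitLength, Int.natAbs_natCast]
  exact Nat.succ_le_succ (Nat.size_le.2 Nat.lt_two_pow_self)

theorem natAbs_le_of_bitLength_le {z : ℤ} {L : ℕ} (h : bitLength z ≤ L) : z.natAbs ≤ 2 ^ L := by
  have : z.natAbs.size ≤ L := by simp only [bitLength] at h; omega
  exact (Nat.size_le.1 this).le

theorem natAbs_toArray_le {r s : ℕ} {M : Matrix (Fin r) (Fin s) ℤ} {L : ℕ}
    (h : ∀ i j, bitLength (M i j) ≤ L) (i j : ℤ) : (toArray M i j).natAbs ≤ 2 ^ L := by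
  rw [toArray]
  split
  · exact natAbs_le_of_bitLength_le (h _ _)
  · simp

section

variable {mA mB n : ℕ} (A : Matrix (Fin mA) (Fin n) ℤ) (B : Matrix (Fin mB) (Fin n) ℤ)
  (v₁ v₂ : Fin n → ℤ)

theorem bitLength_le_inputSize :
    (∀ i j, bitLength (A i j) ≤ inputSize A B v₁ v₂) ∧
    (∀ i j, bitLength (B i j) ≤ inputSize A B v₁ v₂) ∧
    (∀ j, bitLength (v₁ j) ≤ inputSize A B v₁ v₂) ∧
    ∀ j, bitLength (v₂ j) ≤ inputSize A B v₁ v₂ := by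
  have hmat : ∀ {r : ℕ} (M : Matrix (Fin r) (Fin n) ℤ) (i : Fin r) (j : Fin n),
      bitLength (M i j) ≤ ∑ i, ∑ j, bitLength (M i j) := fun M i j =>
    (Finset.single_le_sum (f := fun j => bitLength (M i j)) (fun _ _ => Nat.zero_le _)
      (Finset.mem_univ j)).trans
    (Finset.single_le_sum (f := fun i => ∑ j, bitLength (M i j)) (fun _ _ => Nat.zero_le _)
      (Finset.mem_univ i))
  have hvec : ∀ (v : Fin n → ℤ) (j : Fin n), bitLength (v j) ≤ ∑ j, bitLength (v j) := fun v j =>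
    Finset.single_le_sum (f := fun j => bitLength (v j)) (fun _ _ => Nat.zero_le _)
      (Finset.mem_univ j)
  refine ⟨fun i j => ?_, fun i j => ?_, fun j => ?_, fun j => ?_⟩
  · have := hmat A i j; rw [inputSize]; omega
  · have := hmat B i j; rw [inputSize]; omega
  · have := hvec v₁ j; rw [inputSize]; omega
  · have := hvec v₂ j; rw [inputSize]; omega

theorem dim_le_inputSize : mA + mB + n ≤ inputSize A B v₁ v₂ := by
  rw [inputSize]; omega

theorem inputState_boundedBy :
    (inputState A B v₁ v₂).BoundedBy (2 ^ inputSize A B v₁ v₂) := by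
  have hdim := dim_le_inputSize A B v₁ v₂
  have hpow : inputSize A B v₁ v₂ < 2 ^ inputSize A B v₁ v₂ := Nat.lt_two_pow_self
  obtain ⟨hA, hB, h₁, h₂⟩ := bitLength_le_inputSize A B v₁ v₂
  refine ⟨fun x => ?_, fun a i j => ?_⟩
  · match x with
    | 0 => simp only [inputState, Int.natAbs_natCast]; omega
    | 1 => simp only [inputState, Int.natAbs_natCast]; omega
    | 2 => simp only [inputState, Int.natAbs_natCast]; omega
    | _ + 3 => simp [inputState]
  · match a with
    | 0 => exact natAbs_toArray_le hA i j
    | 1 => exact natAbs_toArray_le hB i j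
    | 2 => exact natAbs_toArray_le (fun _ => h₁) i j
    | 3 => exact natAbs_toArray_le (fun _ => h₂) i j
    | _ + 4 => simp [inputState]

/-- The memory after the dimensions have been computed. -/
def preparedState : State :=
  ((inputState A B v₁ v₂).setVar 3 ((mA : ℤ) + mB)).setVar 4 mA

/-- All inputs are at most `2 ^ L`, and each of at most `S` steps enlarges values by a factor of at
most 100. So `2 ^ L * 100 ^ S` caps every value in memory, and its bit length is polynomial because
`S` is polynomial in `L`. -/
theorem exec_walkProgram : ∃ c, Exec walkProgram (inputState A B v₁ v₂)
      (Cmd.main.run (preparedState A B v₁ v₂)) c ∧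
    c ≤ timeBound.eval (inputSize A B v₁ v₂) := by
  set L := inputSize A B v₁ v₂ with hL
  have hdim : mA + mB + n ≤ L := dim_le_inputSize A B v₁ v₂
  have hpow : L < 2 ^ L := Nat.lt_two_pow_self
  have h3 : ((mA : ℤ) + mB).natAbs ≤ 2 ^ L := by omega
  have h4 : (mA : ℤ).natAbs ≤ 2 ^ L := by omega
  have hb : (preparedState A B v₁ v₂).BoundedBy (2 ^ L) :=
    ((inputState_boundedBy A B v₁ v₂).setVar 3 h3).setVar 4 h4
  set S := Cmd.main.steps.eval L with hS
  -- The crude estimate `100 < 2 ^ 100` suffices and keeps the exponent a visible polynomial.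
  have hsize : (100 * (2 ^ L * 100 ^ S)).size ≤ 100 * (S + 1) + L := by
    rw [Nat.size_le]
    have h1 : (100 : ℕ) ^ (S + 1) < (2 ^ 100) ^ (S + 1) :=
      Nat.pow_lt_pow_left (by norm_num) (Nat.succ_ne_zero _)
    calc 100 * (2 ^ L * 100 ^ S) = 100 ^ (S + 1) * 2 ^ L := by ring
      _ < (2 ^ 100) ^ (S + 1) * 2 ^ L := Nat.mul_lt_mul_of_pos_right h1 (by positivity)
      _ = 2 ^ (100 * (S + 1) + L) := by rw [← pow_mul, ← pow_add]
  obtain ⟨c, he, hc, -⟩ := Cmd.exec_compile (K := 100) (N := L) (Mcap := 2 ^ L * 100 ^ S)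
    (C := 300 * (100 * (S + 1) + L + 1) + 1) (by norm_num) (by omega) Cmd.main_wellFormed
    (M := 2 ^ L) (σ := preparedState A B v₁ v₂) Nat.one_le_two_pow hb le_rfl
    (by simp only [preparedState, State.setVar, inputState]; norm_num; omega)
    (by simp only [preparedState, State.setVar]; norm_num; omega)
  have e1 := Exec.assign (inputState A B v₁ v₂) 3 (.add (.var 0) (.var 1))
  have e2 := Exec.assign ((inputState A B v₁ v₂).setVar 3 ((mA : ℤ) + mB)) 4 (.var 0)
  refine ⟨_, .seq e1 (.seq e2 he), ?_⟩
  have b1 := bitLength_natCast_le mA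
  have b2 := bitLength_natCast_le mB
  have b3 := bitLength_natCast_le (mA + mB)
  have c1 : (Expr.add (.var 0) (.var 1)).cost (inputState A B v₁ v₂) =
      bitLength (mA : ℤ) + bitLength (mB : ℤ) + bitLength ((mA + mB : ℕ) : ℤ) := by
    simp [Expr.cost, Expr.eval, inputState]
  have c2 : (Expr.var 0).cost ((inputState A B v₁ v₂).setVar 3 ((mA : ℤ) + mB)) =
      bitLength (mA : ℤ) := rfl
  have hT : timeBound.eval L =
      S * (300 * (100 * (S + 1) + L + 1) + 1) + (4 * L + 6) := by
    simp [timeBound, ← hS]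
  rw [← hS] at hc
  rw [c1, c2, hT]
  omega

end

end CircuitWalk

/-! ### The theorem for real data -/

theorem corollary4p14 :
    ∃ (prog : Program) (p : Polynomial ℕ),
      ∀ (mA mB n : ℕ) (A : Matrix (Fin mA) (Fin n) ℝ) (B : Matrix (Fin mB) (Fin n) ℝ)
        (b : Fin mA → ℝ) (d : Fin mB → ℝ),
        (Matrix.fromRows A B).rank = n →
        (Matrix.fromRows A B).IsTotallyUnimodular →
        IsIntegralPolyhedron (polyhedron A B b d) →
        ∀ v₁ ∈ polyhedron A B b d, ∀ v₂ ∈ polyhedron A B b d,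
          IsIntegralVector v₁ → IsIntegralVector v₂ →
          (v₂ - v₁ ≠ 0 → ∀ (t : ℕ) (w g : ℕ → Fin n → ℝ) (lam : ℕ → ℝ),
            IsPartialExecution A B (v₂ - v₁) t w g lam →
              t + 1 ≤ n - A.rank ∧
              ((∃ g' lam', FinalStep A B (w t) g' lam') ∨
                ∃ g' lam' w', LoopStep A B (w t) g' lam' w')) ∧
          (∀ (k : ℕ) (g : ℕ → Fin n → ℝ) (lam : ℕ → ℝ),
            IsOutput A B (v₂ - v₁) k g lam →
              k ≤ n - A.rank ∧
              IsSignCompatibleCircuitWalk A B v₁ v₂ k (walkPoint v₁ g lam) g lam ∧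
              ∀ j ≤ k, IsIntegralVector (walkPoint v₁ g lam j) ∧
                walkPoint v₁ g lam j ∈ polyhedron A B b d) ∧
          (∃ (σ : State) (c k : ℕ),
            Exec prog
              (inputState (A.map Int.floor) (B.map Int.floor)
                (fun j => ⌊v₁ j⌋) (fun j => ⌊v₂ j⌋)) σ c ∧
            c ≤ p.eval
              (inputSize (A.map Int.floor) (B.map Int.floor)
                (fun j => ⌊v₁ j⌋) (fun j => ⌊v₂ j⌋)) ∧
            σ.var 0 = k ∧
            IsOutput A B (v₂ - v₁) k (fun i => σ.row n 0 i) (fun i => (σ.arr 1 i 0 : ℝ)) ∧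
            ∀ j ≤ k, σ.row n 2 j =
              walkPoint v₁ (fun i => σ.row n 0 i) (fun i => (σ.arr 1 i 0 : ℝ)) j) := by
  refine ⟨walkProgram, timeBound, fun mA mB n A B b d hrank hTU _ v₁ hv₁ v₂ hv₂ hi₁ hi₂ => ?_⟩
  -- Entries of a totally unimodular matrix are 0, 1 or -1, so all data are casts of integers and
  -- the floors in the statement lose nothing.
  have hentry : ∀ i j, ∃ z : ℤ, Matrix.fromRows A B i j = z := fun i j => by
    obtain ⟨s, hs⟩ := hTU.apply i j
    exact ⟨s, by rw [← hs]; cases s <;> simp⟩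
  obtain ⟨A', rfl⟩ : ∃ A', A = realMat A' := by
    choose z hz using fun i j => hentry (Sum.inl i) j
    exact ⟨Matrix.of z, Matrix.ext fun i j => hz i j⟩
  obtain ⟨B', rfl⟩ : ∃ B', B = realMat B' := by
    choose z hz using fun i j => hentry (Sum.inr i) j
    exact ⟨Matrix.of z, Matrix.ext fun i j => hz i j⟩
  obtain ⟨z₁, rfl⟩ := hi₁.exists_realVec
  obtain ⟨z₂, rfl⟩ := hi₂.exists_realVec
  -- Minors commute with the cast, which is injective, so total unimodularity descends to the
  -- integers.
  have hTU' : (Matrix.fromRows A' B').IsTotallyUnimodular := by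
    intro k f g hf hg
    obtain ⟨s, hs⟩ := hTU k f g hf hg
    refine ⟨s, ?_⟩
    have h1 : (Matrix.fromRows (realMat A') (realMat B')).submatrix f g =
        (Int.castRingHom ℝ).mapMatrix ((Matrix.fromRows A' B').submatrix f g) := by
      rw [← realMat_fromRows]; rfl
    rw [h1, ← RingHom.map_det, eq_intCast] at hs
    have h2 : ((s : ℤ) : ℝ) = (s : ℝ) := by cases s <;> simp
    rw [← h2] at hs
    exact Int.cast_injective hs
  have hu : (realMat A').mulVec (realVec z₂ - realVec z₁) = 0 := by
    rw [Matrix.mulVec_sub, hv₁.1, hv₂.1, sub_self]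
  refine ⟨fun hne t w g lam hp => ?_, fun k g lam ho =>
    isOutput_spec hTU' hrank hv₁ hv₂ hi₁ hi₂ ho, ?_⟩
  · have hrem : IsRemainder A' B' (realVec z₂ - realVec z₁) (realVec z₂ - realVec z₁) :=
      ⟨hu, hne, .refl _, hi₂.sub hi₁⟩
    have hw := (isRemainder_partialExecution hTU' hrank hrem hp t le_rfl).1
    exact ⟨partialExecution_length hTU' hrank hrem hp,
      exists_step hTU' hrank hw.ker hw.ne_zero⟩
  · have eA : (realMat A').map Int.floor = A' := by ext i j; simp [realMat]
    have eB : (realMat B').map Int.floor = B' := by ext i j; simp [realMat]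
    have e₁ : (fun j => ⌊realVec z₁ j⌋) = z₁ := by ext j; simp [realVec]
    have e₂ : (fun j => ⌊realVec z₂ j⌋) = z₂ := by ext j; simp [realVec]
    rw [eA, eB, e₁, e₂]
    obtain ⟨c, he, hc⟩ := exec_walkProgram A' B' z₁ z₂
    obtain ⟨k, h1, h2, h3⟩ := run_main (v₁ := z₁) (v₂ := z₂) hTU' hrank hu
      (σ := preparedState A' B' z₁ z₂) rfl (by simp [preparedState, State.setVar]) rfl rfl rfl
      (funext fun j => toArray_apply (Matrix.of fun _ : Fin 1 => z₁) 0 j)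
      (funext fun j => toArray_apply (Matrix.of fun _ : Fin 1 => z₂) 0 j)
    exact ⟨_, c, k, he, hc, h1, h2, h3⟩
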